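/- Let $\mathbb F$ be an algebraically closed field of characteristic zero, and let $\mathcal C$ be a strict BTC over $\mathbb F$: a semisimple $\mathbb F$-linear strict monoidal category with finite dimensional Hom-spaces and $\mathrm{End}\,\mathbf 1=\mathbb F\,1_{\mathbf 1}$, equipped with a braiding $c$ and a rigid ribbon structure. Let $d(X)\in\mathbb F$ be the resulting dimension of $X$, and for a semisimple spherical tensor category with finitely many isomorphism classes of simple objects $X_i$ (a finite one) put $\dim=\sum_i d(X_i)^2$. Let $\mathcal S\subset\mathcal C$ be a full monoidal subcategory, closed under duals, that is semisimple, symmetric ($c_{Y,X}\circ c_{X,Y}=1$ for $X,Y\in\mathcal S$), finite, and admissible: either $\mathbb F=\mathbb C$, $\mathcal S$ is a $*$-category (whose duality morphisms are adjoint to each other) and all its objects have trivial twist; or $d(X)\in\mathbb Z_{\ge 0}$ for all $X\in\mathcal S$. Here a $*$-category is a $\mathbb C$-linear monoidal category with an involutive, antilinear, contravariant, monoidal endofunctor $*$ which is the identity on objects and satisfies $s^*\circ s=0\Rightarrow s=0$. Let $\mathrm{Rep}_{\mathbb F}G\simeq\mathcal S$ be an $\mathbb F$-linear braided monoidal equivalence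 with the finite dimensional representations of a finite group $G$ (one exists by the theorem of Doplicher–Roberts and Deligne), and let $(\Gamma,m,\eta,\Delta,\varepsilon)$ be the commutative Frobenius algebra in $\mathcal S\subset\mathcal C$ corresponding under it to the left regular representation on the functions on $G$, with pointwise multiplication, $\Delta(\delta_g)=|G|\,\delta_g\otimes\delta_g$ and $\varepsilon(\delta_g)=1/|G|$. Let $\mathcal C\rtimes_0\mathcal S$ be the category with the objects of $\mathcal C$, $\mathrm{Hom}_{\mathcal C\rtimes_0\mathcal S}(X,Y)=\mathrm{Hom}_{\mathcal C}(\Gamma\otimes X,Y)$, composition $t\,\tilde\circ\,s=t\circ(1_\Gamma\otimes s)\circ(\Delta\otimes 1_X)$, the tensor product of $\mathcal C$ on objects, and $s\,\tilde\otimes\,t=(s\otimes t)\circ(1_\Gamma\otimes c_{\Gamma,X}\otimes 1_Z)\circ(\Delta\otimes 1_X\otimes 1_Z)$ for $s:X\to Y$, $t:Z\to T$. Let $\mathcal C\rtimes\mathcal S$ be its idempotent completion, with objects $(X,p)$, $p=p^2\in\mathrm{End}_{\mathcal C\rtimes_0\mathcal S}(X)$, and with $(X,p)\otimes(Y,q)=(X\otimes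 Y,p\,\tilde\otimes\,q)$. Let $\iota$ be the functor $X\mapsto X$, $s\mapsto\varepsilon\otimes s$ from $\mathcal C$ to $\mathcal C\rtimes_0\mathcal S$, and also its composite with $X\mapsto(X,1_X)$, from $\mathcal C$ to $\mathcal C\rtimes\mathcal S$. Then: 1. $\mathcal C\rtimes_0\mathcal S$ and $\mathcal C\rtimes\mathcal S$ are strict $\mathbb F$-linear tensor categories with finite dimensional Hom-spaces and $\mathrm{End}\,\mathbf 1=\mathbb F\,1_{\mathbf 1}$; each carries a spherical structure extending that of $\mathcal C$ along $\iota$; and $\mathcal C\rtimes\mathcal S$ is semisimple. 2. If $\mathbb F=\mathbb C$, $\mathcal C$ is a $*$-category and $\Delta=m^*$, $\varepsilon=\eta^*$, then $\mathcal C\rtimes_0\mathcal S$ and $\mathcal C\rtimes\mathcal S$ carry positive $*$-structures extending that of $\mathcal C$ along $\iota$. 3. Both functors $\iota$ are strict monoidal, and $\iota:\mathcal C\to\mathcal C\rtimes\mathcal S$ is faithful and injective on objects. 4. $\mathrm{Aut}(\Gamma,m,\eta)=\{g\in\mathrm{End}\,\Gamma\mid g\circ m=m\circ(g\otimes g),\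 g\circ\eta=\eta\}$ is a group, isomorphic to $G$. It acts by strict monoidal automorphisms on $\mathcal C\rtimes_0\mathcal S$, via $\gamma_g(X)=X$ and $\gamma_g(s)=s\circ(g^{-1}\otimes 1_X)$ for $s\in\mathrm{Hom}_{\mathcal C}(\Gamma\otimes X,Y)$, and on $\mathcal C\rtimes\mathcal S$, via the same formula on morphisms and $\gamma_g((X,p))=(X,\gamma_g(p))$. For the subcategories of strictly fixed objects and morphisms, $\iota$ induces a strict monoidal isomorphism of categories $\mathcal C\cong(\mathcal C\rtimes_0\mathcal S)^G$ and a strict monoidal functor $\mathcal C\to(\mathcal C\rtimes\mathcal S)^G$ that is an equivalence $\mathcal C\simeq(\mathcal C\rtimes\mathcal S)^G$. 5. $\dim\mathcal S=|G|$. If $\mathcal C$ is finite, then so is $\mathcal C\rtimes\mathcal S$, and $\dim\mathcal C\rtimes\mathcal S=\dim\mathcal C/|G|=\dim\mathcal C/\dim\mathcal S$. -/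

import Mathlib

open CategoryTheory MonoidalCategory Limits Idempotents

universe w v u

noncomputable section

namespace GaloisExt

set_option linter.unusedSectionVars false

/-! ### Strict monoidal categories and strict monoidal functors -/

section strict

variable {C : Type*} [Category* C] [MonoidalCategory C] {D : Type*} [Category* D]
  [MonoidalCategory D]

/-- A monoidal category is strict if its tensor product is associative and unital on the nose, the
associativity and unit constraints being identities. -/
class IsStrictMonoidal (C : Type*) [Category* C] [MonoidalCategory C] : Prop where
  tensor_assoc (X Y Z : C) : (X ⊗ Y) ⊗ Z = X ⊗ (Y ⊗ Z)
  unit_tensor (X : C) : 𝟙_ C ⊗ X = X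
  tensor_unit (X : C) : X ⊗ 𝟙_ C = X
  associator_eq (X Y Z : C) : (α_ X Y Z).hom = eqToHom (tensor_assoc X Y Z)
  leftUnitor_eq (X : C) : (λ_ X).hom = eqToHom (unit_tensor X)
  rightUnitor_eq (X : C) : (ρ_ X).hom = eqToHom (tensor_unit X)

/-- A strict monoidal functor: it preserves the unit, the tensor products of objects and of
morphisms, and the constraints on the nose. -/
structure IsStrictMonoidalFunctor (J : C ⥤ D) : Prop where
  obj_unit : J.obj (𝟙_ C) = 𝟙_ D
  obj_tensor (X Y : C) : J.obj (X ⊗ Y) = J.obj X ⊗ J.obj Y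
  map_tensor {X Y X' Y' : C} (f : X ⟶ Y) (g : X' ⟶ Y') :
    HEq (J.map (f ⊗ₘ g)) (J.map f ⊗ₘ J.map g)
  map_associator (X Y Z : C) :
    HEq (J.map (α_ X Y Z).hom) (α_ (J.obj X) (J.obj Y) (J.obj Z)).hom
  map_leftUnitor (X : C) : HEq (J.map (λ_ X).hom) (λ_ (J.obj X)).hom
  map_rightUnitor (X : C) : HEq (J.map (ρ_ X).hom) (ρ_ (J.obj X)).hom

end strict

/-! ### Pivotal, spherical and ribbon structures -/

section pivotal

variable (C : Type*) [Category* C] [MonoidalCategory C]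

/-- A pivotal structure: every object `X` has a chosen object `X*` which is a dual of `X` on both
sides, by `ev : X* ⊗ X ⟶ 𝟙`, `coev : 𝟙 ⟶ X ⊗ X*` and `evTilde : X ⊗ X* ⟶ 𝟙`,
`coevTilde : 𝟙 ⟶ X* ⊗ X`, such that the two resulting duality functors coincide as monoidal
functors: they agree on morphisms, and so do the two canonical isomorphisms
`Y* ⊗ X* ≅ (X ⊗ Y)*` and `𝟙 ≅ 𝟙*`. -/
structure PivotalStructure where
  dual : C → C
  rightPairing (X : C) : ExactPairing X (dual X)
  leftPairing (X : C) : ExactPairing (dual X) X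
  mate_eq {X Y : C} (f : X ⟶ Y) :
    @rightAdjointMate C _ _ X Y { rightDual := dual X, exact := rightPairing X }
        { rightDual := dual Y, exact := rightPairing Y } f =
      @leftAdjointMate C _ _ X Y { leftDual := dual X, exact := leftPairing X }
        { leftDual := dual Y, exact := leftPairing Y } f
  tensor_eq (X Y : C) : ∃ e : dual Y ⊗ dual X ≅ dual (X ⊗ Y),
    e.hom ▷ (X ⊗ Y) ≫ (rightPairing (X ⊗ Y)).evaluation' =
        (@ExactPairing.tensor C _ _ X Y (dual X) (dual Y)
          (rightPairing X) (rightPairing Y)).evaluation' ∧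
      (X ⊗ Y) ◁ e.hom ≫ (leftPairing (X ⊗ Y)).evaluation' =
        (@ExactPairing.tensor C _ _ (dual Y) (dual X) Y X
          (leftPairing Y) (leftPairing X)).evaluation'
  unit_eq : ∃ e : 𝟙_ C ≅ dual (𝟙_ C),
    e.hom ▷ 𝟙_ C ≫ (rightPairing (𝟙_ C)).evaluation' = (λ_ (𝟙_ C)).hom ∧
      𝟙_ C ◁ e.hom ≫ (leftPairing (𝟙_ C)).evaluation' = (λ_ (𝟙_ C)).hom

namespace PivotalStructure

variable {C} (P : PivotalStructure C)

def ev (X : C) : P.dual X ⊗ X ⟶ 𝟙_ C := (P.rightPairing X).evaluation'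

def coev (X : C) : 𝟙_ C ⟶ X ⊗ P.dual X := (P.rightPairing X).coevaluation'

def evTilde (X : C) : X ⊗ P.dual X ⟶ 𝟙_ C := (P.leftPairing X).evaluation'

def coevTilde (X : C) : 𝟙_ C ⟶ P.dual X ⊗ X := (P.leftPairing X).coevaluation'

def leftTrace {X : C} (f : X ⟶ X) : 𝟙_ C ⟶ 𝟙_ C := P.coevTilde X ≫ P.dual X ◁ f ≫ P.ev X

def rightTrace {X : C} (f : X ⟶ X) : 𝟙_ C ⟶ 𝟙_ C := P.coev X ≫ f ▷ P.dual X ≫ P.evTilde X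

/-- A pivotal structure is spherical if the left and right traces coincide. -/
def IsSpherical : Prop := ∀ (X : C) (f : X ⟶ X), P.leftTrace f = P.rightTrace f

/-- The twist `(ev ⊗ 1) ∘ (1 ⊗ c_{X,X}) ∘ (coevTilde ⊗ 1)`. -/
def twist [BraidedCategory C] (X : C) : X ⟶ X :=
  (λ_ X).inv ≫ P.coevTilde X ▷ X ≫ (α_ _ _ _).hom ≫ P.dual X ◁ (β_ X X).hom ≫
    (α_ _ _ _).inv ≫ P.ev X ▷ X ≫ (λ_ X).hom

/-- The twist `(1 ⊗ evTilde) ∘ (c_{X,X} ⊗ 1) ∘ (1 ⊗ coev)`. -/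
def twistTilde [BraidedCategory C] (X : C) : X ⟶ X :=
  (ρ_ X).inv ≫ X ◁ P.coev X ≫ (α_ _ _ _).inv ≫ (β_ X X).hom ▷ P.dual X ≫
    (α_ _ _ _).hom ≫ X ◁ P.evTilde X ≫ (ρ_ X).hom

/-- A braided pivotal category is ribbon if its two twists coincide. -/
def IsRibbon [BraidedCategory C] : Prop := ∀ X : C, P.twist X = P.twistTilde X

/-- `J` carries the duals and the duality morphisms of `P` to those of `Q`, on the nose. -/
structure Extends {D : Type*} [Category* D] [MonoidalCategory D] (J : C ⥤ D)
    (Q : PivotalStructure D) : Prop where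
  dual_obj (X : C) : Q.dual (J.obj X) = J.obj (P.dual X)
  ev_eq (X : C) : HEq (Q.ev (J.obj X)) (J.map (P.ev X))
  coev_eq (X : C) : HEq (Q.coev (J.obj X)) (J.map (P.coev X))
  evTilde_eq (X : C) : HEq (Q.evTilde (J.obj X)) (J.map (P.evTilde X))
  coevTilde_eq (X : C) : HEq (Q.coevTilde (J.obj X)) (J.map (P.coevTilde X))

end PivotalStructure

end pivotal

/-! ### Semisimple tensor categories and their dimensions -/

section tensor

variable (F : Type u) [Field F] (D : Type v) [Category.{w} D] [Preadditive D]

/-- A semisimple category: it is abelian, and every object is a finite direct sum of simple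
objects. -/
structure IsSemisimple : Prop where
  finiteProducts : HasFiniteProducts D
  kernels : HasKernels D
  cokernels : HasCokernels D
  normalMono : IsNormalMonoCategory D
  normalEpi : IsNormalEpiCategory D
  decomposition (X : D) : ∃ (n : ℕ) (Y : Fin n → D), (∀ i, Simple (Y i)) ∧
    ∃ b : Bicone Y, Nonempty b.IsBilimit ∧ Nonempty (b.pt ≅ X)

/-- Isomorphism of simple objects. -/
def simpleSetoid : Setoid {X : D // Simple X} where
  r X Y := Nonempty (X.1 ≅ Y.1)
  iseqv :=
    { refl := fun X => ⟨Iso.refl X.1⟩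
      symm := fun ⟨e⟩ => ⟨e.symm⟩
      trans := fun ⟨e⟩ ⟨f⟩ => ⟨e ≪≫ f⟩ }

/-- The isomorphism classes of simple objects. -/
def SimpleClass : Type v := Quotient (simpleSetoid D)

/-- `∑ d(X_i)²`, over the isomorphism classes of simple objects. -/
def globalDim {F D} [Field F] [Category.{w} D] [Preadditive D] (d : D → F) : F :=
  ∑ᶠ c : SimpleClass D, d (Quotient.out c).1 ^ 2

variable [Linear F D] [MonoidalCategory D]

/-- An `F`-linear tensor category with bilinear tensor product, finite dimensional spaces of
morphisms and `End 𝟙 = F`. -/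
structure IsLinearTensor : Prop where
  preadditive : MonoidalPreadditive D
  linear : MonoidalLinear F D
  hom_finite (X Y : D) : FiniteDimensional F (X ⟶ Y)
  end_unit : Function.Bijective fun a : F => a • 𝟙 (𝟙_ D)

variable {D}

/-- The dimension `d(X) ∈ F`, determined by `ev ∘ coevTilde = d(X) • 1` in `End 𝟙 = F`. -/
def PivotalStructure.dim (P : PivotalStructure D) (X : D) : F :=
  Classical.epsilon fun a : F => P.leftTrace (𝟙 X) = a • 𝟙 (𝟙_ D)

/-- A semisimple `F`-linear spherical tensor category. -/
structure IsTC (P : PivotalStructure D) : Prop extends IsLinearTensor F D where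
  semisimple : IsSemisimple D
  spherical : P.IsSpherical

/-- A semisimple `F`-linear ribbon category. -/
structure IsBTC [BraidedCategory D] (P : PivotalStructure D) : Prop extends
    IsLinearTensor F D where
  semisimple : IsSemisimple D
  ribbon : P.IsRibbon

variable {F} in
/-- A positive `*`-operation, `F` being identified with `ℂ` by `φ`: an involutive antilinear
contravariant monoidal endofunctor which is the identity on objects, with `s* ∘ s = 0` only for
`s = 0`. -/
structure StarOperation (φ : F ≃+* ℂ) (D : Type*) [Category* D] [Preadditive D] [Linear F D]
    [MonoidalCategory D] where
  star {X Y : D} : (X ⟶ Y) → (Y ⟶ X)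
  star_star {X Y : D} (s : X ⟶ Y) : star (star s) = s
  star_comp {X Y Z : D} (s : X ⟶ Y) (t : Y ⟶ Z) : star (s ≫ t) = star t ≫ star s
  star_tensor {X Y X' Y' : D} (s : X ⟶ Y) (t : X' ⟶ Y') : star (s ⊗ₘ t) = star s ⊗ₘ star t
  star_add {X Y : D} (s t : X ⟶ Y) : star (s + t) = star s + star t
  star_smul {X Y : D} (a : F) (s : X ⟶ Y) :
    star (a • s) = φ.symm (starRingEnd ℂ (φ a)) • star s
  positive {X Y : D} (s : X ⟶ Y) : s ≫ star s = 0 → s = 0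

/-- The full subcategory on `S` is a symmetric semisimple tensor subcategory with duals. -/
structure IsSubSTC [BraidedCategory D] (P : PivotalStructure D) (S : ObjectProperty D)
    [S.IsMonoidal] : Prop where
  dual_mem (X : D) : S X → S (P.dual X)
  symmetric (X Y : D) : S X → S Y → (β_ X Y).hom ≫ (β_ Y X).hom = 𝟙 (X ⊗ Y)
  semisimple : IsSemisimple S.FullSubcategory

/-- Admissibility of `S`: either `F = ℂ`, `S` is a `*`-category whose duality morphisms are
adjoint to each other, and all its objects have trivial twist; or `F` has characteristic zero and
all dimensions in `S` are natural numbers. -/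
def IsAdmissible [BraidedCategory D] (P : PivotalStructure D) (S : ObjectProperty D)
    [S.IsMonoidal] : Prop :=
  (∃ (φ : F ≃+* ℂ) (T : StarOperation φ S.FullSubcategory),
    (∀ (X : D) (hX : S X) (hX' : S (P.dual X)),
      T.star (X := (⟨P.dual X, hX'⟩ ⊗ ⟨X, hX⟩ : S.FullSubcategory)) (Y := 𝟙_ _)
          (ObjectProperty.homMk (P.ev X)) = ObjectProperty.homMk (P.coevTilde X) ∧
      T.star (X := (⟨X, hX⟩ ⊗ ⟨P.dual X, hX'⟩ : S.FullSubcategory)) (Y := 𝟙_ _)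
          (ObjectProperty.homMk (P.evTilde X)) = ObjectProperty.homMk (P.coev X)) ∧
    ∀ X : D, S X → P.twist X = 𝟙 X) ∨
  (CharZero F ∧ ∀ X : D, S X → ∃ n : ℕ, P.dim F X = n)

end tensor

/-! ### Strict group actions and their fixed point categories -/

section action

variable (H : Type*) [Group H] (D : Type v) [Category.{w} D] [MonoidalCategory D]

/-- An action of the group `H` on `D` by strict monoidal automorphisms. -/
structure StrictAction where
  functor : H → D ⥤ D
  functor_one : functor 1 = 𝟭 D
  functor_mul (g h : H) : functor (g * h) = functor h ⋙ functor g
  strict (g : H) : IsStrictMonoidalFunctor (functor g)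

variable {H D}

namespace StrictAction

/-- The objects that are strictly fixed by the action. -/
structure Fixed (A : StrictAction H D) where
  obj : D
  fixed (g : H) : (A.functor g).obj obj = obj

namespace Fixed

variable {A : StrictAction H D}

/-- The morphisms that are strictly fixed by the action. -/
@[ext]
structure Hom (X Y : A.Fixed) where
  hom : X.obj ⟶ Y.obj
  fixed (g : H) : HEq ((A.functor g).map hom) hom

instance : Category A.Fixed where
  Hom X Y := Hom X Y
  id X := ⟨𝟙 X.obj, fun g => by rw [CategoryTheory.Functor.map_id, X.fixed g]⟩
  comp {X Y Z} s t := ⟨s.hom ≫ t.hom, fun g => by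
    rw [CategoryTheory.Functor.map_comp]
    exact heq_comp (X.fixed g) (Y.fixed g) (Z.fixed g) (s.fixed g) (t.fixed g)⟩
  id_comp s := Hom.ext (Category.id_comp s.hom)
  comp_id s := Hom.ext (Category.comp_id s.hom)
  assoc s t r := Hom.ext (Category.assoc s.hom t.hom r.hom)

@[ext]
theorem hom_ext {X Y : A.Fixed} {s t : X ⟶ Y} (h : s.hom = t.hom) : s = t := Hom.ext h

end Fixed

/-- The inclusion of the fixed point category. -/
def forget (A : StrictAction H D) : A.Fixed ⥤ D where
  obj X := X.obj
  map s := s.hom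

instance (A : StrictAction H D) : A.forget.Faithful where
  map_injective h := Fixed.hom_ext h

theorem heq_tensorHom {X Y X' Y' Z W Z' W' : D} (hX : X = Z) (hY : Y = W) (hX' : X' = Z')
    (hY' : Y' = W') {f : X ⟶ Y} {g : Z ⟶ W} {f' : X' ⟶ Y'} {g' : Z' ⟶ W'} (h : HEq f g)
    (h' : HEq f' g') : HEq (f ⊗ₘ f') (g ⊗ₘ g') := by
  subst hX hY hX' hY' h h'
  rfl

theorem heq_inv {X Y Z W : D} (hX : X = Z) (hY : Y = W) {e : X ≅ Y} {f : Z ≅ W}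
    (h : HEq e.hom f.hom) : HEq e.inv f.inv := by
  subst hX hY
  have : e = f := Iso.ext (eq_of_heq h)
  subst this
  rfl

variable {A : StrictAction H D}

namespace Fixed

def tensorObj (X Y : A.Fixed) : A.Fixed :=
  ⟨X.obj ⊗ Y.obj, fun g => by rw [(A.strict g).obj_tensor, X.fixed, Y.fixed]⟩

def unit : A.Fixed := ⟨𝟙_ D, fun g => (A.strict g).obj_unit⟩

def tensorHom {X Y X' Y' : A.Fixed} (s : X ⟶ Y) (t : X' ⟶ Y') :
    tensorObj X X' ⟶ tensorObj Y Y' :=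
  ⟨s.hom ⊗ₘ t.hom, fun g => ((A.strict g).map_tensor _ _).trans
    (heq_tensorHom (X.fixed g) (Y.fixed g) (X'.fixed g) (Y'.fixed g) (s.fixed g) (t.fixed g))⟩

/-- A fixed isomorphism. -/
def isoMk {X Y : A.Fixed} (e : X.obj ≅ Y.obj) (h : ∀ g, HEq ((A.functor g).map e.hom) e.hom) :
    X ≅ Y where
  hom := ⟨e.hom, h⟩
  inv := ⟨e.inv, fun g => heq_inv (e := (A.functor g).mapIso e) (X.fixed g) (Y.fixed g) (h g)⟩
  hom_inv_id := Hom.ext e.hom_inv_id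
  inv_hom_id := Hom.ext e.inv_hom_id

theorem heq_associator {X Y Z X' Y' Z' : D} (hX : X = X') (hY : Y = Y') (hZ : Z = Z') :
    HEq (α_ X Y Z).hom (α_ X' Y' Z').hom := by
  subst hX hY hZ
  rfl

theorem heq_leftUnitor {X X' : D} (hX : X = X') : HEq (λ_ X).hom (λ_ X').hom := by
  subst hX
  rfl

theorem heq_rightUnitor {X X' : D} (hX : X = X') : HEq (ρ_ X).hom (ρ_ X').hom := by
  subst hX
  rfl

/-- The tensor product of `D`, restricted to the fixed objects and morphisms. -/
instance : MonoidalCategoryStruct A.Fixed where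
  tensorObj := tensorObj
  tensorHom := tensorHom
  whiskerLeft X _ _ t := tensorHom (𝟙 X) t
  whiskerRight s Y := tensorHom s (𝟙 Y)
  tensorUnit := unit
  associator X Y Z := isoMk (X := tensorObj (tensorObj X Y) Z) (Y := tensorObj X (tensorObj Y Z))
    (α_ X.obj Y.obj Z.obj) fun g => ((A.strict g).map_associator _ _ _).trans
      (heq_associator (X.fixed g) (Y.fixed g) (Z.fixed g))
  leftUnitor X := isoMk (X := tensorObj unit X) (Y := X) (λ_ X.obj) fun g =>
    ((A.strict g).map_leftUnitor _).trans (heq_leftUnitor (X.fixed g))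
  rightUnitor X := isoMk (X := tensorObj X unit) (Y := X) (ρ_ X.obj) fun g =>
    ((A.strict g).map_rightUnitor _).trans (heq_rightUnitor (X.fixed g))

instance : MonoidalCategory A.Fixed :=
  MonoidalCategory.ofTensorHom
    (id_tensorHom_id := fun X Y => Hom.ext (MonoidalCategory.id_tensorHom_id X.obj Y.obj))
    (id_tensorHom := fun _ _ _ _ => rfl)
    (tensorHom_id := fun _ _ => rfl)
    (tensorHom_comp_tensorHom := fun f₁ f₂ g₁ g₂ =>
      Hom.ext (MonoidalCategory.tensorHom_comp_tensorHom f₁.hom f₂.hom g₁.hom g₂.hom))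
    (associator_naturality := fun f₁ f₂ f₃ =>
      Hom.ext (MonoidalCategory.associator_naturality f₁.hom f₂.hom f₃.hom))
    (leftUnitor_naturality := fun {X Y} f => Hom.ext (by
      have h := MonoidalCategory.leftUnitor_naturality f.hom
      rw [← id_tensorHom] at h
      exact h))
    (rightUnitor_naturality := fun {X Y} f => Hom.ext (by
      have h := MonoidalCategory.rightUnitor_naturality f.hom
      rw [← tensorHom_id] at h
      exact h))
    (pentagon := fun W X Y Z => Hom.ext (by
      have h := MonoidalCategory.pentagon W.obj X.obj Y.obj Z.obj
      rw [← tensorHom_id, ← id_tensorHom] at h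
      exact h))
    (triangle := fun X Y => Hom.ext (by
      have h := MonoidalCategory.triangle X.obj Y.obj
      rw [← tensorHom_id, ← id_tensorHom] at h
      exact h))

end Fixed

end StrictAction

end action

/-! ### The crossed product without splitting of idempotents -/

section crossed

open ComonObj

variable {C : Type v} [Category.{w} C] [MonoidalCategory C]

/-- The category with the objects of `C` and `Hom(X, Y) = Hom_C(Γ ⊗ X, Y)`, for a comonoid `Γ`. -/
structure Crossed (Γ : C) where
  of ::
  obj : C

namespace Crossed
variable {Γ : C}

@[ext]
structure Hom (X Y : Crossed Γ) where
  hom : Γ ⊗ X.obj ⟶ Y.obj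

variable [ComonObj Γ]

/-- Identity `ε ⊗ 1` and composition `t ∘ (1 ⊗ s) ∘ (Δ ⊗ 1)`. -/
instance : CategoryStruct (Crossed Γ) where
  Hom X Y := Hom X Y
  id X := ⟨ε[Γ] ▷ X.obj ≫ (λ_ X.obj).hom⟩
  comp {X _ _} s t := ⟨Δ[Γ] ▷ X.obj ≫ (α_ Γ Γ X.obj).hom ≫ Γ ◁ s.hom ≫ t.hom⟩

@[ext]
theorem hom_ext {X Y : Crossed Γ} {s t : X ⟶ Y} (h : s.hom = t.hom) : s = t := Hom.ext h

theorem id_hom (X : Crossed Γ) : Hom.hom (𝟙 X) = ε[Γ] ▷ X.obj ≫ (λ_ X.obj).hom := rfl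

theorem comp_hom {X Y Z : Crossed Γ} (s : X ⟶ Y) (t : Y ⟶ Z) :
    (s ≫ t).hom = Δ[Γ] ▷ X.obj ≫ (α_ Γ Γ X.obj).hom ≫ Γ ◁ s.hom ≫ t.hom := rfl

instance : Category (Crossed Γ) where
  id_comp s := by
    ext
    simp only [comp_hom, id_hom, MonoidalCategory.whiskerLeft_comp, Category.assoc]
    rw [← associator_naturality_middle_assoc, ← comp_whiskerRight_assoc, comul_counit]
    simp
  comp_id s := by
    ext
    simp only [comp_hom, id_hom]
    rw [whisker_exchange_assoc, ← associator_naturality_left_assoc, ← comp_whiskerRight_assoc,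
      counit_comul]
    simp
  assoc {X Y Z W} s t r := by
    ext
    simp only [comp_hom, MonoidalCategory.whiskerLeft_comp, Category.assoc]
    rw [whisker_exchange_assoc, ← associator_naturality_left_assoc, ← comp_whiskerRight_assoc,
      ← associator_naturality_middle_assoc, ← comp_whiskerRight_assoc]
    have h := comul_assoc_flip Γ
    rw [h]
    simp only [comp_whiskerRight, Category.assoc]
    congr 2
    simp

variable (Γ) in
/-- The functor `ι : X ↦ X`, `s ↦ ε ⊗ s`. -/
def incl : C ⥤ Crossed Γ where
  obj X := of X
  map {X _} s := ⟨ε[Γ] ▷ X ≫ (λ_ X).hom ≫ s⟩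
  map_id X := by ext; simp [id_hom]
  map_comp {X Y Z} s t := by
    ext
    have := counit_comul (X := Γ)
    simp only [comp_hom, MonoidalCategory.whiskerLeft_comp, Category.assoc]
    rw [← leftUnitor_naturality_assoc, whisker_exchange_assoc,whisker_exchange_assoc, whisker_exchange_assoc, ← associator_naturality_left_assoc, ← comp_whiskerRight_assoc,
      counit_comul]
    simp

theorem incl_map_hom {X Y : C} (s : X ⟶ Y) :
    Hom.hom ((incl Γ).map s) = ε[Γ] ▷ X ≫ (λ_ X).hom ≫ s := rfl

theorem counit_comp {X Y Z : C} (s : X ⟶ Y) (t : Γ ⊗ Y ⟶ Z) :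
    Δ[Γ] ▷ X ≫ (α_ Γ Γ X).hom ≫ Γ ◁ (ε[Γ] ▷ X ≫ (λ_ X).hom ≫ s) ≫ t = Γ ◁ s ≫ t := by
  simp only [MonoidalCategory.whiskerLeft_comp, Category.assoc]
  rw [← associator_naturality_middle_assoc, ← comp_whiskerRight_assoc, comul_counit]
  simp

theorem comp_counit {X Y Z : C} (s : Γ ⊗ X ⟶ Y) (t : Y ⟶ Z) :
    Δ[Γ] ▷ X ≫ (α_ Γ Γ X).hom ≫ Γ ◁ s ≫ ε[Γ] ▷ Y ≫ (λ_ Y).hom ≫ t = s ≫ t := by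
  rw [whisker_exchange_assoc, ← associator_naturality_left_assoc, ← comp_whiskerRight_assoc,
    counit_comul]
  simp

theorem incl_comp_hom {X Y : C} {Z : Crossed Γ} (s : X ⟶ Y) (t : (incl Γ).obj Y ⟶ Z) :
    ((incl Γ).map s ≫ t).hom = Γ ◁ s ≫ t.hom := counit_comp s t.hom

theorem comp_incl_hom {X : Crossed Γ} {Y Z : C} (s : X ⟶ (incl Γ).obj Y) (t : Y ⟶ Z) :
    (s ≫ (incl Γ).map t).hom = s.hom ≫ t := comp_counit s.hom t

section monoidal
variable [BraidedCategory C]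

variable (Γ) in
/-- Duplicate `Γ` and move the right copy past `X`, over it. -/
def split (X Z : C) : Γ ⊗ (X ⊗ Z) ⟶ (Γ ⊗ X) ⊗ (Γ ⊗ Z) :=
  Δ[Γ] ▷ (X ⊗ Z) ≫ tensorμ Γ Γ X Z

theorem split_natural {X Y Z W : C} (f : X ⟶ Y) (g : Z ⟶ W) :
    Γ ◁ (f ⊗ₘ g) ≫ split Γ Y W = split Γ X Z ≫ (Γ ◁ f ⊗ₘ Γ ◁ g) := by
  simp only [split, Category.assoc]
  rw [whisker_exchange_assoc, tensorμ_natural_right]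

theorem split_counit (X Z : C) :
    split Γ X Z ≫ ((ε[Γ] ▷ X ≫ (λ_ X).hom) ⊗ₘ (ε[Γ] ▷ Z ≫ (λ_ Z).hom)) =
      ε[Γ] ▷ (X ⊗ Z) ≫ (λ_ (X ⊗ Z)).hom := by
  rw [split, Category.assoc, ← tensorHom_comp_tensorHom, ← tensorμ_natural_left_assoc,
    ← comp_whiskerRight_assoc, counit_comul_hom, comp_whiskerRight, Category.assoc,
    ← tensor_left_unitality]

theorem split_assoc (X Y Z : C) :
    split Γ (X ⊗ Y) Z ≫ split Γ X Y ▷ (Γ ⊗ Z) ≫ (α_ _ _ _).hom =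
      Γ ◁ (α_ X Y Z).hom ≫ split Γ X (Y ⊗ Z) ≫ (Γ ⊗ X) ◁ split Γ Y Z := by
  have h₁ := tensorμ_natural_left Δ[Γ] (𝟙 Γ) (X ⊗ Y) Z
  have h₂ := tensorμ_natural_left (𝟙 Γ) Δ[Γ] X (Y ⊗ Z)
  simp only [id_whiskerRight, tensorHom_id, id_tensorHom] at h₁ h₂
  simp only [split, comp_whiskerRight, MonoidalCategory.whiskerLeft_comp, Category.assoc]
  rw [← reassoc_of% h₁, ← reassoc_of% h₂, associator_monoidal, whisker_exchange_assoc,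
    MonoidalCategory.tensorHom_def (α_ Γ Γ Γ).hom, whisker_exchange_assoc]
  simp only [Category.assoc, ← comp_whiskerRight_assoc, comul_assoc]

theorem split_left (X : C) :
    split Γ (𝟙_ C) X ≫ ((ε[Γ] ▷ 𝟙_ C ≫ (λ_ (𝟙_ C)).hom) ▷ (Γ ⊗ X)) ≫ (λ_ (Γ ⊗ X)).hom =
      Γ ◁ (λ_ X).hom := by
  have h := tensorμ_natural_left ε[Γ] (𝟙 Γ) (𝟙_ C) X
  simp only [id_whiskerRight, tensorHom_id] at h
  rw [split, comp_whiskerRight, Category.assoc, Category.assoc, ← reassoc_of% h,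
    ← comp_whiskerRight_assoc, counit_comul, ← leftUnitor_monoidal, MonoidalCategory.tensorHom_def,
    ← comp_whiskerRight_assoc]
  simp

theorem split_right (X : C) :
    split Γ X (𝟙_ C) ≫ ((Γ ⊗ X) ◁ (ε[Γ] ▷ 𝟙_ C ≫ (λ_ (𝟙_ C)).hom)) ≫ (ρ_ (Γ ⊗ X)).hom =
      Γ ◁ (ρ_ X).hom := by
  have h := tensorμ_natural_left (𝟙 Γ) ε[Γ] X (𝟙_ C)
  simp only [id_whiskerRight, id_tensorHom] at h
  rw [split, MonoidalCategory.whiskerLeft_comp, Category.assoc, Category.assoc, ← reassoc_of% h,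
    ← comp_whiskerRight_assoc, comul_counit, ← rightUnitor_monoidal, MonoidalCategory.tensorHom_def,
    ← comp_whiskerRight_assoc]
  simp

theorem split_tensor_assoc {X₁ X₂ X₃ Y₁ Y₂ Y₃ : C} (f₁ : Γ ⊗ X₁ ⟶ Y₁) (f₂ : Γ ⊗ X₂ ⟶ Y₂)
    (f₃ : Γ ⊗ X₃ ⟶ Y₃) :
    (split Γ (X₁ ⊗ X₂) X₃ ≫ ((split Γ X₁ X₂ ≫ (f₁ ⊗ₘ f₂)) ⊗ₘ f₃)) ≫ (α_ Y₁ Y₂ Y₃).hom =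
      Γ ◁ (α_ X₁ X₂ X₃).hom ≫ split Γ X₁ (X₂ ⊗ X₃) ≫
        (f₁ ⊗ₘ (split Γ X₂ X₃ ≫ (f₂ ⊗ₘ f₃))) := by
  have h₁ : (split Γ X₁ X₂ ≫ (f₁ ⊗ₘ f₂)) ⊗ₘ f₃ =
      split Γ X₁ X₂ ▷ (Γ ⊗ X₃) ≫ ((f₁ ⊗ₘ f₂) ⊗ₘ f₃) := by
    rw [← tensorHom_id, tensorHom_comp_tensorHom, Category.id_comp]
  have h₂ : f₁ ⊗ₘ (split Γ X₂ X₃ ≫ (f₂ ⊗ₘ f₃)) =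
      (Γ ⊗ X₁) ◁ split Γ X₂ X₃ ≫ (f₁ ⊗ₘ (f₂ ⊗ₘ f₃)) := by
    rw [← id_tensorHom, tensorHom_comp_tensorHom, Category.id_comp]
  rw [h₁, h₂, Category.assoc, Category.assoc, associator_naturality, reassoc_of% split_assoc]

theorem split_tensor_left {X Y : C} (f : Γ ⊗ X ⟶ Y) :
    (split Γ (𝟙_ C) X ≫ ((ε[Γ] ▷ 𝟙_ C ≫ (λ_ (𝟙_ C)).hom) ⊗ₘ f)) ≫ (λ_ Y).hom =
      Γ ◁ (λ_ X).hom ≫ f := by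
  rw [MonoidalCategory.tensorHom_def, Category.assoc, Category.assoc, leftUnitor_naturality,
    ← split_left]
  simp only [Category.assoc]

theorem split_tensor_right {X Y : C} (f : Γ ⊗ X ⟶ Y) :
    (split Γ X (𝟙_ C) ≫ (f ⊗ₘ (ε[Γ] ▷ 𝟙_ C ≫ (λ_ (𝟙_ C)).hom))) ≫ (ρ_ Y).hom =
      Γ ◁ (ρ_ X).hom ≫ f := by
  rw [tensorHom_def', Category.assoc, Category.assoc, rightUnitor_naturality, ← split_right]
  simp only [Category.assoc]

/-- On morphisms: `s ⊗ t := (s ⊗ t) ∘ (1 ⊗ c_{Γ,X} ⊗ 1) ∘ (Δ ⊗ 1 ⊗ 1)`. -/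
instance : MonoidalCategoryStruct (Crossed Γ) where
  tensorObj X Y := of (X.obj ⊗ Y.obj)
  tensorHom {X _ Z _} s t := ⟨split Γ X.obj Z.obj ≫ (s.hom ⊗ₘ t.hom)⟩
  whiskerLeft X {Y₁ _} t := ⟨split Γ X.obj Y₁.obj ≫ (Hom.hom (𝟙 X) ⊗ₘ t.hom)⟩
  whiskerRight {X₁ _} s Y := ⟨split Γ X₁.obj Y.obj ≫ (s.hom ⊗ₘ Hom.hom (𝟙 Y))⟩
  tensorUnit := of (𝟙_ C)
  associator X Y Z := (incl Γ).mapIso (α_ X.obj Y.obj Z.obj)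
  leftUnitor X := (incl Γ).mapIso (λ_ X.obj)
  rightUnitor X := (incl Γ).mapIso (ρ_ X.obj)

theorem tensorObj_obj (X Y : Crossed Γ) : (X ⊗ Y).obj = X.obj ⊗ Y.obj := rfl

theorem tensorHom_hom {X Y Z W : Crossed Γ} (s : X ⟶ Y) (t : Z ⟶ W) :
    Hom.hom (s ⊗ₘ t) = split Γ X.obj Z.obj ≫ (s.hom ⊗ₘ t.hom) := rfl

theorem incl_tensor {X Y Z W : C} (s : X ⟶ Y) (t : Z ⟶ W) :
    (incl Γ).map s ⊗ₘ (incl Γ).map t = (incl Γ).map (s ⊗ₘ t) := by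
  ext
  have h := congrArg (· ≫ (s ⊗ₘ t)) (split_counit (Γ := Γ) X Z)
  simp only [Category.assoc, tensorHom_comp_tensorHom] at h
  exact h

theorem incl_tensor_id {X Y Z : C} (s : X ⟶ Y) :
    (incl Γ).map s ⊗ₘ 𝟙 (of Z) = (incl Γ).map (s ▷ Z) := by
  have h := incl_tensor (Γ := Γ) s (𝟙 Z)
  rwa [CategoryTheory.Functor.map_id, tensorHom_id] at h

theorem id_tensor_incl {X Y Z : C} (s : X ⟶ Y) :
    𝟙 (of Z) ⊗ₘ (incl Γ).map s = (incl Γ).map (Z ◁ s) := by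
  have h := incl_tensor (Γ := Γ) (𝟙 Z) s
  rwa [CategoryTheory.Functor.map_id, id_tensorHom] at h

variable [IsCommComonObj Γ]

theorem comul_swap : Δ[Γ] ≫ (Δ[Γ] ⊗ₘ Δ[Γ]) ≫ tensorμ Γ Γ Γ Γ = Δ[Γ] ≫ (Δ[Γ] ⊗ₘ Δ[Γ]) := by
  have h : Δ[Γ] ≫ (Δ[Γ] ⊗ₘ Δ[Γ]) = (Δ[Γ] ≫ Γ ◁ Δ[Γ] ≫ Γ ◁ (Δ[Γ] ▷ Γ)) ≫ Γ ◁ (α_ Γ Γ Γ).hom ≫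
      (α_ Γ Γ (Γ ⊗ Γ)).inv := by
    have h₁ := comul_assoc_flip Γ
    have h₂ := comul_assoc (X := Γ)
    rw [MonoidalCategory.tensorHom_def, reassoc_of% h₁, ← associator_inv_naturality_right]
    simp only [← MonoidalCategory.whiskerLeft_comp_assoc, Category.assoc]
    rw [h₂]
  rw [reassoc_of% h, h]
  simp only [tensorμ, Category.assoc, Iso.inv_hom_id_assoc]
  simp only [← MonoidalCategory.whiskerLeft_comp_assoc, Iso.hom_inv_id_assoc,
    ← comp_whiskerRight_assoc, IsCommComonObj.comul_comm]

theorem split_comul (X Z : C) :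
    split Γ X Z ≫ ((Δ[Γ] ▷ X ≫ (α_ Γ Γ X).hom) ⊗ₘ (Δ[Γ] ▷ Z ≫ (α_ Γ Γ Z).hom)) =
      Δ[Γ] ▷ (X ⊗ Z) ≫ (α_ Γ Γ (X ⊗ Z)).hom ≫ Γ ◁ split Γ X Z ≫ split Γ (Γ ⊗ X) (Γ ⊗ Z) := by
  have h : Δ[Γ] ▷ (X ⊗ Z) ≫ (α_ Γ Γ (X ⊗ Z)).hom ≫ Δ[Γ] ▷ (Γ ⊗ X ⊗ Z) ≫
      (Γ ⊗ Γ) ◁ Δ[Γ] ▷ (X ⊗ Z) =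
      (Δ[Γ] ≫ (Δ[Γ] ⊗ₘ Δ[Γ])) ▷ (X ⊗ Z) ≫ (α_ (Γ ⊗ Γ) (Γ ⊗ Γ) (X ⊗ Z)).hom := by
    rw [MonoidalCategory.tensorHom_def, ← associator_naturality_left_assoc, ← associator_naturality_middle]
    simp only [comp_whiskerRight, Category.assoc]
  simp only [split, MonoidalCategory.whiskerLeft_comp, Category.assoc]
  rw [whisker_exchange_assoc, whisker_exchange_assoc, reassoc_of% h, ← tensor_associativity,
    ← tensorHom_comp_tensorHom, ← tensorμ_natural_left_assoc, ← comp_whiskerRight_assoc,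
    ← comp_whiskerRight_assoc, Category.assoc, comul_swap]

theorem split_interchange {X Y Z X' Y' Z' : C} (s : Γ ⊗ X ⟶ Y) (s' : Γ ⊗ Y ⟶ Z)
    (t : Γ ⊗ X' ⟶ Y') (t' : Γ ⊗ Y' ⟶ Z') :
    Δ[Γ] ▷ (X ⊗ X') ≫ (α_ Γ Γ (X ⊗ X')).hom ≫ Γ ◁ (split Γ X X' ≫ (s ⊗ₘ t)) ≫
        split Γ Y Y' ≫ (s' ⊗ₘ t') =
      split Γ X X' ≫ ((Δ[Γ] ▷ X ≫ (α_ Γ Γ X).hom ≫ Γ ◁ s ≫ s') ⊗ₘ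
        (Δ[Γ] ▷ X' ≫ (α_ Γ Γ X').hom ≫ Γ ◁ t ≫ t')) := by
  have h := congrArg (· ≫ ((Γ ◁ s ≫ s') ⊗ₘ (Γ ◁ t ≫ t'))) (split_comul (Γ := Γ) X X')
  simp only [Category.assoc, tensorHom_comp_tensorHom] at h
  rw [h, MonoidalCategory.whiskerLeft_comp, Category.assoc, reassoc_of% split_natural,
    tensorHom_comp_tensorHom]

instance : MonoidalCategory (Crossed Γ) :=
  MonoidalCategory.ofTensorHom
    (id_tensorHom_id := fun X Y => Hom.ext (split_counit X.obj Y.obj))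
    (id_tensorHom := fun _ _ _ _ => rfl)
    (tensorHom_id := fun _ _ => rfl)
    (tensorHom_comp_tensorHom := fun f₁ f₂ g₁ g₂ =>
      Hom.ext (split_interchange f₁.hom g₁.hom f₂.hom g₂.hom))
    (associator_naturality := fun {X₁ X₂ X₃ Y₁ Y₂ Y₃} f₁ f₂ f₃ => by
      ext
      refine (comp_incl_hom _ _).trans (Eq.trans ?_ (incl_comp_hom _ _).symm)
      exact split_tensor_assoc f₁.hom f₂.hom f₃.hom)
    (leftUnitor_naturality := fun f => by
      ext
      refine (comp_incl_hom _ _).trans (Eq.trans ?_ (incl_comp_hom _ _).symm)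
      exact split_tensor_left f.hom)
    (rightUnitor_naturality := fun f => by
      ext
      refine (comp_incl_hom _ _).trans (Eq.trans ?_ (incl_comp_hom _ _).symm)
      exact split_tensor_right f.hom)
    (pentagon := fun W X Y Z => by
      have h := congrArg (incl Γ).map (MonoidalCategory.pentagon W.obj X.obj Y.obj Z.obj)
      simp only [Functor.map_comp] at h
      rw [← incl_tensor_id, ← id_tensor_incl] at h
      exact h)
    (triangle := fun X Y => by
      have h := congrArg (incl Γ).map (MonoidalCategory.triangle X.obj Y.obj)
      simp only [Functor.map_comp] at h
      rw [← incl_tensor_id, ← id_tensor_incl] at h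
      exact h)

end monoidal

section linear
variable [Preadditive C]

def homEquiv (X Y : Crossed Γ) : (X ⟶ Y) ≃ (Γ ⊗ X.obj ⟶ Y.obj) where
  toFun s := s.hom
  invFun s := ⟨s⟩
  left_inv _ := rfl
  right_inv _ := rfl

instance (X Y : Crossed Γ) : AddCommGroup (X ⟶ Y) := (homEquiv X Y).addCommGroup

theorem add_hom {X Y : Crossed Γ} (s t : X ⟶ Y) : Hom.hom (s + t) = s.hom + t.hom := rfl

instance [MonoidalPreadditive C] : Preadditive (Crossed Γ) where
  add_comp X Y Z s t r := by ext; simp [comp_hom, add_hom]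
  comp_add X Y Z s t r := by ext; simp [comp_hom, add_hom]

variable (F : Type u) [Field F] [Linear F C]

instance (X Y : Crossed Γ) : Module F (X ⟶ Y) := (homEquiv X Y).module F

theorem smul_hom (a : F) {X Y : Crossed Γ} (s : X ⟶ Y) : Hom.hom (a • s) = a • s.hom := rfl

instance [MonoidalPreadditive C] [MonoidalLinear F C] : Linear F (Crossed Γ) where
  smul_comp X Y Z a s t := by ext; simp [comp_hom, smul_hom]
  comp_smul X Y Z s a t := by ext; simp [comp_hom, smul_hom]

end linear
end Crossed
end crossed

/-! ### The tensor product on the idempotent completion -/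

section karoubi

variable {D : Type v} [Category.{w} D]

/-- `(X, p) ⊗ (Y, q) = (X ⊗ Y, p ⊗ q)`. -/
instance [MonoidalCategory D] : MonoidalCategoryStruct (Karoubi D) where
  tensorObj P Q := ⟨P.X ⊗ Q.X, P.p ⊗ₘ Q.p, by simp⟩
  tensorHom {P P' Q Q'} f g := ⟨f.f ⊗ₘ g.f, by simp⟩
  whiskerLeft P Q Q' f := ⟨P.p ⊗ₘ f.f, by simp⟩
  whiskerRight {P P'} f Q := ⟨f.f ⊗ₘ Q.p, by simp⟩
  tensorUnit := ⟨𝟙_ D, 𝟙 _, by simp⟩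
  associator P Q R :=
    { hom := ⟨((P.p ⊗ₘ Q.p) ⊗ₘ R.p) ≫ (α_ P.X Q.X R.X).hom, by simp⟩
      inv := ⟨(P.p ⊗ₘ (Q.p ⊗ₘ R.p)) ≫ (α_ P.X Q.X R.X).inv, by simp⟩
      hom_inv_id := by ext; simp
      inv_hom_id := by ext; simp }
  leftUnitor P :=
    { hom := ⟨(𝟙 (𝟙_ D) ⊗ₘ P.p) ≫ (λ_ P.X).hom, by simp⟩
      inv := ⟨P.p ≫ (λ_ P.X).inv, by simp⟩
      hom_inv_id := by ext; simp
      inv_hom_id := by ext; simp }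
  rightUnitor P :=
    { hom := ⟨(P.p ⊗ₘ 𝟙 (𝟙_ D)) ≫ (ρ_ P.X).hom, by simp⟩
      inv := ⟨P.p ≫ (ρ_ P.X).inv, by simp⟩
      hom_inv_id := by ext; simp
      inv_hom_id := by ext; simp }

theorem idem_pentagon [MonoidalCategory D] {W X Y Z : D} (w : W ⟶ W) (x : X ⟶ X) (y : Y ⟶ Y) (z : Z ⟶ Z) (hw : w ≫ w = w)
  (hx : x ≫ x = x) (hy : y ≫ y = y) (hz : z ≫ z = z) : ((((w ⊗ₘ x) ⊗ₘ y) ≫ (α_ W X Y).hom) ⊗ₘ z) ≫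
          (((w ⊗ₘ (x ⊗ₘ y)) ⊗ₘ z) ≫ (α_ W (X ⊗ Y) Z).hom) ≫
          (w ⊗ₘ (((x ⊗ₘ y) ⊗ₘ z) ≫ (α_ X Y Z).hom)) =
        ((((w ⊗ₘ x) ⊗ₘ y) ⊗ₘ z) ≫ (α_ (W ⊗ X) Y Z).hom) ≫
          (((w ⊗ₘ x) ⊗ₘ (y ⊗ₘ z)) ≫ (α_ W X (Y ⊗ Z)).hom) := by
  have h₁ : (((w ⊗ₘ x) ⊗ₘ y) ≫ (α_ W X Y).hom) ⊗ₘ z =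
      (((w ⊗ₘ x) ⊗ₘ y) ⊗ₘ z) ≫ (α_ W X Y).hom ▷ Z := by
    rw [← tensorHom_id, tensorHom_comp_tensorHom, Category.comp_id]
  have h₂ : w ⊗ₘ (((x ⊗ₘ y) ⊗ₘ z) ≫ (α_ X Y Z).hom) =
      (w ⊗ₘ ((x ⊗ₘ y) ⊗ₘ z)) ≫ W ◁ (α_ X Y Z).hom := by
    rw [← id_tensorHom, tensorHom_comp_tensorHom, Category.comp_id]
  have h₃ : (α_ W X Y).hom ▷ Z ≫ ((w ⊗ₘ (x ⊗ₘ y)) ⊗ₘ z) =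
      (((w ⊗ₘ x) ⊗ₘ y) ⊗ₘ z) ≫ (α_ W X Y).hom ▷ Z := by
    rw [← tensorHom_id, tensorHom_comp_tensorHom, tensorHom_comp_tensorHom,
      associator_naturality, Category.comp_id, Category.id_comp]
  rw [h₁, h₂]
  simp only [Category.assoc]
  rw [← associator_naturality_assoc, ← associator_naturality_assoc]
  simp only [tensorHom_comp_tensorHom_assoc, tensorHom_comp_tensorHom, hw, hx, hy, hz]
  rw [reassoc_of% h₃, pentagon]
  simp only [tensorHom_comp_tensorHom_assoc, tensorHom_comp_tensorHom, hw, hx, hy, hz]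

theorem idem_triangle [MonoidalCategory D] {X Y : D} (x : X ⟶ X) (y : Y ⟶ Y) (hx : x ≫ x = x) (hy : y ≫ y = y) :
    (((x ⊗ₘ 𝟙 (𝟙_ D)) ⊗ₘ y) ≫ (α_ X (𝟙_ D) Y).hom) ≫
          (x ⊗ₘ ((𝟙 (𝟙_ D) ⊗ₘ y) ≫ (λ_ Y).hom)) =
        (((x ⊗ₘ 𝟙 (𝟙_ D)) ≫ (ρ_ X).hom) ⊗ₘ y) := by
  have h₁ : (((x ⊗ₘ 𝟙 (𝟙_ D)) ≫ (ρ_ X).hom) ⊗ₘ y) = ((x ⊗ₘ 𝟙 (𝟙_ D)) ⊗ₘ y) ≫ (ρ_ X).hom ▷ Y := by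
    rw [← tensorHom_id, tensorHom_comp_tensorHom, Category.comp_id]
  have h₂ : x ⊗ₘ ((𝟙 (𝟙_ D) ⊗ₘ y) ≫ (λ_ Y).hom) = (x ⊗ₘ (𝟙 (𝟙_ D) ⊗ₘ y)) ≫ X ◁ (λ_ Y).hom := by
    rw [← id_tensorHom, tensorHom_comp_tensorHom, Category.comp_id]
  rw [h₁, h₂, Category.assoc, ← associator_naturality_assoc, triangle,
    tensorHom_comp_tensorHom_assoc, tensorHom_comp_tensorHom, hx, hy, Category.comp_id]

instance [MonoidalCategory D] : MonoidalCategory (Karoubi D) :=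
  MonoidalCategory.ofTensorHom
    (id_tensorHom_id := fun _ _ => rfl)
    (id_tensorHom := fun _ _ _ _ => rfl)
    (tensorHom_id := fun _ _ => rfl)
    (tensorHom_comp_tensorHom := fun f₁ f₂ g₁ g₂ =>
      Karoubi.hom_ext _ _ (MonoidalCategory.tensorHom_comp_tensorHom f₁.f f₂.f g₁.f g₂.f))
    (associator_naturality := fun {X₁ X₂ X₃ Y₁ Y₂ Y₃} f₁ f₂ f₃ => by
      apply Karoubi.hom_ext
      change ((f₁.f ⊗ₘ f₂.f) ⊗ₘ f₃.f) ≫ ((Y₁.p ⊗ₘ Y₂.p) ⊗ₘ Y₃.p) ≫ (α_ Y₁.X Y₂.X Y₃.X).hom =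
        (((X₁.p ⊗ₘ X₂.p) ⊗ₘ X₃.p) ≫ (α_ X₁.X X₂.X X₃.X).hom) ≫ (f₁.f ⊗ₘ (f₂.f ⊗ₘ f₃.f))
      simp)
    (leftUnitor_naturality := fun {X Y} f => by
      apply Karoubi.hom_ext
      change (𝟙 (𝟙_ D) ⊗ₘ f.f) ≫ (𝟙 (𝟙_ D) ⊗ₘ Y.p) ≫ (λ_ Y.X).hom =
        ((𝟙 (𝟙_ D) ⊗ₘ X.p) ≫ (λ_ X.X).hom) ≫ f.f
      simp)
    (rightUnitor_naturality := fun {X Y} f => by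
      apply Karoubi.hom_ext
      change (f.f ⊗ₘ 𝟙 (𝟙_ D)) ≫ (Y.p ⊗ₘ 𝟙 (𝟙_ D)) ≫ (ρ_ Y.X).hom =
        ((X.p ⊗ₘ 𝟙 (𝟙_ D)) ≫ (ρ_ X.X).hom) ≫ f.f
      simp)
    (pentagon := fun W X Y Z =>
      Karoubi.hom_ext _ _ (idem_pentagon W.p X.p Y.p Z.p W.idem X.idem Y.idem Z.idem))
    (triangle := fun X Y => Karoubi.hom_ext _ _ (idem_triangle X.p Y.p X.idem Y.idem))

instance (F : Type u) [Field F] [Preadditive D] [Linear F D] : Linear F (Karoubi D) where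
  homModule P Q :=
    { smul := fun a f => ⟨a • f.f, by simp⟩
      one_smul := fun f => Karoubi.hom_ext _ _ (one_smul F f.f)
      mul_smul := fun a b f => Karoubi.hom_ext _ _ (mul_smul a b f.f)
      smul_zero := fun a => Karoubi.hom_ext _ _ (smul_zero a)
      smul_add := fun a f g => Karoubi.hom_ext _ _ (smul_add a f.f g.f)
      add_smul := fun a b f => Karoubi.hom_ext _ _ (add_smul a b f.f)
      zero_smul := fun f => Karoubi.hom_ext _ _ (zero_smul F f.f) }
  smul_comp P Q R a f g := Karoubi.hom_ext _ _ (Linear.smul_comp _ _ _ a f.f g.f)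
  comp_smul P Q R f a g := Karoubi.hom_ext _ _ (Linear.comp_smul _ _ _ f.f a g.f)

end karoubi

/-! ### The Frobenius algebra of functions on a finite group -/

section regular

open MonObj ComonObj TensorProduct

variable (F G : Type u) [Field F] [Group G] [Fintype G]

/-- The left regular representation: the functions on `G`, with `(s f)(t) = f (s⁻¹ t)`. -/
def regularRep : FDRep F G := FDRep.of (TannakaDuality.FiniteGroup.leftRegular (k := F) (G := G))

open Classical in
/-- The function `δ_g`. -/
def delta (g : G) : G → F := Pi.single g 1

/-- `Δ f = |G| ∑ g, f g • δ_g ⊗ δ_g`. -/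
def regularComul : (G → F) →ₗ[F] (G → F) ⊗[F] (G → F) :=
  (Fintype.card G : F) • ∑ g : G, (LinearMap.toSpanSingleton F _ (delta F G g ⊗ₜ[F] delta F G g)) ∘ₗ
    LinearMap.proj g

/-- `ε f = |G|⁻¹ ∑ g, f g`. -/
def regularCounit : (G → F) →ₗ[F] F := (Fintype.card G : F)⁻¹ • ∑ g : G, LinearMap.proj g

variable {F G}

theorem regularComul_delta (g : G) :
    regularComul F G (delta F G g) = (Fintype.card G : F) • (delta F G g ⊗ₜ[F] delta F G g) := by
  classical
  simp [regularComul, delta, Pi.single_apply, Finset.sum_apply]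

theorem regularCounit_delta (g : G) :
    regularCounit F G (delta F G g) = (Fintype.card G : F)⁻¹ := by
  classical
  simp [regularCounit, delta, Pi.single_apply, Finset.sum_apply]

theorem leftRegular_delta (s g : G) :
    TannakaDuality.FiniteGroup.leftRegular (k := F) s (delta F G g) = delta F G (s * g) := by
  classical
  ext t
  simp [delta, Pi.single_apply, inv_mul_eq_iff_eq_mul]

theorem delta_ext {M : Type*} [AddCommGroup M] [Module F M] {f g : (G → F) →ₗ[F] M}
    (h : ∀ x, f (delta F G x) = g (delta F G x)) : f = g := by
  classical
  apply LinearMap.pi_ext'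
  intro x
  ext
  exact h x

theorem fdRep_hom_ext {V W : FDRep F G} {f g : V ⟶ W} (h : f.hom.hom.hom = g.hom.hom.hom) :
    f = g :=
  Action.hom_ext _ _ (InducedCategory.hom_ext (ModuleCat.hom_ext h))

open ModuleCat in
/-- Pointwise multiplication of functions. -/
instance : MonObj (regularRep F G) where
  one :=
    { hom := InducedCategory.homMk (ofHom (LinearMap.toSpanSingleton F (G → F) 1))
      comm := by intro g; ext; rfl }
  mul :=
    { hom := InducedCategory.homMk (ofHom (LinearMap.mul' F (G → F)))
      comm := by
        intro g
        ext u
        refine TensorProduct.induction_on u rfl (fun _ _ ↦ rfl) (fun _ _ hx hy ↦ ?_)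
        simp only [map_add, hx, hy] }
  one_mul := by
    apply fdRep_hom_ext
    refine TensorProduct.ext' (R := F) (M := F) (N := G → F) fun a f => ?_
    change (a • (1 : G → F)) * f = a • f
    simp
  mul_one := by
    apply fdRep_hom_ext
    refine TensorProduct.ext' (R := F) (M := G → F) (N := F) fun f a => ?_
    change f * (a • (1 : G → F)) = a • f
    simp
  mul_assoc := by
    apply fdRep_hom_ext
    refine TensorProduct.ext_threefold (R := F) (M := G → F) (N := G → F) (P := G → F)
      fun f g h => ?_
    change f * g * h = f * (g * h)
    rw [_root_.mul_assoc]

variable [CharZero F]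

open ModuleCat in
/-- The comultiplication and counit above; then `m ∘ Δ = |G|` and `ε ∘ η = 1`. -/
instance : ComonObj (regularRep F G) where
  counit :=
    { hom := InducedCategory.homMk (ofHom (regularCounit F G))
      comm := by
        intro s
        apply InducedCategory.hom_ext
        apply ModuleCat.hom_ext
        refine delta_ext (M := F) fun x => ?_
        change regularCounit F G (TannakaDuality.FiniteGroup.leftRegular s (delta F G x)) =
          regularCounit F G (delta F G x)
        rw [leftRegular_delta, regularCounit_delta, regularCounit_delta] }
  comul :=
    { hom := InducedCategory.homMk (ofHom (regularComul F G))
      comm := by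
        intro s
        apply InducedCategory.hom_ext
        apply ModuleCat.hom_ext
        refine delta_ext (M := (G → F) ⊗[F] (G → F)) fun x => ?_
        change regularComul F G (TannakaDuality.FiniteGroup.leftRegular s (delta F G x)) =
          TensorProduct.map (TannakaDuality.FiniteGroup.leftRegular s)
            (TannakaDuality.FiniteGroup.leftRegular s) (regularComul F G (delta F G x))
        rw [leftRegular_delta, regularComul_delta, regularComul_delta, map_smul, map_tmul,
          leftRegular_delta] }
  counit_comul := by
    apply fdRep_hom_ext
    refine delta_ext (M := F ⊗[F] (G → F)) fun x => ?_
    change (regularCounit F G).rTensor (G → F) (regularComul F G (delta F G x)) = 1 ⊗ₜ delta F G x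
    rw [regularComul_delta, map_smul, LinearMap.rTensor_tmul, regularCounit_delta,
      TensorProduct.smul_tmul', smul_eq_mul, mul_inv_cancel₀ (by simp)]
  comul_counit := by
    apply fdRep_hom_ext
    refine delta_ext (M := (G → F) ⊗[F] F) fun x => ?_
    change (regularCounit F G).lTensor (G → F) (regularComul F G (delta F G x)) = delta F G x ⊗ₜ 1
    rw [regularComul_delta, map_smul, LinearMap.lTensor_tmul, regularCounit_delta,
      ← TensorProduct.tmul_smul, smul_eq_mul, mul_inv_cancel₀ (by simp)]
  comul_assoc := by
    apply fdRep_hom_ext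
    refine delta_ext (M := (G → F) ⊗[F] ((G → F) ⊗[F] (G → F))) fun x => ?_
    change (regularComul F G).lTensor (G → F) (regularComul F G (delta F G x)) =
      (α_ (regularRep F G) (regularRep F G) (regularRep F G)).hom.hom.hom.hom
        ((regularComul F G).rTensor (G → F) (regularComul F G (delta F G x)))
    rw [regularComul_delta, map_smul, map_smul, LinearMap.lTensor_tmul, LinearMap.rTensor_tmul,
      regularComul_delta, TensorProduct.tmul_smul, ← TensorProduct.smul_tmul']
    refine Eq.trans ?_ (((α_ (regularRep F G) (regularRep F G)
      (regularRep F G)).hom.hom.hom.hom.map_smul _ _).trans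
        (congrArg _ ((α_ (regularRep F G) (regularRep F G)
      (regularRep F G)).hom.hom.hom.hom.map_smul _ _))).symm
    rfl

instance : IsCommComonObj (regularRep F G) where
  comul_comm := by
    apply fdRep_hom_ext
    refine delta_ext (M := (G → F) ⊗[F] (G → F)) fun x => ?_
    change TensorProduct.comm F _ _ (regularComul F G (delta F G x)) =
      regularComul F G (delta F G x)
    rw [regularComul_delta, map_smul, TensorProduct.comm_tmul]

end regular

section transport
variable {A : Type*} [Category* A] [MonoidalCategory A] [BraidedCategory A]
  {B : Type*} [Category* B] [MonoidalCategory B] [BraidedCategory B]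

theorem isComm_map (K : A ⥤ B) [K.Braided] (Γ : A) [ComonObj Γ] [IsCommComonObj Γ] :
    letI := Functor.obj.instComonObj Γ K
    IsCommComonObj (K.obj Γ) := by
  let _ := Functor.obj.instComonObj Γ K
  refine ⟨?_⟩
  rw [Functor.obj.Δ_def, Category.assoc]
  have h := congrArg K.map (IsCommComonObj.comul_comm Γ)
  rw [CategoryTheory.Functor.map_comp, Functor.map_braiding] at h
  rw [← cancel_mono (Functor.LaxMonoidal.μ K Γ Γ)]
  simpa using h
end transport

/-! ### The crossed product of `C` by `S` and its Galois group -/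

section galois

theorem isMonHom_inv {C : Type v} [Category.{w} C] [MonoidalCategory C] {Γ : C} [MonObj Γ]
    (e : Γ ≅ Γ) (_ : IsMonHom e.hom) : IsMonHom e.inv := inferInstance

/-- The automorphism group of the monoid `(Γ, m, η)`. -/
def algAut {C : Type v} [Category.{w} C] [MonoidalCategory C] (Γ : C) [MonObj Γ] :
    Subgroup (Aut Γ) where
  carrier := {g | IsMonHom g.hom}
  one_mem' := inferInstanceAs (IsMonHom (𝟙 Γ))
  mul_mem' {a b} (_ : IsMonHom a.hom) (_ : IsMonHom b.hom) :=
    inferInstanceAs (IsMonHom (b.hom ≫ a.hom))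
  inv_mem' h := isMonHom_inv _ h

/-- `γ_g(s) = s ∘ (g⁻¹ ⊗ 1)`. -/
def gammaHom {C : Type v} [Category.{w} C] [MonoidalCategory C] {Γ : C} [MonObj Γ] [ComonObj Γ]
    (g : algAut Γ) {X Y : Crossed Γ} (s : X ⟶ Y) : X ⟶ Y :=
  ⟨(g⁻¹ : algAut Γ).1.hom ▷ X.obj ≫ s.hom⟩

variable {F G : Type u} [Field F] [CharZero F] [Group G] [Fintype G]
  {C : Type v} [Category.{w} C] [MonoidalCategory C] [BraidedCategory C]
  (S : ObjectProperty C) [S.IsMonoidal] (K : FDRep F G ⥤ S.FullSubcategory)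

/-- The object `Γ` of `C` that corresponds to the regular representation under an equivalence
`K : Rep G ⥤ S`. -/
def regularObj : C := (K ⋙ S.ι).obj (regularRep F G)

variable [K.Braided]

instance : MonObj (regularObj S K) := Functor.monObjObj (F := K ⋙ S.ι) (regularRep F G)

instance : ComonObj (regularObj S K) := Functor.obj.instComonObj (regularRep F G) (K ⋙ S.ι)

instance : IsCommComonObj (regularObj S K) := isComm_map (K ⋙ S.ι) (regularRep F G)

/-- `C ⋊₀ S`. -/
abbrev CrossedZero := Crossed (regularObj S K)

/-- `C ⋊ S`, the completion of `C ⋊₀ S` to a category with split idempotents. -/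
abbrev CrossedProduct := Karoubi (CrossedZero S K)

/-- `ι : C ⥤ C ⋊₀ S`. -/
abbrev inclZero : C ⥤ CrossedZero S K := Crossed.incl (regularObj S K)

/-- `ι : C ⥤ C ⋊ S`. -/
abbrev inclProduct : C ⥤ CrossedProduct S K := inclZero S K ⋙ toKaroubi (CrossedZero S K)

/-- The group `Aut(Γ, m, η)`. -/
abbrev GaloisGroup := algAut (regularObj S K)

end galois

end GaloisExt

end

open GaloisExt

/-! A morphism `Γ ⊗ X ⟶ Y` is the same as a `Γ`-colinear map `Γ ⊗ X ⟶ Γ ⊗ Y` (its colinear extension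
`cofreeMap`), and the composition of `C ⋊₀ S` is the ordinary composition of these maps. So `C ⋊₀ S`
is the category of cofree comodules over `Γ`. Everything used about `Γ` is collected in two lists of
identities, proved for the functions on `G` on the basis of delta functions and carried to `C` by
the equivalence. `IsGaloisAlgebra`: `Γ` is Frobenius, `m ∘ Δ = n` with `n = |G|`, `ε ∘ η = 1`, and
`Hom(Γ, 𝟙)` is spanned by `ε`. `IsTranslations`: the algebra endomorphisms of `Γ` are exactly the
right translations, they sum to `n (η ∘ ε)`, and they decompose the identity of `Γ ⊗ Γ` into `n`
maps through `Γ`.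

Semisimplicity is Maschke's theorem. In a semisimple category every morphism has a quasi-inverse.
Averaging by `m ∘ (1 ⊗ h) ∘ Δ` makes a quasi-inverse of a colinear map colinear, up to the factor
`n`, so the property passes to `C ⋊₀ S` and to its idempotent completion
(`IsGaloisAlgebra.isRegularHom`, `karoubi_isRegularHom`). Conversely, quasi-inverses, split
idempotents, finite products and finite dimensional endomorphism spaces give semisimplicity
(`isSemisimple_of_isRegularHom`).

The spherical structure rests on the triviality of the twist of `Γ` (`twist_regularObj`), the only
place where admissibility enters. It identifies the two evaluations of `Γ` up to the braiding, and
then the left and right duals of a morphism of the crossed product coincide (`exists_mate`). A trace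
in the crossed product is a multiple of `ε`, hence is determined by its restriction along `η`, which
is a trace in `C`.

Fixed points: if `s` is invariant under all translations, then averaging turns `s` into `s ∘ (ηε ⊗
1)`, which comes from `C` (`IsTranslations.eq_incl_of_fixed`). For objects of `C ⋊ S` a fixed
idempotent therefore comes from an idempotent of `C`, which splits there.

For the star structure, the adjoint of a colinear map is linear and hence, by the Frobenius
relation, colinear. Compatibility with tensor products requires the braiding with `Γ` to be unitary,
a consequence of the Galois relation and positivity (`IsTranslations.star_braiding`). On the
idempotent completion the star is corrected by Gram inverses, since the idempotents need not be
self-adjoint.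

Dimensions: `ι` has an adjoint, the restriction `Y ↦ im(cofreeMap p)`. The functor `ι` preserves
dimensions and restriction multiplies them by `n`, so counting multiplicities of simple objects in
two ways gives `dim C = n · dim C ⋊ S`. Finally a simple object of `S` occurs in `Γ` with
multiplicity its dimension, so that `dim S = d(Γ) = |G|`. -/

noncomputable section

namespace GaloisExt

set_option linter.unusedSectionVars false

/-! ### Von Neumann regular preadditive categories -/

section vonNeumann

variable {A : Type v} [Category.{w} A]

/-- A morphism with a quasi-inverse. -/
def IsRegularHom {X Y : A} (f : X ⟶ Y) : Prop := ∃ g : Y ⟶ X, f ≫ g ≫ f = f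

theorem exists_retraction_of_mono (hreg : ∀ {X Y : A} (f : X ⟶ Y), IsRegularHom f) {X Y : A}
    (f : X ⟶ Y) [Mono f] : ∃ r : Y ⟶ X, f ≫ r = 𝟙 X := by
  obtain ⟨g, hg⟩ := hreg f
  exact ⟨g, by rw [← cancel_mono f, Category.assoc, hg, Category.id_comp]⟩

theorem exists_section_of_epi (hreg : ∀ {X Y : A} (f : X ⟶ Y), IsRegularHom f) {X Y : A}
    (f : X ⟶ Y) [Epi f] : ∃ s : Y ⟶ X, s ≫ f = 𝟙 Y := by
  obtain ⟨g, hg⟩ := hreg f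
  exact ⟨g, by rw [← cancel_epi f, hg, Category.comp_id]⟩

variable [Preadditive A]

/-- McCoy's lemma. A quasi-inverse `g` of the remainder, cut down on both sides by `1 - a f` and `1
- f a`, repairs exactly what `a` misses. This permits quasi-inverses to be built one simple summand
at a time. -/
theorem IsRegularHom.of_sub {X Y : A} {f : X ⟶ Y} (a : Y ⟶ X)
    (h : IsRegularHom (f - f ≫ a ≫ f)) : IsRegularHom f := by
  obtain ⟨g, hg⟩ := h
  refine ⟨a + (𝟙 Y - a ≫ f) ≫ g ≫ (𝟙 X - f ≫ a), ?_⟩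
  have h₁ : f ≫ (𝟙 Y - a ≫ f) = f - f ≫ a ≫ f := by simp
  have h₂ : (𝟙 X - f ≫ a) ≫ f = f - f ≫ a ≫ f := by simp
  rw [Preadditive.add_comp, Preadditive.comp_add, Category.assoc, Category.assoc, h₂,
    reassoc_of% h₁, hg]
  abel

/-- A decomposition of `X` as a direct sum of simple objects. -/
structure SimpleDecomposition (X : A) where
  index : Type
  fintype : Fintype index
  summand : index → A
  incl (j : index) : summand j ⟶ X
  proj (j : index) : X ⟶ summand j
  simple (j : index) : Simple (summand j)
  incl_proj (j : index) : incl j ≫ proj j = 𝟙 _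
  incl_proj_ne (j k : index) : j ≠ k → incl j ≫ proj k = 0
  total : ∑ j, proj j ≫ incl j = 𝟙 X

attribute [instance] SimpleDecomposition.fintype

namespace SimpleDecomposition

variable {X : A}

theorem hom_eq_zero (d : SimpleDecomposition X) {Y : A} (f : X ⟶ Y)
    (h : ∀ j, d.incl j ≫ f = 0) : f = 0 := by
  rw [← Category.id_comp f, ← d.total, Preadditive.sum_comp]
  exact Finset.sum_eq_zero fun j _ => by rw [Category.assoc, h, comp_zero]

theorem hom_eq_zero' (d : SimpleDecomposition X) {Y : A} (f : Y ⟶ X)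
    (h : ∀ j, f ≫ d.proj j = 0) : f = 0 := by
  rw [← Category.comp_id f, ← d.total, Preadditive.comp_sum]
  exact Finset.sum_eq_zero fun j _ => by rw [← Category.assoc, h, zero_comp]

/-- Some component of `f` is nonzero, hence an isomorphism by Schur's lemma, and its inverse gives
the retraction. -/
theorem exists_retraction [HasKernels A] (d : SimpleDecomposition X) {Y : A} [Simple Y]
    (f : Y ⟶ X) (hf : f ≠ 0) : ∃ r : X ⟶ Y, f ≫ r = 𝟙 Y := by
  by_contra hc
  apply hf
  refine d.hom_eq_zero' f fun j => ?_
  by_contra hj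
  have := d.simple j
  have := isIso_of_hom_simple hj
  exact hc ⟨d.proj j ≫ inv (f ≫ d.proj j), by rw [← Category.assoc, IsIso.hom_inv_id]⟩

/-- Induction on the set of simple summands of the source on which `f` may be nonzero. A summand on
which `f` is nonzero is a retract of the target, and subtracting the corresponding piece of `f`
kills `f` on it. -/
theorem isRegularHom [HasKernels A] {Y : A} (d : SimpleDecomposition X)
    (d' : SimpleDecomposition Y) (f : X ⟶ Y) : IsRegularHom f := by
  classical
  suffices H : ∀ (s : Finset d.index) (f : X ⟶ Y), (∀ j ∉ s, d.incl j ≫ f = 0) →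
      IsRegularHom f from H Finset.univ f fun j hj => absurd (Finset.mem_univ j) hj
  intro s
  induction s using Finset.induction_on with
  | empty =>
    intro f hf
    have : f = 0 := d.hom_eq_zero f fun j => hf j (Finset.notMem_empty j)
    exact ⟨0, by simp [this]⟩
  | insert k s hk ih =>
    intro f hf
    by_cases h0 : d.incl k ≫ f = 0
    · refine ih f fun j hj => ?_
      by_cases hjk : j = k
      · rw [hjk, h0]
      · exact hf j (by simp [hj, hjk])
    · have := d.simple k
      obtain ⟨r, hr⟩ := d'.exists_retraction _ h0
      -- The remainder vanishes on the summand `k`, and still vanishes wherever `f` did.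
      refine IsRegularHom.of_sub (r ≫ d.incl k) (ih _ fun j hj => ?_)
      by_cases hjk : j = k
      · subst hjk
        have hr' := reassoc_of% hr
        simp [hr']
      · have h := hf j (by simp [hj, hjk])
        simp [reassoc_of% h, h]

end SimpleDecomposition

variable (A) in
/-- Every object is a finite direct sum of simple objects. -/
def HasSimpleDecompositions : Prop := ∀ X : A, Nonempty (SimpleDecomposition X)

theorem IsSemisimple.hasSimpleDecompositions (h : IsSemisimple A) :
    HasSimpleDecompositions A := by
  intro X
  obtain ⟨n, Y, hY, b, ⟨hb⟩, ⟨e⟩⟩ := h.decomposition X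
  refine ⟨⟨Fin n, inferInstance, Y, fun j => b.ι j ≫ e.hom, fun j => e.inv ≫ b.π j, hY,
    fun j => by simp, fun j k hjk => by simp [bicone_ι_π_ne b hjk], ?_⟩⟩
  have ht : ∑ j, b.π j ≫ b.ι j = 𝟙 b.pt := by
    apply hb.isLimit.hom_ext
    rintro ⟨k⟩
    simp only [Bicone.toCone_π_app, Preadditive.sum_comp, Category.assoc, Category.id_comp,
      Bicone.toCone_pt]
    rw [Finset.sum_eq_single k]
    · simp
    · intro j _ hj
      rw [bicone_ι_π_ne b hj, comp_zero]
    · simp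
  have := congrArg (fun t => e.inv ≫ t ≫ e.hom) ht
  simpa [Preadditive.comp_sum, Preadditive.sum_comp] using this

theorem IsSemisimple.isRegularHom (h : IsSemisimple A) {X Y : A} (f : X ⟶ Y) :
    IsRegularHom f := by
  have := h.kernels
  exact (h.hasSimpleDecompositions X).some.isRegularHom (h.hasSimpleDecompositions Y).some f

theorem SimpleDecomposition.exists_bicone {X : A} (d : SimpleDecomposition X) :
    ∃ (n : ℕ) (Y : Fin n → A), (∀ i, Simple (Y i)) ∧
      ∃ b : Bicone Y, Nonempty b.IsBilimit ∧ Nonempty (b.pt ≅ X) := by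
  classical
  let e := (Fintype.equivFin d.index).symm
  refine ⟨Fintype.card d.index, fun i => d.summand (e i), fun i => d.simple _,
    ⟨X, fun i => d.proj (e i), fun i => d.incl (e i), ?_⟩, ⟨?_⟩, ⟨Iso.refl X⟩⟩
  · intro i j
    split_ifs with h
    · subst h
      simpa using d.incl_proj _
    · exact d.incl_proj_ne _ _ fun h' => h (e.injective h')
  · apply isBilimitOfTotal
    exact (e.sum_comp (fun j => d.proj j ≫ d.incl j)).trans d.total

/-- With a quasi-inverse `g`, the composite `f ≫ g` is idempotent and has the same kernel as `f`. So
the kernel is the image of the complementary idempotent. Cokernels are dual. -/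
theorem hasKernels_of_isRegularHom [IsIdempotentComplete A]
    (hreg : ∀ {X Y : A} (f : X ⟶ Y), IsRegularHom f) : HasKernels A where
  has_limit {X Y} f := by
    obtain ⟨g, hg⟩ := hreg f
    obtain ⟨Z, i, q, hiq, hqi⟩ := IsIdempotentComplete.idempotents_split X (𝟙 X - f ≫ g)
      (by simp [reassoc_of% hg])
    have hif : i ≫ f = 0 := by
      rw [← Category.id_comp i, ← hiq, Category.assoc, Category.assoc, reassoc_of% hqi]
      simp [hg]
    have : Mono i := mono_of_mono_fac (h := 𝟙 Z) hiq
    exact ⟨⟨⟨KernelFork.ofι i hif, KernelFork.IsLimit.ofι' i hif fun {W} k hk =>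
      ⟨k ≫ q, by rw [Category.assoc, hqi]; simp [reassoc_of% hk]⟩⟩⟩⟩

theorem hasCokernels_of_isRegularHom [IsIdempotentComplete A]
    (hreg : ∀ {X Y : A} (f : X ⟶ Y), IsRegularHom f) : HasCokernels A where
  has_colimit {X Y} f := by
    obtain ⟨g, hg⟩ := hreg f
    obtain ⟨Z, i, q, hiq, hqi⟩ := IsIdempotentComplete.idempotents_split Y (𝟙 Y - g ≫ f)
      (by simp [hg])
    have hfq : f ≫ q = 0 := by
      rw [← Category.comp_id q, ← hiq, reassoc_of% hqi]
      simp [reassoc_of% hg]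
    have : Epi q := epi_of_epi_fac (h := 𝟙 Z) hiq
    exact ⟨⟨⟨CokernelCofork.ofπ q hfq, CokernelCofork.IsColimit.ofπ' q hfq fun {W} k hk =>
      ⟨i ≫ k, by rw [reassoc_of% hqi]; simp [hk]⟩⟩⟩⟩

/-- A monomorphism splits, and is then the kernel of the idempotent complementary to its image. -/
theorem isNormalMono_of_isRegularHom (hreg : ∀ {X Y : A} (f : X ⟶ Y), IsRegularHom f) :
    IsNormalMonoCategory A where
  normalMonoOfMono {X Y} f _ := by
    obtain ⟨r, hr⟩ := exists_retraction_of_mono hreg f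
    exact ⟨⟨Y, 𝟙 Y - r ≫ f, by simp [reassoc_of% hr],
      KernelFork.IsLimit.ofι' f (by simp [reassoc_of% hr]) fun {W} k hk =>
        ⟨k ≫ r, by
          have : k - k ≫ r ≫ f = 0 := by simpa using hk
          rw [Category.assoc]; exact (sub_eq_zero.mp this).symm⟩⟩⟩

theorem isNormalEpi_of_isRegularHom (hreg : ∀ {X Y : A} (f : X ⟶ Y), IsRegularHom f) :
    IsNormalEpiCategory A where
  normalEpiOfEpi {X Y} f _ := by
    obtain ⟨s, hs⟩ := exists_section_of_epi hreg f
    exact ⟨⟨X, 𝟙 X - f ≫ s, by simp [hs],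
      CokernelCofork.IsColimit.ofπ' f (by simp [hs]) fun {W} k hk =>
        ⟨s ≫ k, by
          have : k - f ≫ s ≫ k = 0 := by simpa using hk
          exact (sub_eq_zero.mp this).symm⟩⟩⟩

/-- Combine decompositions of two complementary summands. -/
def SimpleDecomposition.sum {X Y Z : A} (d : SimpleDecomposition Y) (d' : SimpleDecomposition Z)
    (i : Y ⟶ X) (p : X ⟶ Y) (i' : Z ⟶ X) (p' : X ⟶ Z) (h : i ≫ p = 𝟙 Y) (h' : i' ≫ p' = 𝟙 Z)
    (hip : i ≫ p' = 0) (hip' : i' ≫ p = 0) (ht : p ≫ i + p' ≫ i' = 𝟙 X) :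
    SimpleDecomposition X where
  index := d.index ⊕ d'.index
  fintype := inferInstance
  summand := Sum.elim d.summand d'.summand
  incl j := match j with
    | .inl j => d.incl j ≫ i
    | .inr j => d'.incl j ≫ i'
  proj j := match j with
    | .inl j => p ≫ d.proj j
    | .inr j => p' ≫ d'.proj j
  simple j := match j with
    | .inl j => d.simple j
    | .inr j => d'.simple j
  incl_proj j := match j with
    | .inl j => by simp [reassoc_of% h, d.incl_proj]
    | .inr j => by simp [reassoc_of% h', d'.incl_proj]
  incl_proj_ne j k hjk := match j, k with
    | .inl j, .inl k => by
      change (d.incl j ≫ i) ≫ p ≫ d.proj k = 0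
      rw [Category.assoc, reassoc_of% h, d.incl_proj_ne j k fun e => hjk (congrArg _ e)]
    | .inr j, .inr k => by
      change (d'.incl j ≫ i') ≫ p' ≫ d'.proj k = 0
      rw [Category.assoc, reassoc_of% h', d'.incl_proj_ne j k fun e => hjk (congrArg _ e)]
    | .inl j, .inr k => by
      change (d.incl j ≫ i) ≫ p' ≫ d'.proj k = 0
      rw [Category.assoc, reassoc_of% hip, zero_comp, comp_zero]
    | .inr j, .inl k => by
      change (d'.incl j ≫ i') ≫ p ≫ d.proj k = 0
      rw [Category.assoc, reassoc_of% hip', zero_comp, comp_zero]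
  total := by
    rw [Fintype.sum_sum_type]
    have h₁ := congrArg (fun t => p ≫ t ≫ i) d.total
    have h₂ := congrArg (fun t => p' ≫ t ≫ i') d'.total
    simp only [Preadditive.comp_sum, Preadditive.sum_comp, Category.assoc,
      Category.id_comp] at h₁ h₂
    change ∑ j, (p ≫ d.proj j) ≫ d.incl j ≫ i + ∑ j, (p' ≫ d'.proj j) ≫ d'.incl j ≫ i' = 𝟙 X
    simp only [Category.assoc]
    rw [h₁, h₂, ht]

variable (F : Type u) [Field F] [Linear F A]

/-- The endomorphisms of a retract embed as a corner of those of `X`. The corner contains the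
identity only if the retract is everything. -/
theorem finrank_end_lt {X Y : A} [FiniteDimensional F (X ⟶ X)] (i : Y ⟶ X) (p : X ⟶ Y)
    (h : i ≫ p = 𝟙 Y) (h' : p ≫ i ≠ 𝟙 X) :
    Module.finrank F (Y ⟶ Y) < Module.finrank F (X ⟶ X) := by
  let L : (Y ⟶ Y) →ₗ[F] (X ⟶ X) :=
    { toFun := fun a => p ≫ a ≫ i
      map_add' := by simp
      map_smul' := by simp }
  have hL : Function.Injective L := fun a b hab => by
    have := congrArg (fun t => i ≫ t ≫ p) hab
    simpa [L, h, reassoc_of% h] using this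
  rw [← LinearMap.finrank_range_of_inj hL]
  refine Submodule.finrank_lt fun ht => h' ?_
  obtain ⟨a, ha⟩ : 𝟙 X ∈ LinearMap.range L := by rw [ht]; trivial
  have ha' : p ≫ a ≫ i = 𝟙 X := ha
  have h₂ := congrArg (fun t => t ≫ p ≫ i) ha'
  simp only [Category.assoc, reassoc_of% h, Category.id_comp] at h₂
  rw [← h₂, ha']

/-- Induction on the dimension of the endomorphism space. A nonzero object that is not simple has a
proper nonzero subobject; it splits off, and both it and its complement have smaller endomorphism
spaces. -/
theorem hasSimpleDecompositions_of_isRegularHom [IsIdempotentComplete A]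
    (hreg : ∀ {X Y : A} (f : X ⟶ Y), IsRegularHom f)
    (hfin : ∀ X : A, FiniteDimensional F (X ⟶ X)) : HasSimpleDecompositions A := by
  intro X
  induction hn : Module.finrank F (X ⟶ X) using Nat.strong_induction_on generalizing X with
  | _ n ih =>
  have := hfin X
  by_cases h0 : 𝟙 X = 0
  · exact ⟨⟨Empty, inferInstance, Empty.elim, fun j => j.elim, fun j => j.elim, fun j => j.elim,
      fun j => j.elim, fun j => j.elim, by simp [h0]⟩⟩
  by_cases hs : Simple X
  · exact ⟨⟨Unit, inferInstance, fun _ => X, fun _ => 𝟙 X, fun _ => 𝟙 X, fun _ => hs,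
      fun _ => by simp, fun j k h => (h rfl).elim, by simp⟩⟩
  obtain ⟨Y, f, hf, hne, hniso⟩ : ∃ (Y : A) (f : Y ⟶ X), Mono f ∧ f ≠ 0 ∧ ¬ IsIso f := by
    by_contra hc
    push Not at hc
    refine hs ⟨fun {Y} f hf => ⟨fun hi hz => h0 ?_, fun hz => hc Y f hf hz⟩⟩
    exact (IsIso.inv_hom_id f).symm.trans ((congrArg _ hz).trans comp_zero)
  obtain ⟨r, hr⟩ := exists_retraction_of_mono hreg f
  have hrf : r ≫ f ≠ 𝟙 X := fun h => hniso ⟨r, hr, h⟩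
  obtain ⟨Z, i, q, hiq, hqi⟩ := IsIdempotentComplete.idempotents_split X (𝟙 X - r ≫ f)
    (by simp [reassoc_of% hr])
  have hqi' : q ≫ i ≠ 𝟙 X := fun h => hne (by
    rw [hqi, sub_eq_self] at h
    rw [← Category.id_comp f, ← hr, Category.assoc, h, comp_zero])
  have hfq : f ≫ q = 0 := by
    rw [← Category.comp_id q, ← hiq, reassoc_of% hqi]
    simp [reassoc_of% hr]
  have hir : i ≫ r = 0 := by
    rw [← Category.id_comp i, ← hiq, Category.assoc, Category.assoc, reassoc_of% hqi]
    simp [hr]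
  obtain ⟨d⟩ := ih _ (hn ▸ finrank_end_lt F f r hr hrf) Y rfl
  obtain ⟨d'⟩ := ih _ (hn ▸ finrank_end_lt F i q hiq hqi') Z rfl
  exact ⟨d.sum d' f r i q hr hiq hfq hir (by rw [hqi]; abel)⟩

theorem isSemisimple_of_isRegularHom [IsIdempotentComplete A] [HasFiniteProducts A]
    (hreg : ∀ {X Y : A} (f : X ⟶ Y), IsRegularHom f)
    (hfin : ∀ X : A, FiniteDimensional F (X ⟶ X)) : IsSemisimple A where
  finiteProducts := inferInstance
  kernels := hasKernels_of_isRegularHom hreg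
  cokernels := hasCokernels_of_isRegularHom hreg
  normalMono := isNormalMono_of_isRegularHom hreg
  normalEpi := isNormalEpi_of_isRegularHom hreg
  decomposition X :=
    (hasSimpleDecompositions_of_isRegularHom F hreg hfin X).some.exists_bicone

theorem IsSemisimple.isIdempotentComplete (h : IsSemisimple A) : IsIdempotentComplete A := by
  have := h.kernels
  refine (isIdempotentComplete_iff_hasEqualizer_of_id_and_idempotent A).mpr fun X p _ => ?_
  exact Preadditive.hasEqualizer_of_hasKernel _ _

end vonNeumann

/-! ### Counting simple summands -/

section counting

variable (F : Type u) [Field F] {A : Type v} [Category.{w} A] [Preadditive A] [Linear F A]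

namespace SimpleDecomposition

variable {X : A} (d : SimpleDecomposition X)

def homToEquiv (Y : A) : (Y ⟶ X) ≃ₗ[F] (∀ j, Y ⟶ d.summand j) where
  toFun f j := f ≫ d.proj j
  map_add' f g := by ext; simp
  map_smul' a f := by ext; simp
  invFun g := ∑ j, g j ≫ d.incl j
  left_inv f := by simp [← Preadditive.comp_sum, d.total]
  right_inv g := by
    ext k
    dsimp only
    rw [Preadditive.sum_comp, Finset.sum_eq_single k]
    · simp [d.incl_proj]
    · intro j _ hj
      simp [d.incl_proj_ne j k hj]
    · simp

def homFromEquiv (Y : A) : (X ⟶ Y) ≃ₗ[F] (∀ j, d.summand j ⟶ Y) where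
  toFun f j := d.incl j ≫ f
  map_add' f g := by ext; simp
  map_smul' a f := by ext; simp
  invFun g := ∑ j, d.proj j ≫ g j
  left_inv f := by simp [← Category.assoc, ← Preadditive.sum_comp, d.total]
  right_inv g := by
    ext k
    dsimp only
    rw [Preadditive.comp_sum, Finset.sum_eq_single k]
    · simp [← Category.assoc, d.incl_proj]
    · intro j _ hj
      simp [← Category.assoc, d.incl_proj_ne k j hj.symm]
    · simp

end SimpleDecomposition

variable [IsAlgClosed F] [HasKernels A]

open Classical in
theorem finrank_simple (hfin : ∀ X Y : A, FiniteDimensional F (X ⟶ Y)) (X Y : A) [Simple X]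
    [Simple Y] : Module.finrank F (X ⟶ Y) = if Nonempty (X ≅ Y) then 1 else 0 := by
  have := hfin
  split_ifs with h
  · exact finrank_hom_simple_simple_eq_one_iff F X Y |>.mpr h
  · exact finrank_hom_simple_simple_eq_zero_iff F X Y |>.mpr (not_nonempty_iff.mp h)

theorem finrank_from_simple (hfin : ∀ X Y : A, FiniteDimensional F (X ⟶ Y)) {X : A}
    (d : SimpleDecomposition X) (Y : A) [Simple Y] :
    Module.finrank F (Y ⟶ X) = ∑ j, Module.finrank F (Y ⟶ d.summand j) := by
  have := hfin
  rw [(d.homToEquiv F Y).finrank_eq, Module.finrank_pi_fintype]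

theorem finrank_simple_comm (hfin : ∀ X Y : A, FiniteDimensional F (X ⟶ Y)) {X : A}
    (d : SimpleDecomposition X) (Y : A) [Simple Y] :
    Module.finrank F (X ⟶ Y) = Module.finrank F (Y ⟶ X) := by
  have := hfin
  rw [finrank_from_simple F hfin d, (d.homFromEquiv F Y).finrank_eq, Module.finrank_pi_fintype]
  refine Finset.sum_congr rfl fun j _ => ?_
  have := d.simple j
  rw [finrank_simple F hfin, finrank_simple F hfin]
  congr 1
  exact propext ⟨fun ⟨e⟩ => ⟨e.symm⟩, fun ⟨e⟩ => ⟨e.symm⟩⟩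

variable {F} in
/-- A function on objects that is additive on decompositions into simple objects. -/
def IsAdditiveDim (d : A → F) : Prop :=
  ∀ (X : A) (D : SimpleDecomposition X), d X = ∑ j, d (D.summand j)

/-- An isomorphism from a simple object, as a decomposition. -/
def SimpleDecomposition.ofIso {X Y : A} (hX : Simple X) (e : X ≅ Y) : SimpleDecomposition Y where
  index := Unit
  fintype := inferInstance
  summand _ := X
  incl _ := e.hom
  proj _ := e.inv
  simple _ := hX
  incl_proj _ := by simp
  incl_proj_ne _ _ h := (h rfl).elim
  total := by simp

theorem IsAdditiveDim.iso {F : Type*} [Field F] {d : A → F} (hd : IsAdditiveDim d) {X Y : A}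
    (hX : Simple X) (e : X ≅ Y) : d Y = d X := by
  rw [hd Y (.ofIso hX e)]
  exact Fintype.sum_unique (ι := Unit) fun _ => d X

/-- The class of a simple object. -/
def SimpleClass.mk (X : A) (hX : Simple X) : SimpleClass A :=
  Quotient.mk (simpleSetoid A) ⟨X, hX⟩

theorem simpleClass_iso_iff (c : SimpleClass A) (X : A) (hX : Simple X) :
    Nonempty (c.out.1 ≅ X) ↔ c = .mk X hX := by
  conv_rhs => rw [← Quotient.out_eq c]
  exact Iff.symm Quotient.eq

theorem IsAdditiveDim.eq_sum (hfin : ∀ X Y : A, FiniteDimensional F (X ⟶ Y)) {d : A → F}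
    (hd : IsAdditiveDim d) [Fintype (SimpleClass A)] {X : A} (D : SimpleDecomposition X) :
    d X = ∑ c : SimpleClass A, (Module.finrank F (c.out.1 ⟶ X) : F) * d c.out.1 := by
  classical
  have h : ∀ c : SimpleClass A, (Module.finrank F (c.out.1 ⟶ X) : F) * d c.out.1 =
      ∑ j, if c = .mk (D.summand j) (D.simple j) then
        d (D.summand j) else 0 := by
    intro c
    have hc : Simple c.out.1 := c.out.2
    rw [finrank_from_simple F hfin D, Nat.cast_sum, Finset.sum_mul]
    refine Finset.sum_congr rfl fun j _ => ?_
    have := D.simple j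
    rw [finrank_simple F hfin, ← simpleClass_iso_iff c]
    split_ifs with h
    · rw [Nat.cast_one, one_mul, ← hd.iso hc h.some]
    · simp
  rw [hd X D, Finset.sum_congr rfl fun c _ => h c, Finset.sum_comm]
  simp

variable {B : Type*} [Category* B] [Preadditive B] [Linear F B] [HasKernels B]

/-- Double counting of the multiplicities between the simple objects of two categories that are
related by an adjunction on the level of dimensions of spaces of morphisms. -/
theorem globalDim_eq_mul (hfinA : ∀ X Y : A, FiniteDimensional F (X ⟶ Y))
    (hfinB : ∀ X Y : B, FiniteDimensional F (X ⟶ Y))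
    (hA : HasSimpleDecompositions A) (hB : HasSimpleDecompositions B)
    [Finite (SimpleClass A)] [Finite (SimpleClass B)]
    {dA : A → F} {dB : B → F} (hdA : IsAdditiveDim dA) (hdB : IsAdditiveDim dB)
    (J : A → B) (R : B → A) (n : F) (hJ : ∀ X, dB (J X) = dA X) (hR : ∀ Y, dA (R Y) = n * dB Y)
    (hJR : ∀ X Y, Module.finrank F (Y ⟶ J X) = Module.finrank F (R Y ⟶ X)) :
    globalDim dA = n * globalDim dB := by
  have := Fintype.ofFinite (SimpleClass A)
  have := Fintype.ofFinite (SimpleClass B)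
  rw [globalDim, globalDim, finsum_eq_sum_of_fintype, finsum_eq_sum_of_fintype, Finset.mul_sum]
  -- One of the two factors `d(a)` is `d(J a)`, expanded over the simple objects of `B`. Below, the
  -- factor `n d(b) = d(R b)` is expanded over those of `A`. The two double sums agree by the
  -- adjunction and the symmetry of multiplicities.
  have h₁ : ∀ a : SimpleClass A, dA a.out.1 ^ 2 = ∑ b : SimpleClass B,
      dA a.out.1 * ((Module.finrank F (b.out.1 ⟶ J a.out.1) : F) * dB b.out.1) := by
    intro a
    rw [← Finset.mul_sum, ← hdB.eq_sum F hfinB (hB _).some, hJ, sq]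
  have h₂ : ∀ b : SimpleClass B, n * dB b.out.1 ^ 2 = ∑ a : SimpleClass A,
      ((Module.finrank F (a.out.1 ⟶ R b.out.1) : F) * dA a.out.1) * dB b.out.1 := by
    intro b
    rw [← Finset.sum_mul, ← hdA.eq_sum F hfinA (hA _).some, hR, sq, mul_assoc]
  rw [Finset.sum_congr rfl fun a _ => h₁ a, Finset.sum_congr rfl fun b _ => h₂ b, Finset.sum_comm]
  refine Finset.sum_congr rfl fun b _ => Finset.sum_congr rfl fun a _ => ?_
  have : Simple a.out.1 := a.out.2
  rw [hJR, finrank_simple_comm F hfinA (hA _).some]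
  ring

/-- Each simple object of `B` is isomorphic to a summand of the image of some simple object of `A`.
There are finitely many such summands up to isomorphism. -/
theorem finite_simpleClass [Finite (SimpleClass A)] (hB : HasSimpleDecompositions B) (J : A ⥤ B)
    (h : ∀ Y : B, Simple Y → ∃ X : A, Simple X ∧ ∃ f : Y ⟶ J.obj X, f ≠ 0) :
    Finite (SimpleClass B) := by
  let D (c : SimpleClass A) := (hB (J.obj c.out.1)).some
  let φ : (Σ c : SimpleClass A, (D c).index) → SimpleClass B := fun x =>
    .mk ((D x.1).summand x.2) ((D x.1).simple x.2)
  refine Finite.of_surjective φ fun b => ?_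
  obtain ⟨⟨Y, hY⟩, rfl⟩ := Quotient.exists_rep b
  obtain ⟨X, hX, f, hf⟩ := h Y hY
  let c : SimpleClass A := .mk X hX
  obtain ⟨e⟩ : Nonempty (c.out.1 ≅ X) := (simpleClass_iso_iff c X hX).mpr rfl
  have hf' : f ≫ J.map e.inv ≠ 0 := fun h0 => hf (by
    have := congrArg (· ≫ J.map e.hom) h0
    simpa [← J.map_comp] using this)
  obtain ⟨j, hj⟩ : ∃ j, (f ≫ J.map e.inv) ≫ (D c).proj j ≠ 0 := by
    by_contra hc
    push Not at hc
    exact hf' ((D c).hom_eq_zero' _ hc)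
  have := (D c).simple j
  have := isIso_of_hom_simple hj
  exact ⟨⟨c, j⟩, Quotient.sound ⟨(asIso ((f ≫ J.map e.inv) ≫ (D c).proj j)).symm⟩⟩

end counting

/-! ### Exact pairings -/

section pairing

variable {D : Type*} [Category* D] [MonoidalCategory D]

section
variable {X Y Z : D} [ExactPairing X Y]

theorem eq_of_whiskerRight_evaluation {g g' : Z ⟶ Y}
    (h : g ▷ X ≫ ExactPairing.evaluation X Y = g' ▷ X ≫ ExactPairing.evaluation X Y) :
    g = g' := by
  have key : ∀ g : Z ⟶ Y, g = ((tensorRightHomEquiv Z X Y (𝟙_ D))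
      (g ▷ X ≫ ExactPairing.evaluation X Y)) ≫ (λ_ Y).hom := fun g => by
    simp only [tensorRightHomEquiv, Equiv.coe_fn_mk, comp_whiskerRight, Category.assoc]
    rw [← associator_inv_naturality_left_assoc, whisker_exchange_assoc,
      ExactPairing.coevaluation_evaluation_assoc]
    simp
  rw [key g, key g', h]

theorem eq_of_whiskerLeft_evaluation {g g' : Z ⟶ X}
    (h : Y ◁ g ≫ ExactPairing.evaluation X Y = Y ◁ g' ≫ ExactPairing.evaluation X Y) :
    g = g' := by
  have key : ∀ g : Z ⟶ X, g = ((tensorLeftHomEquiv Z X Y (𝟙_ D))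
      (Y ◁ g ≫ ExactPairing.evaluation X Y)) ≫ (ρ_ X).hom := fun g => by
    simp only [tensorLeftHomEquiv, Equiv.coe_fn_mk, MonoidalCategory.whiskerLeft_comp,
      Category.assoc]
    rw [← associator_naturality_right_assoc, ← whisker_exchange_assoc,
      ExactPairing.evaluation_coevaluation_assoc]
    simp
  rw [key g, key g', h]

end

/-- The coevaluation is determined by the evaluation. -/
theorem coevaluation_comp_of_evaluation {A A' Z : D} (p : ExactPairing A Z)
    (q : ExactPairing A' Z) (e : A ⟶ A') (h : Z ◁ e ≫ q.evaluation' = p.evaluation') :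
    p.coevaluation' ≫ e ▷ Z = q.coevaluation' := by
  apply (tensorLeftHomEquiv (𝟙_ D) A' Z Z).symm.injective
  have key : ∀ t : 𝟙_ D ⟶ A' ⊗ Z, (tensorLeftHomEquiv (𝟙_ D) A' Z Z).symm t =
    Z ◁ t ≫ (α_ _ _ _).inv ≫ q.evaluation' ▷ Z ≫ (λ_ Z).hom := fun t => rfl
  rw [key, key]
  have h₁ := p.coevaluation_evaluation'
  have h₂ := q.coevaluation_evaluation'
  rw [← h, comp_whiskerRight] at h₁
  rw [MonoidalCategory.whiskerLeft_comp, Category.assoc,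
    associator_inv_naturality_middle_assoc, reassoc_of% h₁, reassoc_of% h₂]

/-- The evaluation alone pins down a dual morphism. Pivotality is thus checked by exhibiting one
candidate that satisfies both evaluation identities. -/
theorem rightAdjointMate_eq {X X' Y Y' : D} (rX : ExactPairing X X') (rY : ExactPairing Y Y')
    {f : X ⟶ Y} {g : Y' ⟶ X'} (h : g ▷ X ≫ rX.evaluation' = Y' ◁ f ≫ rY.evaluation') :
    @rightAdjointMate D _ _ X Y ⟨X'⟩ ⟨Y'⟩ f = g := by
  apply eq_of_whiskerRight_evaluation (X := X)
  exact (@rightAdjointMate_comp_evaluation D _ _ X Y ⟨X'⟩ ⟨Y'⟩ f).trans h.symm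

theorem leftAdjointMate_eq {X X' Y Y' : D} (lX : ExactPairing X' X) (lY : ExactPairing Y' Y)
    {f : X ⟶ Y} {g : Y' ⟶ X'} (h : X ◁ g ≫ lX.evaluation' = f ▷ Y' ≫ lY.evaluation') :
    @leftAdjointMate D _ _ X Y ⟨X'⟩ ⟨Y'⟩ f = g := by
  apply eq_of_whiskerLeft_evaluation (Y := X)
  exact (@leftAdjointMate_comp_evaluation D _ _ X Y ⟨X'⟩ ⟨Y'⟩ f).trans h.symm

end pairing

/-! ### Pivotal categories -/

namespace PivotalStructure

variable {D : Type*} [Category* D] [MonoidalCategory D] (P : PivotalStructure D)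

theorem coev_ev (X : D) : P.coev X ▷ X ≫ (α_ _ _ _).hom ≫ X ◁ P.ev X = (λ_ X).hom ≫ (ρ_ X).inv :=
  (P.rightPairing X).evaluation_coevaluation'

theorem coevTilde_evTilde' (X : D) : X ◁ P.coevTilde X ≫ (α_ _ _ _).inv ≫ P.evTilde X ▷ X =
    (ρ_ _).hom ≫ (λ_ _).inv :=
  (P.leftPairing X).coevaluation_evaluation'

/-- The dual morphism. -/
def dualMap {X Y : D} (f : X ⟶ Y) : P.dual Y ⟶ P.dual X :=
  @rightAdjointMate D _ _ X Y (@HasRightDual.mk D _ _ X (P.dual X) (P.rightPairing X))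
    (@HasRightDual.mk D _ _ Y (P.dual Y) (P.rightPairing Y)) f

section
variable {X Y Z : D} (f : X ⟶ Y)

theorem dualMap_ev : P.dualMap f ▷ X ≫ P.ev X = P.dual Y ◁ f ≫ P.ev Y :=
  @rightAdjointMate_comp_evaluation D _ _ X Y (@HasRightDual.mk D _ _ X (P.dual X) (P.rightPairing X))
    (@HasRightDual.mk D _ _ Y (P.dual Y) (P.rightPairing Y)) f

/-- Pivotality in use: the dual morphism, defined by the right pairings, also slides through the
left ones. -/
theorem dualMap_evTilde : X ◁ P.dualMap f ≫ P.evTilde X = f ▷ P.dual Y ≫ P.evTilde Y := by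
  rw [dualMap, P.mate_eq]
  exact @leftAdjointMate_comp_evaluation D _ _ X Y (@HasLeftDual.mk D _ _ X (P.dual X) (P.leftPairing X))
    (@HasLeftDual.mk D _ _ Y (P.dual Y) (P.leftPairing Y)) f

theorem coevTilde_dualMap : P.coevTilde Y ≫ P.dualMap f ▷ Y = P.coevTilde X ≫ P.dual X ◁ f := by
  rw [dualMap, P.mate_eq]
  exact @coevaluation_comp_leftAdjointMate D _ _ X Y (@HasLeftDual.mk D _ _ X (P.dual X) (P.leftPairing X))
    (@HasLeftDual.mk D _ _ Y (P.dual Y) (P.leftPairing Y)) f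

theorem hom_ext_ev {g g' : Z ⟶ P.dual X} (h : g ▷ X ≫ P.ev X = g' ▷ X ≫ P.ev X) : g = g' :=
  @eq_of_whiskerRight_evaluation D _ _ _ _ _ (P.rightPairing X) _ _ h

theorem hom_ext_ev' {g g' : Z ⟶ X} (h : P.dual X ◁ g ≫ P.ev X = P.dual X ◁ g' ≫ P.ev X) :
    g = g' :=
  @eq_of_whiskerLeft_evaluation D _ _ _ _ _ (P.rightPairing X) _ _ h

@[simp]
theorem dualMap_id : P.dualMap (𝟙 X) = 𝟙 _ := P.hom_ext_ev (by simp [dualMap_ev])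

theorem dualMap_comp (g : Y ⟶ Z) : P.dualMap (f ≫ g) = P.dualMap g ≫ P.dualMap f := by
  apply P.hom_ext_ev
  rw [dualMap_ev, comp_whiskerRight, Category.assoc, dualMap_ev, ← whisker_exchange_assoc,
    dualMap_ev, MonoidalCategory.whiskerLeft_comp, Category.assoc]

end

/-- The morphism `f` is carried once around the loop, travelling along the dual strand as its dual.
-/
theorem leftTrace_comp {X Y : D} (f : X ⟶ Y) (g : Y ⟶ X) :
    P.leftTrace (f ≫ g) = P.leftTrace (g ≫ f) := by
  simp only [leftTrace, MonoidalCategory.whiskerLeft_comp, Category.assoc]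
  rw [← reassoc_of% P.coevTilde_dualMap f, ← whisker_exchange_assoc, dualMap_ev]

/-- The pairings of `X ⊗ Y` may be replaced by nested pairings of `X` and `Y`, by monoidality of the
duality. Hence the trace can be taken over `X` first. -/
theorem leftTrace_tensor {X Y : D} (f : X ⊗ Y ⟶ X ⊗ Y) :
    P.leftTrace f = P.leftTrace ((λ_ Y).inv ≫ P.coevTilde X ▷ Y ≫ (α_ _ _ _).hom ≫
      P.dual X ◁ f ≫ (α_ _ _ _).inv ≫ P.ev X ▷ Y ≫ (λ_ Y).hom) := by
  obtain ⟨e, he, he'⟩ := P.tensor_eq X Y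
  have hc := coevaluation_comp_of_evaluation _ _ e.hom he'
  change _ = P.coevTilde (X ⊗ Y) at hc
  change e.hom ▷ (X ⊗ Y) ≫ P.ev (X ⊗ Y) = _ at he
  have h₁ : P.leftTrace f = (P.coevTilde Y ⊗≫ (P.dual Y ◁ P.coevTilde X) ▷ Y ⊗≫ 𝟙 _) ≫
      (P.dual Y ⊗ P.dual X) ◁ f ≫ (𝟙 _ ⊗≫ P.dual Y ◁ (P.ev X ▷ Y) ⊗≫ P.ev Y) := by
    rw [leftTrace, ← hc, Category.assoc, ← whisker_exchange_assoc, he]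
    rfl
  rw [h₁, leftTrace]
  monoidal

/-! ### Ribbon categories -/

section ribbon

variable [BraidedCategory D]

theorem twist_eq (X : D) : P.twist X = (ρ_ X).inv ≫ X ◁ P.coevTilde X ≫ (α_ _ _ _).inv ≫
    ((β_ (P.dual X) X).inv ≫ P.ev X) ▷ X ≫ (λ_ X).hom := by
  have h := BraidedCategory.braiding_naturality_left (P.coevTilde X) X
  rw [BraidedCategory.braiding_tensor_left_hom, braiding_tensorUnit_left] at h
  have h' := congrArg (fun t => (λ_ X).inv ≫ t ≫ (α_ _ _ _).inv ≫
    ((β_ (P.dual X) X).inv ≫ P.ev X) ▷ X ≫ (λ_ X).hom) h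
  simp only [Category.assoc, Iso.inv_hom_id_assoc, comp_whiskerRight, Iso.hom_inv_id_assoc,
    hom_inv_whiskerRight_assoc] at h'
  rw [twist, h']
  simp

/-- The twist measures the difference between `evTilde` and the evaluation `ev` transported by the
inverse braiding. Both sides have the same image under the duality bijection, where the left one is
the kink `twist_eq`. -/
theorem twist_evTilde (X : D) :
    (β_ (P.dual X) X).inv ≫ P.ev X = P.twist X ▷ P.dual X ≫ P.evTilde X := by
  let _ := P.leftPairing X
  apply (tensorRightHomEquiv X (P.dual X) X (𝟙_ D)).injective
  have key : ∀ t : X ⊗ P.dual X ⟶ 𝟙_ D, tensorRightHomEquiv X (P.dual X) X (𝟙_ D) t =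
    (ρ_ X).inv ≫ X ◁ P.coevTilde X ≫ (α_ _ _ _).inv ≫ t ▷ X := fun t => rfl
  rw [key, key, ← cancel_mono (λ_ X).hom]
  simp only [Category.assoc]
  rw [← twist_eq, comp_whiskerRight, Category.assoc, ← associator_inv_naturality_left_assoc,
    whisker_exchange_assoc, reassoc_of% P.coevTilde_evTilde' X]
  simp

theorem twistTilde_eq (X : D) : P.twistTilde X = (λ_ X).inv ≫ P.coev X ▷ X ≫ (α_ _ _ _).hom ≫
    X ◁ ((β_ X (P.dual X)).inv ≫ P.evTilde X) ≫ (ρ_ X).hom := by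
  have h := BraidedCategory.braiding_naturality_right X (P.coev X)
  rw [BraidedCategory.braiding_tensor_right_hom, braiding_tensorUnit_right] at h
  have h' := congrArg (fun t => (ρ_ X).inv ≫ t ≫ (α_ _ _ _).hom ≫
    X ◁ ((β_ X (P.dual X)).inv ≫ P.evTilde X) ≫ (ρ_ X).hom) h
  simp only [Category.assoc, Iso.inv_hom_id_assoc, MonoidalCategory.whiskerLeft_comp,
    whiskerLeft_hom_inv_assoc] at h'
  rw [twistTilde, h']
  simp

theorem twistTilde_ev (X : D) :
    (β_ X (P.dual X)).inv ≫ P.evTilde X = P.dual X ◁ P.twistTilde X ≫ P.ev X := by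
  let _ := P.rightPairing X
  apply (tensorLeftHomEquiv X X (P.dual X) (𝟙_ D)).injective
  have key : ∀ t : P.dual X ⊗ X ⟶ 𝟙_ D, tensorLeftHomEquiv X X (P.dual X) (𝟙_ D) t =
    (λ_ X).inv ≫ P.coev X ▷ X ≫ (α_ _ _ _).hom ≫ X ◁ t := fun t => rfl
  rw [key, key, ← cancel_mono (ρ_ X).hom]
  simp only [Category.assoc]
  rw [← twistTilde_eq, MonoidalCategory.whiskerLeft_comp, Category.assoc,
    ← associator_naturality_right_assoc, ← whisker_exchange_assoc, reassoc_of% P.coev_ev X]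
  simp

theorem twistTilde_eq' (X : D) : P.twistTilde X = (ρ_ X).inv ≫
    X ◁ (P.coev X ≫ (β_ (P.dual X) X).inv) ≫ (α_ _ _ _).inv ≫ P.evTilde X ▷ X ≫ (λ_ X).hom := by
  have h := BraidedCategory.braiding_naturality_left (P.evTilde X) X
  rw [BraidedCategory.braiding_tensor_left_hom, braiding_tensorUnit_left] at h
  have h' := congrArg (fun t => (ρ_ X).inv ≫ X ◁ (P.coev X ≫ (β_ (P.dual X) X).inv) ≫
    (α_ _ _ _).inv ≫ t ≫ (ρ_ X).hom) h
  simp only [Category.assoc, Iso.inv_hom_id_assoc, MonoidalCategory.whiskerLeft_comp,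
    whiskerLeft_inv_hom_assoc, Iso.inv_hom_id, Category.comp_id] at h'
  rw [twistTilde, MonoidalCategory.whiskerLeft_comp, Category.assoc, h']

theorem coev_braiding (X : D) :
    P.coev X ≫ (β_ (P.dual X) X).inv = P.coevTilde X ≫ P.dual X ◁ P.twistTilde X := by
  let _ := P.leftPairing X
  apply (tensorLeftHomEquiv (𝟙_ D) (P.dual X) X X).symm.injective
  have key : ∀ t : 𝟙_ D ⟶ P.dual X ⊗ X, (tensorLeftHomEquiv (𝟙_ D) (P.dual X) X X).symm t =
    X ◁ t ≫ (α_ _ _ _).inv ≫ P.evTilde X ▷ X ≫ (λ_ X).hom := fun t => rfl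
  rw [key, key, ← cancel_epi (ρ_ X).inv, ← twistTilde_eq', MonoidalCategory.whiskerLeft_comp,
    Category.assoc, associator_inv_naturality_right_assoc, whisker_exchange_assoc,
    reassoc_of% P.coevTilde_evTilde' X]
  simp

theorem twist_natural {X Y : D} (f : X ⟶ Y) : f ≫ P.twist Y = P.twist X ≫ f := by
  have h : f ▷ P.dual Y ≫ (β_ (P.dual Y) Y).inv ≫ P.ev Y =
      X ◁ P.dualMap f ≫ (β_ (P.dual X) X).inv ≫ P.ev X := by
    rw [BraidedCategory.braiding_inv_naturality_left_assoc, ← dualMap_ev,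
      BraidedCategory.braiding_inv_naturality_right_assoc]
  rw [twist_eq, twist_eq]
  calc _ = (ρ_ X).inv ≫ X ◁ P.coevTilde Y ≫ (α_ _ _ _).inv ≫
        (f ▷ P.dual Y ≫ (β_ (P.dual Y) Y).inv ≫ P.ev Y) ▷ Y ≫ (λ_ Y).hom := by
        rw [comp_whiskerRight (f ▷ P.dual Y), Category.assoc,
          ← associator_inv_naturality_left_assoc, whisker_exchange_assoc]
        simp
    _ = (ρ_ X).inv ≫ X ◁ (P.coevTilde Y ≫ P.dualMap f ▷ Y) ≫ (α_ _ _ _).inv ≫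
        ((β_ (P.dual X) X).inv ≫ P.ev X) ▷ Y ≫ (λ_ Y).hom := by
        rw [h, comp_whiskerRight, MonoidalCategory.whiskerLeft_comp]
        simp
    _ = _ := by
        rw [coevTilde_dualMap, MonoidalCategory.whiskerLeft_comp]
        simp only [Category.assoc]
        rw [associator_inv_naturality_right_assoc, whisker_exchange_assoc]
        simp

/-- With `ev` and `coev` expressed through `evTilde`, `coevTilde`, the braiding and the twist, both
traces become the same closed diagram carrying `f` and the twist in opposite orders. The ribbon
condition identifies the two twists, and naturality commutes them past `f`. -/
theorem IsRibbon.isSpherical {P : PivotalStructure D} (hP : P.IsRibbon) : P.IsSpherical := by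
  intro X f
  have h₁ : P.ev X = (β_ (P.dual X) X).hom ≫ P.twist X ▷ P.dual X ≫ P.evTilde X := by
    rw [← twist_evTilde, Iso.hom_inv_id_assoc]
  have h₂ : P.coev X = P.coevTilde X ≫ P.dual X ◁ P.twist X ≫ (β_ (P.dual X) X).hom := by
    rw [hP X, ← Category.assoc, ← coev_braiding, Category.assoc, Iso.inv_hom_id,
      Category.comp_id]
  rw [leftTrace, rightTrace, h₁, h₂]
  simp only [Category.assoc]
  rw [← BraidedCategory.braiding_naturality_right_assoc,
    ← BraidedCategory.braiding_naturality_right_assoc,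
    ← MonoidalCategory.whiskerLeft_comp_assoc, ← MonoidalCategory.whiskerLeft_comp_assoc,
    twist_natural]

/-- The twist relates `ev` to `evTilde` through one inverse braiding and `evTilde` to `ev` through
the other. Without monodromy between `X` and its dual the braidings cancel, leaving the square of
the twist. -/
theorem twist_sq {P : PivotalStructure D} (hP : P.IsRibbon) (X : D)
    (h : (β_ X (P.dual X)).hom ≫ (β_ (P.dual X) X).hom = 𝟙 _) : P.twist X ≫ P.twist X = 𝟙 X := by
  apply P.hom_ext_ev'
  have h₁ := P.twist_evTilde X
  have h₂ := P.twistTilde_ev X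
  have h₃ : (β_ (P.dual X) X).inv = (β_ X (P.dual X)).hom := by
    rw [← cancel_mono (β_ (P.dual X) X).hom, h, Iso.inv_hom_id]
  rw [← hP X] at h₂
  rw [MonoidalCategory.whiskerLeft_comp, Category.assoc, ← h₂, ← cancel_epi (β_ _ _).hom,
    ← BraidedCategory.braiding_naturality_left_assoc, Iso.hom_inv_id_assoc, ← h₁, h₃,
    MonoidalCategory.whiskerLeft_id, Category.id_comp]

end ribbon

end PivotalStructure

section

/-! ### The tensor product of the crossed product -/

namespace Crossed

open ComonObj

variable {C : Type v} [Category.{w} C] [MonoidalCategory C] [BraidedCategory C] {Γ : C}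
  [ComonObj Γ] [IsCommComonObj Γ]

theorem split_counit_right (X Z : C) :
    split Γ X Z ≫ (Γ ⊗ X) ◁ (ε[Γ] ▷ Z ≫ (λ_ Z).hom) = (α_ Γ X Z).inv := by
  have h := tensorμ_natural_left (𝟙 Γ) ε[Γ] X Z
  simp only [id_whiskerRight, id_tensorHom] at h
  rw [split, MonoidalCategory.whiskerLeft_comp, Category.assoc, ← reassoc_of% h,
    ← comp_whiskerRight_assoc, comul_counit]
  simp only [tensorμ, braiding_tensorUnit_left]
  monoidal

theorem split_counit_left (X Z : C) :
    split Γ X Z ≫ (ε[Γ] ▷ X ≫ (λ_ X).hom) ▷ (Γ ⊗ Z) =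
      (α_ Γ X Z).inv ≫ (β_ Γ X).hom ▷ Z ≫ (α_ X Γ Z).hom := by
  have h := tensorμ_natural_left ε[Γ] (𝟙 Γ) X Z
  simp only [id_whiskerRight, tensorHom_id] at h
  rw [split, comp_whiskerRight, Category.assoc, ← reassoc_of% h,
    ← comp_whiskerRight_assoc, counit_comul]
  simp only [tensorμ]
  monoidal

theorem whiskerRight_hom {X Y : Crossed Γ} (s : X ⟶ Y) (Z : Crossed Γ) :
    Hom.hom (s ▷ Z) = (α_ Γ X.obj Z.obj).inv ≫ s.hom ▷ Z.obj := by
  rw [← split_counit_right, Category.assoc, ← MonoidalCategory.tensorHom_def']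
  rfl

/-- The counit deletes one of the two copies of `Γ`. The remaining one must pass `Z` to reach `t`,
whereas in `whiskerRight_hom` it is already adjacent to `s`. All braidings in later computations
come from this asymmetry. -/
theorem whiskerLeft_hom (Z : Crossed Γ) {X Y : Crossed Γ} (t : X ⟶ Y) :
    Hom.hom (Z ◁ t) = (α_ Γ Z.obj X.obj).inv ≫ (β_ Γ Z.obj).hom ▷ X.obj ≫
      (α_ Z.obj Γ X.obj).hom ≫ Z.obj ◁ t.hom := by
  have h := split_counit_left (Γ := Γ) Z.obj X.obj
  rw [← reassoc_of% h, ← MonoidalCategory.tensorHom_def]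
  rfl

theorem incl_whiskerRight {X Y : C} (s : X ⟶ Y) (Z : C) :
    (incl Γ).map s ▷ of Z = (incl Γ).map (s ▷ Z) := by
  rw [← tensorHom_id]
  exact incl_tensor_id s

theorem incl_whiskerLeft (Z : C) {X Y : C} (s : X ⟶ Y) :
    of Z ◁ (incl Γ).map s = (incl Γ).map (Z ◁ s) := by
  rw [← id_tensorHom]
  exact id_tensor_incl s

theorem associator_hom_eq (X Y Z : Crossed Γ) :
    (α_ X Y Z).hom = (incl Γ).map (α_ X.obj Y.obj Z.obj).hom := rfl

theorem leftUnitor_hom_eq (X : Crossed Γ) : (λ_ X).hom = (incl Γ).map (λ_ X.obj).hom := rfl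

theorem rightUnitor_hom_eq (X : Crossed Γ) : (ρ_ X).hom = (incl Γ).map (ρ_ X.obj).hom := rfl

instance [IsStrictMonoidal C] : IsStrictMonoidal (Crossed Γ) where
  tensor_assoc X Y Z := congrArg of (IsStrictMonoidal.tensor_assoc X.obj Y.obj Z.obj)
  unit_tensor X := congrArg of (IsStrictMonoidal.unit_tensor X.obj)
  tensor_unit X := congrArg of (IsStrictMonoidal.tensor_unit X.obj)
  associator_eq X Y Z := by
    rw [associator_hom_eq, IsStrictMonoidal.associator_eq]
    exact eqToHom_map (incl Γ) _
  leftUnitor_eq X := by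
    rw [leftUnitor_hom_eq, IsStrictMonoidal.leftUnitor_eq]
    exact eqToHom_map (incl Γ) _
  rightUnitor_eq X := by
    rw [rightUnitor_hom_eq, IsStrictMonoidal.rightUnitor_eq]
    exact eqToHom_map (incl Γ) _

variable (Γ) in
theorem isStrictMonoidalFunctor_incl : IsStrictMonoidalFunctor (incl Γ) where
  obj_unit := rfl
  obj_tensor _ _ := rfl
  map_tensor f g := heq_of_eq (incl_tensor f g).symm
  map_associator _ _ _ := HEq.rfl
  map_leftUnitor _ := HEq.rfl
  map_rightUnitor _ := HEq.rfl

section linear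

variable [Preadditive C] [MonoidalPreadditive C]

theorem zero_hom (X Y : Crossed Γ) : Hom.hom (0 : X ⟶ Y) = 0 := rfl

instance : MonoidalPreadditive (Crossed Γ) where
  whiskerLeft_zero := by intros; ext; simp [whiskerLeft_hom, zero_hom]
  zero_whiskerRight := by intros; ext; simp [whiskerRight_hom, zero_hom]
  whiskerLeft_add f g := by ext; simp [whiskerLeft_hom, add_hom]
  add_whiskerRight f g := by ext; simp [whiskerRight_hom, add_hom]

instance : (incl Γ).Additive where
  map_add {X Y f g} := Hom.ext (by
    change ε[Γ] ▷ X ≫ (λ_ X).hom ≫ (f + g) =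
      ε[Γ] ▷ X ≫ (λ_ X).hom ≫ f + ε[Γ] ▷ X ≫ (λ_ X).hom ≫ g
    simp)

variable (F : Type u) [Field F] [Linear F C] [MonoidalLinear F C]

instance : MonoidalLinear F (Crossed Γ) where
  whiskerLeft_smul := by intros; ext; simp [whiskerLeft_hom, smul_hom]
  smul_whiskerRight := by intros; ext; simp [whiskerRight_hom, smul_hom]

def homLinearEquiv (X Y : Crossed Γ) : (X ⟶ Y) ≃ₗ[F] (Γ ⊗ X.obj ⟶ Y.obj) where
  __ := homEquiv X Y
  map_add' _ _ := rfl
  map_smul' _ _ := rfl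

/-- The tensor structure of `Crossed Γ`, if `Hom(Γ, 𝟙)` is spanned by the counit. -/
theorem isLinearTensor (hfin : ∀ X Y : C, FiniteDimensional F (X ⟶ Y))
    (hε : Function.Bijective fun a : F => a • ε[Γ]) : IsLinearTensor F (Crossed Γ) where
  preadditive := inferInstance
  linear := inferInstance
  hom_finite X Y :=
    have := hfin (Γ ⊗ X.obj) Y.obj
    (homLinearEquiv F X Y).symm.finiteDimensional
  end_unit := by
    have h : ∀ a : F, Hom.hom (a • 𝟙 (𝟙_ (Crossed Γ))) = (ρ_ Γ).hom ≫ (a • ε[Γ]) := fun a => by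
      rw [smul_hom, id_hom, Linear.comp_smul]
      congr 1
      change ε[Γ] ▷ 𝟙_ C ≫ (λ_ (𝟙_ C)).hom = _
      rw [unitors_equal, rightUnitor_naturality]
    constructor
    · intro a b hab
      apply hε.1
      have h' := congrArg Hom.hom hab
      rw [h, h, cancel_epi] at h'
      exact h'
    · intro s
      obtain ⟨a, ha⟩ := hε.2 ((ρ_ Γ).inv ≫ s.hom)
      refine ⟨a, ?_⟩
      ext
      dsimp only at ha ⊢
      rw [h, ha, Iso.hom_inv_id_assoc]

end linear

/-! ### The pivotal structure of the crossed product -/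

section pivotal

variable (P : PivotalStructure C)

/-- The image in `Crossed Γ` of an exact pairing. -/
@[reducible]
def inclPairing {X Y : C} (p : ExactPairing X Y) : ExactPairing (of X : Crossed Γ) (of Y) where
  coevaluation' := (incl Γ).map p.coevaluation'
  evaluation' := (incl Γ).map p.evaluation'
  coevaluation_evaluation' := by
    have h := congrArg (incl Γ).map p.coevaluation_evaluation'
    simp only [Functor.map_comp] at h
    rw [← incl_whiskerRight, ← incl_whiskerLeft] at h
    exact h
  evaluation_coevaluation' := by
    have h := congrArg (incl Γ).map p.evaluation_coevaluation'
    simp only [Functor.map_comp] at h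
    rw [← incl_whiskerRight, ← incl_whiskerLeft] at h
    exact h

/-- The dual in `Crossed Γ` of a morphism `s : Γ ⊗ X ⟶ Y`. -/
theorem exists_mate (hΓ : (β_ Γ (P.dual Γ)).hom ≫ P.ev Γ = P.evTilde Γ) {X Y : C}
    (s : Γ ⊗ X ⟶ Y) : ∃ g : Γ ⊗ P.dual Y ⟶ P.dual X,
      g ▷ X ≫ P.ev X = (β_ Γ (P.dual Y)).hom ▷ X ≫ (α_ _ _ _).hom ≫ P.dual Y ◁ s ≫ P.ev Y ∧
      (β_ Γ X).hom ▷ P.dual Y ≫ (α_ _ _ _).hom ≫ X ◁ g ≫ P.evTilde X =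
        s ▷ P.dual Y ≫ P.evTilde Y := by
  obtain ⟨e, he, he'⟩ := P.tensor_eq Γ X
  change e.hom ▷ (Γ ⊗ X) ≫ P.ev (Γ ⊗ X) = 𝟙 _ ⊗≫ P.dual X ◁ (P.ev Γ ▷ X) ⊗≫ P.ev X at he
  change (Γ ⊗ X) ◁ e.hom ≫ P.evTilde (Γ ⊗ X) =
    𝟙 _ ⊗≫ Γ ◁ (P.evTilde X ▷ P.dual Γ) ⊗≫ P.evTilde Γ at he'
  -- The dual in `C` of `s`, as a map from the dual of `Y` to the tensor product of the duals of `X`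
  -- and `Γ`. The mate `g` arises by closing its `Γ` leg against the input `Γ`.
  let t := P.dualMap s ≫ e.inv
  have ht : P.dual Y ◁ s ≫ P.ev Y = t ▷ (Γ ⊗ X) ≫ (𝟙 _ ⊗≫ P.dual X ◁ (P.ev Γ ▷ X) ⊗≫ P.ev X) := by
    rw [← he, ← comp_whiskerRight_assoc, Category.assoc, Iso.inv_hom_id, Category.comp_id,
      P.dualMap_ev]
  have ht' : s ▷ P.dual Y ≫ P.evTilde Y =
      (Γ ⊗ X) ◁ t ≫ (𝟙 _ ⊗≫ Γ ◁ (P.evTilde X ▷ P.dual Γ) ⊗≫ P.evTilde Γ) := by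
    rw [← he', ← MonoidalCategory.whiskerLeft_comp_assoc, Category.assoc, Iso.inv_hom_id,
      Category.comp_id, P.dualMap_evTilde]
  refine ⟨(β_ Γ (P.dual Y)).hom ≫ t ▷ Γ ≫ (α_ _ _ _).hom ≫ P.dual X ◁ P.ev Γ ≫ (ρ_ _).hom,
    ?_, ?_⟩
  · rw [ht]
    monoidal
  -- Pulling the input `Γ` to the other side of `t` replaces `ev` by `evTilde` on `Γ`, by `hΓ`. This
  -- makes the one candidate `g` work for both pairings.
  · have h₁ : (β_ Γ (P.dual Y)).hom ≫ t ▷ Γ ≫ (α_ _ _ _).hom ≫ P.dual X ◁ P.ev Γ ≫ (ρ_ _).hom =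
        Γ ◁ t ≫ (α_ _ _ _).inv ≫ (β_ Γ (P.dual X)).hom ▷ P.dual Γ ≫ (α_ _ _ _).hom ≫
          P.dual X ◁ P.evTilde Γ ≫ (ρ_ _).hom := by
      rw [← BraidedCategory.braiding_naturality_right_assoc,
        BraidedCategory.braiding_tensor_right_hom, ← hΓ]
      simp
    have h₂ := BraidedCategory.braiding_naturality_right Γ (P.evTilde X)
    rw [BraidedCategory.braiding_tensor_right_hom, braiding_tensorUnit_right] at h₂
    rw [h₁, ht']
    calc _ = ((β_ Γ X).hom ▷ P.dual Y ≫ (X ⊗ Γ) ◁ t) ⊗≫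
          (X ◁ (β_ Γ (P.dual X)).hom) ▷ P.dual Γ ⊗≫ (X ⊗ P.dual X) ◁ P.evTilde Γ ⊗≫
          P.evTilde X := by monoidal
      _ = (Γ ⊗ X) ◁ t ⊗≫ ((β_ Γ X).hom ▷ P.dual X ⊗≫ X ◁ (β_ Γ (P.dual X)).hom) ▷ P.dual Γ ⊗≫
          ((X ⊗ P.dual X) ◁ P.evTilde Γ ≫ P.evTilde X ▷ _) ⊗≫ 𝟙 _ := by
          rw [← whisker_exchange]
          monoidal
      _ = (Γ ⊗ X) ◁ t ⊗≫ (((α_ _ _ _).inv ≫ (β_ Γ X).hom ▷ P.dual X ≫ (α_ _ _ _).hom ≫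
            X ◁ (β_ Γ (P.dual X)).hom ≫ (α_ _ _ _).inv) ≫ P.evTilde X ▷ Γ) ▷ P.dual Γ ⊗≫
          P.evTilde Γ ⊗≫ 𝟙 _ := by
          rw [whisker_exchange]
          monoidal
      _ = _ := by
          rw [← h₂]
          monoidal

theorem tensorEvaluation_eq {D : Type*} [Category* D] [MonoidalCategory D] {X₁ X₂ Y₁ Y₂ : D}
    (p₁ : ExactPairing X₁ Y₁) (p₂ : ExactPairing X₂ Y₂) :
    (@ExactPairing.tensor D _ _ X₁ X₂ Y₁ Y₂ p₁ p₂).evaluation' = (α_ _ _ _).hom ≫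
      Y₂ ◁ ((α_ _ _ _).inv ≫ p₁.evaluation' ▷ X₂ ≫ (λ_ X₂).hom) ≫ p₂.evaluation' := by
  change 𝟙 _ ⊗≫ Y₂ ◁ (p₁.evaluation' ▷ X₂) ⊗≫ p₂.evaluation' = _
  monoidal

theorem inclPairing_tensor {X₁ X₂ Y₁ Y₂ : C} (p₁ : ExactPairing X₁ Y₁)
    (p₂ : ExactPairing X₂ Y₂) :
    (@ExactPairing.tensor (Crossed Γ) _ _ _ _ _ _ (inclPairing p₁)
      (inclPairing p₂)).evaluation' =
      (incl Γ).map (@ExactPairing.tensor C _ _ X₁ X₂ Y₁ Y₂ p₁ p₂).evaluation' := by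
  rw [tensorEvaluation_eq, tensorEvaluation_eq]
  simp only [Functor.map_comp, ← incl_whiskerLeft, ← incl_whiskerRight]
  rfl

/-- The pivotal structure of the crossed product. -/
def pivotalStructure (hΓ : (β_ Γ (P.dual Γ)).hom ≫ P.ev Γ = P.evTilde Γ) :
    PivotalStructure (Crossed Γ) where
  dual X := of (P.dual X.obj)
  rightPairing X := inclPairing (P.rightPairing X.obj)
  leftPairing X := inclPairing (P.leftPairing X.obj)
  mate_eq {X Y} f := by
    obtain ⟨g, h₁, h₂⟩ := exists_mate P hΓ f.hom
    let g' : (of (P.dual Y.obj) : Crossed Γ) ⟶ of (P.dual X.obj) := ⟨g⟩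
    refine (rightAdjointMate_eq _ _ (g := g') ?_).trans (leftAdjointMate_eq _ _ ?_).symm
    · refine Hom.ext ((comp_incl_hom _ _).trans (Eq.trans ?_ (comp_incl_hom _ _).symm))
      refine (congrArg (· ≫ P.ev X.obj) (whiskerRight_hom g' X)).trans (Eq.trans ?_
        (congrArg (· ≫ P.ev Y.obj) (whiskerLeft_hom (of (P.dual Y.obj)) f)).symm)
      simpa using h₁
    · refine Hom.ext ((comp_incl_hom _ _).trans (Eq.trans ?_ (comp_incl_hom _ _).symm))
      refine (congrArg (· ≫ P.evTilde X.obj) (whiskerLeft_hom X g')).trans (Eq.trans ?_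
        (congrArg (· ≫ P.evTilde Y.obj) (whiskerRight_hom f (of (P.dual Y.obj)))).symm)
      simpa using h₂
  tensor_eq X Y := by
    obtain ⟨e, h₁, h₂⟩ := P.tensor_eq X.obj Y.obj
    refine ⟨(incl Γ).mapIso e, Eq.trans ?_ (inclPairing_tensor _ _).symm,
      Eq.trans ?_ (inclPairing_tensor _ _).symm⟩
    · rw [← h₁, Functor.map_comp, ← incl_whiskerRight]
      rfl
    · rw [← h₂, Functor.map_comp, ← incl_whiskerLeft]
      rfl
  unit_eq := by
    obtain ⟨e, h₁, h₂⟩ := P.unit_eq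
    refine ⟨(incl Γ).mapIso e, ?_, ?_⟩
    · refine Eq.trans ?_ (congrArg (incl Γ).map h₁)
      rw [Functor.map_comp, ← incl_whiskerRight]
      rfl
    · refine Eq.trans ?_ (congrArg (incl Γ).map h₂)
      rw [Functor.map_comp, ← incl_whiskerLeft]
      rfl

theorem extends_pivotalStructure (hΓ : (β_ Γ (P.dual Γ)).hom ≫ P.ev Γ = P.evTilde Γ) :
    P.Extends (incl Γ) (pivotalStructure P hΓ) where
  dual_obj _ := rfl
  ev_eq _ := HEq.rfl
  coev_eq _ := HEq.rfl
  evTilde_eq _ := HEq.rfl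
  coevTilde_eq _ := HEq.rfl

variable {P} (hΓ : (β_ Γ (P.dual Γ)).hom ≫ P.ev Γ = P.evTilde Γ)

theorem leftTrace_hom {X : Crossed Γ} (f : X ⟶ X) :
    Hom.hom ((pivotalStructure P hΓ).leftTrace f) = Γ ◁ P.coevTilde X.obj ≫
      (α_ _ _ _).inv ≫ (β_ Γ (P.dual X.obj)).hom ▷ X.obj ≫ (α_ _ _ _).hom ≫
        P.dual X.obj ◁ f.hom ≫ P.ev X.obj := by
  refine (incl_comp_hom (P.coevTilde X.obj) _).trans (congrArg (_ ≫ ·) ?_)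
  refine (comp_incl_hom _ (P.ev X.obj)).trans ?_
  refine (congrArg (· ≫ P.ev X.obj) (whiskerLeft_hom (of (P.dual X.obj)) f)).trans ?_
  simp

theorem rightTrace_hom {X : Crossed Γ} (f : X ⟶ X) :
    Hom.hom ((pivotalStructure P hΓ).rightTrace f) = Γ ◁ P.coev X.obj ≫
      (α_ _ _ _).inv ≫ f.hom ▷ P.dual X.obj ≫ P.evTilde X.obj := by
  refine (incl_comp_hom (P.coev X.obj) _).trans (congrArg (_ ≫ ·) ?_)
  refine (comp_incl_hom _ (P.evTilde X.obj)).trans ?_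
  refine (congrArg (· ≫ P.evTilde X.obj) (whiskerRight_hom f (of (P.dual X.obj)))).trans ?_
  simp

open MonObj

variable [MonObj Γ]

/-- Plugging the unit into the `Γ` input trivialises the braiding with the dual of `X`, so that only
a trace in `C` remains. -/
theorem one_leftTrace {X : Crossed Γ} (f : X ⟶ X) :
    (λ_ _).inv ≫ η[Γ] ▷ 𝟙_ C ≫ Hom.hom ((pivotalStructure P hΓ).leftTrace f) =
      P.leftTrace ((λ_ X.obj).inv ≫ η[Γ] ▷ X.obj ≫ f.hom) := by
  rw [leftTrace_hom, ← whisker_exchange_assoc, associator_inv_naturality_left_assoc,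
    ← comp_whiskerRight_assoc, BraidedCategory.braiding_naturality_left,
    PivotalStructure.leftTrace, braiding_tensorUnit_left]
  simp only [comp_whiskerRight, Category.assoc, MonoidalCategory.whiskerLeft_comp]
  monoidal

theorem one_rightTrace {X : Crossed Γ} (f : X ⟶ X) :
    (λ_ _).inv ≫ η[Γ] ▷ 𝟙_ C ≫ Hom.hom ((pivotalStructure P hΓ).rightTrace f) =
      P.rightTrace ((λ_ X.obj).inv ≫ η[Γ] ▷ X.obj ≫ f.hom) := by
  rw [rightTrace_hom, ← whisker_exchange_assoc, associator_inv_naturality_left_assoc,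
    PivotalStructure.rightTrace]
  monoidal

end pivotal

end Crossed

end

section

/-! ### Separable Frobenius algebras -/

open ComonObj MonObj

/-- A special Frobenius algebra `Γ` with `m ∘ Δ = n ≠ 0` and `ε ∘ η = 1`, for which `Hom(Γ, 𝟙)` is
spanned by `ε`. -/
structure IsGaloisAlgebra {F : Type u} [Field F] {C : Type v} [Category.{w} C] [Preadditive C]
    [Linear F C] [MonoidalCategory C] (Γ : C) [MonObj Γ] [ComonObj Γ] (n : F) : Prop where
  ne_zero : n ≠ 0
  one_counit : η[Γ] ≫ ε[Γ] = 𝟙 (𝟙_ C)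
  comul_mul : Δ[Γ] ≫ μ[Γ] = n • 𝟙 Γ
  frobenius_left : Δ[Γ] ▷ Γ ≫ (α_ Γ Γ Γ).hom ≫ Γ ◁ μ[Γ] = μ[Γ] ≫ Δ[Γ]
  frobenius_right : Γ ◁ Δ[Γ] ≫ (α_ Γ Γ Γ).inv ≫ μ[Γ] ▷ Γ = μ[Γ] ≫ Δ[Γ]
  span_counit (f : Γ ⟶ 𝟙_ C) : ∃ a : F, f = a • ε[Γ]

/-! ### Colinear maps between cofree comodules -/

section cofree

variable {C : Type v} [Category.{w} C] [MonoidalCategory C] {Γ : C} [ComonObj Γ]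

/-- The colinear extension `Γ ⊗ X ⟶ Γ ⊗ Y` of a morphism `Γ ⊗ X ⟶ Y`. -/
def cofreeMap {X Y : C} (s : Γ ⊗ X ⟶ Y) : Γ ⊗ X ⟶ Γ ⊗ Y :=
  Δ[Γ] ▷ X ≫ (α_ _ _ _).hom ≫ Γ ◁ s

theorem cofreeMap_counit {X Y : C} (s : Γ ⊗ X ⟶ Y) :
    cofreeMap s ≫ ε[Γ] ▷ Y ≫ (λ_ _).hom = s := by
  have := Crossed.comp_counit s (𝟙 _)
  simpa [cofreeMap] using this

theorem cofreeMap_colinear {X Y : C} (s : Γ ⊗ X ⟶ Y) :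
    cofreeMap s ≫ Δ[Γ] ▷ Y ≫ (α_ _ _ _).hom =
      Δ[Γ] ▷ X ≫ (α_ _ _ _).hom ≫ Γ ◁ cofreeMap s := by
  simp only [cofreeMap, MonoidalCategory.whiskerLeft_comp, Category.assoc]
  rw [whisker_exchange_assoc, ← associator_naturality_left_assoc, ← comp_whiskerRight_assoc,
    ← associator_naturality_middle_assoc, ← comp_whiskerRight_assoc]
  have h := comul_assoc_flip Γ
  rw [h]
  simp

/-- With `Crossed.comp_hom'`, this says that composition in the crossed product is composition of
colinear extensions. It follows from coassociativity. -/
theorem cofreeMap_comp {X Y Z : C} (s : Γ ⊗ X ⟶ Y) (t : Γ ⊗ Y ⟶ Z) :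
    cofreeMap (cofreeMap s ≫ t) = cofreeMap s ≫ cofreeMap t := by
  have h := cofreeMap_colinear s
  rw [cofreeMap, cofreeMap.eq_def t, reassoc_of% h, MonoidalCategory.whiskerLeft_comp]

/-- A colinear map into a cofree comodule is recovered from its composite with the counit. So a
morphism of the crossed product can be given by any colinear map. -/
theorem cofreeMap_of_colinear {X Y : C} {k : Γ ⊗ X ⟶ Γ ⊗ Y}
    (hk : k ≫ Δ[Γ] ▷ Y ≫ (α_ _ _ _).hom = Δ[Γ] ▷ X ≫ (α_ _ _ _).hom ≫ Γ ◁ k) :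
    cofreeMap (k ≫ ε[Γ] ▷ Y ≫ (λ_ Y).hom) = k := by
  rw [cofreeMap, MonoidalCategory.whiskerLeft_comp, ← reassoc_of% hk,
    MonoidalCategory.whiskerLeft_comp, ← associator_naturality_middle_assoc,
    ← comp_whiskerRight_assoc, comul_counit]
  simp

theorem Crossed.comp_hom' {X Y Z : Crossed Γ} (f : X ⟶ Y) (g : Y ⟶ Z) :
    (f ≫ g).hom = cofreeMap f.hom ≫ g.hom := by
  simp [comp_hom, cofreeMap]

/-- `m ∘ (1 ⊗ h) ∘ Δ`. -/
def averageMap [MonObj Γ] {X Y : C} (h : Γ ⊗ Y ⟶ Γ ⊗ X) : Γ ⊗ Y ⟶ Γ ⊗ X :=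
  Δ[Γ] ▷ Y ≫ (α_ _ _ _).hom ≫ Γ ◁ h ≫ (α_ _ _ _).inv ≫ μ[Γ] ▷ X

end cofree

namespace IsGaloisAlgebra

variable {F : Type u} [Field F] {C : Type v} [Category.{w} C] [Preadditive C]
    [Linear F C] [MonoidalCategory C] [MonoidalPreadditive C] [MonoidalLinear F C]
    {Γ : C} [MonObj Γ] [ComonObj Γ] {n : F}

open Crossed

/-- By the Frobenius relation, colinear extensions are also linear for the multiplication of `Γ`. -/
theorem cofreeMap_linear (hΓ : IsGaloisAlgebra Γ n) {X Y : C} (s : Γ ⊗ X ⟶ Y) :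
    (α_ _ _ _).inv ≫ μ[Γ] ▷ X ≫ cofreeMap s =
      Γ ◁ cofreeMap s ≫ (α_ _ _ _).inv ≫ μ[Γ] ▷ Y := by
  simp only [cofreeMap, MonoidalCategory.whiskerLeft_comp, Category.assoc]
  rw [← comp_whiskerRight_assoc, ← hΓ.frobenius_right, associator_inv_naturality_right_assoc,
    whisker_exchange]
  simp

/-- The averaging of Maschke's theorem: the Frobenius relation moves `Δ` in front of the
multiplication, and coassociativity moves it to the first comultiplication. No property of `h` is
needed. -/
theorem averageMap_colinear (hΓ : IsGaloisAlgebra Γ n) {X Y : C} (h : Γ ⊗ Y ⟶ Γ ⊗ X) :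
    averageMap h ≫ Δ[Γ] ▷ X ≫ (α_ _ _ _).hom =
      Δ[Γ] ▷ Y ≫ (α_ _ _ _).hom ≫ Γ ◁ averageMap h := by
  have h₁ : (α_ Γ Γ X).inv ≫ μ[Γ] ▷ X ≫ Δ[Γ] ▷ X ≫ (α_ _ _ _).hom =
      Δ[Γ] ▷ (Γ ⊗ X) ≫ (α_ _ _ _).hom ≫ Γ ◁ ((α_ _ _ _).inv ≫ μ[Γ] ▷ X) := by
    rw [← comp_whiskerRight_assoc, ← hΓ.frobenius_left]
    simp
  have h₂ : Δ[Γ] ▷ Y ≫ (α_ _ _ _).hom ≫ Γ ◁ (Δ[Γ] ▷ Y ≫ (α_ _ _ _).hom) =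
      Δ[Γ] ▷ Y ≫ (α_ _ _ _).hom ≫ Δ[Γ] ▷ (Γ ⊗ Y) ≫ (α_ _ _ _).hom := by
    rw [MonoidalCategory.whiskerLeft_comp, ← associator_naturality_middle_assoc,
      ← comp_whiskerRight_assoc, ← associator_naturality_left_assoc, ← comp_whiskerRight_assoc,
      comul_assoc]
    simp
  simp only [averageMap, Category.assoc]
  rw [h₁, whisker_exchange_assoc]
  have h₃ := reassoc_of% h₂
  simp only [MonoidalCategory.whiskerLeft_comp, Category.assoc] at h₃ ⊢
  rw [h₃]
  simp

/-- Since `cofreeMap s` is linear and colinear, it can be pulled inside the average of `h`. What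
remains is `m ∘ Δ = n`, so the average divided by `n` is a colinear quasi-inverse. -/
theorem exists_colinear (hΓ : IsGaloisAlgebra Γ n) {X Y : C} (s : Γ ⊗ X ⟶ Y)
    (h : Γ ⊗ Y ⟶ Γ ⊗ X) (hh : cofreeMap s ≫ h ≫ cofreeMap s = cofreeMap s) :
    ∃ t : Γ ⊗ Y ⟶ X, cofreeMap s ≫ cofreeMap t ≫ cofreeMap s = cofreeMap s := by
  let k := averageMap h
  have hk := hΓ.averageMap_colinear h
  have hs := cofreeMap_colinear s
  have key : cofreeMap s ≫ k ≫ cofreeMap s = n • cofreeMap s := by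
    simp only [k, averageMap, Category.assoc]
    rw [reassoc_of% hs, hΓ.cofreeMap_linear, ← MonoidalCategory.whiskerLeft_comp_assoc,
      ← MonoidalCategory.whiskerLeft_comp_assoc, Category.assoc, hh, ← reassoc_of% hs,
      Iso.hom_inv_id_assoc, ← comp_whiskerRight, hΓ.comul_mul]
    simp
  refine ⟨n⁻¹ • (k ≫ ε[Γ] ▷ X ≫ (λ_ X).hom), ?_⟩
  have hc : cofreeMap (n⁻¹ • (k ≫ ε[Γ] ▷ X ≫ (λ_ X).hom)) = n⁻¹ • k := by
    have := congrArg (n⁻¹ • ·) (cofreeMap_of_colinear hk)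
    rw [← this]
    simp [cofreeMap, k]
  rw [hc, Linear.smul_comp, Linear.comp_smul, key, smul_smul, inv_mul_cancel₀ hΓ.ne_zero, one_smul]

theorem isRegularHom (hΓ : IsGaloisAlgebra Γ n)
    (hreg : ∀ {X Y : C} (f : X ⟶ Y), IsRegularHom f) {X Y : Crossed Γ} (f : X ⟶ Y) :
    IsRegularHom f := by
  obtain ⟨h, hh⟩ := hreg (cofreeMap f.hom)
  obtain ⟨t, ht⟩ := hΓ.exists_colinear f.hom h hh
  refine ⟨⟨t⟩, ?_⟩
  ext
  have h' := congrArg (· ≫ ε[Γ] ▷ Y.obj ≫ (λ_ _).hom) ht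
  simp only [Category.assoc, cofreeMap_counit] at h'
  rw [comp_hom', comp_hom']
  exact h'

theorem bijective_counit (hΓ : IsGaloisAlgebra Γ n)
    (hunit : Function.Bijective fun a : F => a • 𝟙 (𝟙_ C)) :
    Function.Bijective fun a : F => a • ε[Γ] := by
  refine ⟨fun a b hab => hunit.1 ?_, fun f => ?_⟩
  · have := congrArg (η[Γ] ≫ ·) hab
    simpa [hΓ.one_counit] using this
  · obtain ⟨a, ha⟩ := hΓ.span_counit f
    exact ⟨a, ha.symm⟩

/-- Maps `Γ ⟶ 𝟙` are multiples of `ε`, and the multiple is read off along `η` because `ε ∘ η = 1`.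
Thereby identities between traces in the crossed product are reduced to identities in `C`. -/
theorem eq_of_one_comp (hΓ : IsGaloisAlgebra Γ n) {f g : Γ ⊗ 𝟙_ C ⟶ 𝟙_ C}
    (h : η[Γ] ▷ 𝟙_ C ≫ f = η[Γ] ▷ 𝟙_ C ≫ g) : f = g := by
  rw [← cancel_epi (ρ_ Γ).inv]
  obtain ⟨a, ha⟩ := hΓ.span_counit ((ρ_ Γ).inv ≫ f)
  obtain ⟨b, hb⟩ := hΓ.span_counit ((ρ_ Γ).inv ≫ g)
  have h' := congrArg ((ρ_ _).inv ≫ ·) h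
  simp only [← rightUnitor_inv_naturality_assoc, ha, hb] at h'
  rw [ha, hb, ← Category.id_comp ε[Γ], ← Linear.smul_comp, ← Linear.smul_comp]
  have h'' : a • 𝟙 (𝟙_ C) = b • 𝟙 (𝟙_ C) := by simpa [hΓ.one_counit] using h'
  rw [← Category.comp_id ε[Γ], Linear.smul_comp, Linear.smul_comp, Category.id_comp,
    ← Linear.comp_smul, ← Linear.comp_smul, h'']

variable [BraidedCategory C] [IsCommComonObj Γ]

theorem isSpherical (hΓ : IsGaloisAlgebra Γ n) {P : PivotalStructure C} (hP : P.IsSpherical)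
    (hev : (β_ Γ (P.dual Γ)).hom ≫ P.ev Γ = P.evTilde Γ) :
    (pivotalStructure P hev).IsSpherical := by
  intro X f
  ext
  apply hΓ.eq_of_one_comp
  rw [← cancel_epi (λ_ _).inv, one_leftTrace, one_rightTrace, hP]

end IsGaloisAlgebra

section biproducts

variable {C : Type v} [Category.{w} C] [Preadditive C] [MonoidalCategory C]
  [MonoidalPreadditive C] [BraidedCategory C] {Γ : C} [ComonObj Γ] [IsCommComonObj Γ]

/-- Every family of objects comes from `C`, and the additive functor `incl` preserves its biproduct.
-/
instance [HasFiniteBiproducts C] : HasFiniteBiproducts (Crossed Γ) where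
  out n :=
    { has_biproduct := fun f => by
        have h := Functor.preservesFiniteBiproductsOfAdditive (F := Crossed.incl Γ)
        exact HasBiproduct.mk ⟨(Crossed.incl Γ).mapBicone (biproduct.bicone fun j => (f j).obj),
          isBilimitOfPreserves (Crossed.incl Γ) (biproduct.isBilimit fun j => (f j).obj)⟩ }

end biproducts

end

/-! ### The tensor structure of the idempotent completion -/

section karoubiTensor

variable {D : Type v} [Category.{w} D] [MonoidalCategory D]

namespace KaroubiTensor

theorem heq_of_f {P Q P' Q' : Karoubi D} {f : P ⟶ Q} {f' : P' ⟶ Q'} (hP : P = P') (hQ : Q = Q')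
    (h : HEq f.f f'.f) : HEq f f' := by
  subst hP hQ
  exact heq_of_eq (Karoubi.hom_ext _ _ (eq_of_heq h))

end KaroubiTensor

open KaroubiTensor

instance [IsStrictMonoidal D] : IsStrictMonoidal (Karoubi D) where
  tensor_assoc P Q R := Karoubi.ext (IsStrictMonoidal.tensor_assoc P.X Q.X R.X) (by
    rw [← IsStrictMonoidal.associator_eq]
    exact associator_naturality P.p Q.p R.p)
  unit_tensor P := Karoubi.ext (IsStrictMonoidal.unit_tensor P.X) (by
    rw [← IsStrictMonoidal.leftUnitor_eq]
    change (𝟙 (𝟙_ D) ⊗ₘ P.p) ≫ _ = _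
    rw [id_tensorHom]
    exact leftUnitor_naturality P.p)
  tensor_unit P := Karoubi.ext (IsStrictMonoidal.tensor_unit P.X) (by
    rw [← IsStrictMonoidal.rightUnitor_eq]
    change (P.p ⊗ₘ 𝟙 (𝟙_ D)) ≫ _ = _
    rw [tensorHom_id]
    exact rightUnitor_naturality P.p)
  associator_eq P Q R := by
    ext
    rw [Karoubi.eqToHom_f]
    exact congrArg _ (IsStrictMonoidal.associator_eq P.X Q.X R.X)
  leftUnitor_eq P := by
    ext
    rw [Karoubi.eqToHom_f]
    exact congrArg _ (IsStrictMonoidal.leftUnitor_eq P.X)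
  rightUnitor_eq P := by
    ext
    rw [Karoubi.eqToHom_f]
    exact congrArg _ (IsStrictMonoidal.rightUnitor_eq P.X)

variable (D) in
theorem isStrictMonoidalFunctor_toKaroubi : IsStrictMonoidalFunctor (toKaroubi D) where
  obj_unit := rfl
  obj_tensor X Y := Karoubi.ext rfl (by
    change 𝟙 (X ⊗ Y) ≫ 𝟙 _ = 𝟙 _ ≫ (𝟙 X ⊗ₘ 𝟙 Y)
    simp)
  map_tensor {X Y X' Y'} f g := by
    have h : ∀ X Y : D, (toKaroubi D).obj (X ⊗ Y) = (toKaroubi D).obj X ⊗ (toKaroubi D).obj Y :=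
      fun X Y => Karoubi.ext rfl (by
        change 𝟙 (X ⊗ Y) ≫ 𝟙 _ = 𝟙 _ ≫ (𝟙 X ⊗ₘ 𝟙 Y)
        simp)
    exact heq_of_f (h _ _) (h _ _) HEq.rfl
  map_associator X Y Z := by
    refine heq_of_f (Karoubi.ext rfl ?_) (Karoubi.ext rfl ?_) (heq_of_eq ?_)
    · change 𝟙 ((X ⊗ Y) ⊗ Z) ≫ 𝟙 _ = 𝟙 _ ≫ ((𝟙 X ⊗ₘ 𝟙 Y) ⊗ₘ 𝟙 Z)
      simp
    · change 𝟙 (X ⊗ Y ⊗ Z) ≫ 𝟙 _ = 𝟙 _ ≫ (𝟙 X ⊗ₘ 𝟙 Y ⊗ₘ 𝟙 Z)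
      simp
    · change (α_ X Y Z).hom = ((𝟙 X ⊗ₘ 𝟙 Y) ⊗ₘ 𝟙 Z) ≫ (α_ X Y Z).hom
      simp
  map_leftUnitor X := by
    refine heq_of_f (Karoubi.ext rfl ?_) rfl (heq_of_eq ?_)
    · change 𝟙 (𝟙_ D ⊗ X) ≫ 𝟙 _ = 𝟙 _ ≫ (𝟙 (𝟙_ D) ⊗ₘ 𝟙 X)
      simp
    · change (λ_ X).hom = (𝟙 (𝟙_ D) ⊗ₘ 𝟙 X) ≫ (λ_ X).hom
      simp
  map_rightUnitor X := by
    refine heq_of_f (Karoubi.ext rfl ?_) rfl (heq_of_eq ?_)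
    · change 𝟙 (X ⊗ 𝟙_ D) ≫ 𝟙 _ = 𝟙 _ ≫ (𝟙 X ⊗ₘ 𝟙 (𝟙_ D))
      simp
    · change (ρ_ X).hom = (𝟙 X ⊗ₘ 𝟙 (𝟙_ D)) ≫ (ρ_ X).hom
      simp

section linear

variable [Preadditive D] (F : Type u) [Field F] [Linear F D]

/-- The underlying morphism, as a linear map. -/
def karoubiHomLinear (P Q : Karoubi D) : (P ⟶ Q) →ₗ[F] (P.X ⟶ Q.X) where
  toFun f := f.f
  map_add' _ _ := rfl
  map_smul' _ _ := rfl

instance [MonoidalPreadditive D] : MonoidalPreadditive (Karoubi D) where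
  whiskerLeft_zero := by
    intros
    ext
    exact MonoidalPreadditive.tensor_zero _
  zero_whiskerRight := by
    intros
    ext
    exact MonoidalPreadditive.zero_tensor _
  whiskerLeft_add := by
    intros
    ext
    exact MonoidalPreadditive.tensor_add _ _ _
  add_whiskerRight := by
    intros
    ext
    exact MonoidalPreadditive.add_tensor _ _ _

instance [MonoidalPreadditive D] [MonoidalLinear F D] : MonoidalLinear F (Karoubi D) where
  whiskerLeft_smul X Y Z r f := by
    ext
    change X.p ⊗ₘ (r • f.f) = r • (X.p ⊗ₘ f.f)
    simp [MonoidalCategory.tensorHom_def]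
  smul_whiskerRight r {Y Z} f X := by
    ext
    change (r • f.f) ⊗ₘ X.p = r • (f.f ⊗ₘ X.p)
    simp [MonoidalCategory.tensorHom_def]

theorem karoubi_isLinearTensor [MonoidalPreadditive D] [MonoidalLinear F D]
    (h : IsLinearTensor F D) : IsLinearTensor F (Karoubi D) where
  preadditive := inferInstance
  linear := inferInstance
  hom_finite P Q :=
    have := h.hom_finite P.X Q.X
    FiniteDimensional.of_injective (karoubiHomLinear F P Q) fun f g hfg =>
      Karoubi.hom_ext _ _ hfg
  end_unit := by
    refine ⟨fun a b hab => h.end_unit.1 (congrArg Karoubi.Hom.f hab), fun f => ?_⟩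
    obtain ⟨a, ha⟩ := h.end_unit.2 f.f
    exact ⟨a, Karoubi.hom_ext _ _ ha⟩

end linear

theorem karoubi_isRegularHom (h : ∀ {X Y : D} (f : X ⟶ Y), IsRegularHom f) {P Q : Karoubi D}
    (f : P ⟶ Q) : IsRegularHom f := by
  obtain ⟨g, hg⟩ := h f.f
  refine ⟨⟨Q.p ≫ g ≫ P.p, by simp⟩, ?_⟩
  ext
  simp [hg]

end karoubiTensor

/-! ### The pivotal structure of the idempotent completion -/

section karoubiPivotal

variable {D : Type v} [Category.{w} D] [MonoidalCategory D] (P : PivotalStructure D)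

namespace PivotalStructure

@[simp]
theorem dualMap_idem (X : Karoubi D) : P.dualMap X.p ≫ P.dualMap X.p = P.dualMap X.p := by
  rw [← dualMap_comp, X.idem]

theorem tensor_ev {X Y Z : D} (f : X ⟶ Y) (g : Z ⟶ X) :
    (P.dualMap f ⊗ₘ g) ≫ P.ev X = P.dual Y ◁ (g ≫ f) ≫ P.ev Y := by
  rw [MonoidalCategory.tensorHom_def', Category.assoc, dualMap_ev,
    MonoidalCategory.whiskerLeft_comp, Category.assoc]

theorem tensor_evTilde {X Y Z : D} (f : X ⟶ Y) (g : Z ⟶ X) :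
    (g ⊗ₘ P.dualMap f) ≫ P.evTilde X = (g ≫ f) ▷ P.dual Y ≫ P.evTilde Y := by
  rw [MonoidalCategory.tensorHom_def, Category.assoc, dualMap_evTilde, comp_whiskerRight,
    Category.assoc]

/-- The dual of `(X, p)` is `(X*, p*)`. -/
def karoubiDual (X : Karoubi D) : Karoubi D := ⟨P.dual X.X, P.dualMap X.p, P.dualMap_idem X⟩

/-- The restriction of an exact pairing to a pair of adjoint idempotents. -/
@[reducible]
def karoubiPairing {X Y : Karoubi D} (E : ExactPairing X.X Y.X)
    (h : Y.p ▷ X.X ≫ E.evaluation' = Y.X ◁ X.p ≫ E.evaluation') : ExactPairing X Y where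
  coevaluation' := ⟨E.coevaluation' ≫ (X.p ⊗ₘ Y.p), by
    change 𝟙 (𝟙_ D) ≫ (E.coevaluation' ≫ (X.p ⊗ₘ Y.p)) ≫ (X.p ⊗ₘ Y.p) = _
    simp⟩
  evaluation' := ⟨(Y.p ⊗ₘ X.p) ≫ E.evaluation', by
    change (Y.p ⊗ₘ X.p) ≫ ((Y.p ⊗ₘ X.p) ≫ E.evaluation') ≫ 𝟙 (𝟙_ D) = _
    simp⟩
  coevaluation_evaluation' := by
    ext
    change (Y.p ⊗ₘ (E.coevaluation' ≫ (X.p ⊗ₘ Y.p))) ≫ ((Y.p ⊗ₘ (X.p ⊗ₘ Y.p)) ≫ (α_ _ _ _).inv) ≫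
      (((Y.p ⊗ₘ X.p) ≫ E.evaluation') ⊗ₘ Y.p) =
        ((Y.p ⊗ₘ 𝟙 (𝟙_ D)) ≫ (ρ_ Y.X).hom) ≫ (Y.p ≫ (λ_ Y.X).inv)
    -- Under the evaluation the two adjoint idempotents merge into one. All idempotents can then be
    -- moved out of the way of the snake identity of `E`.
    have h₁ : (Y.p ⊗ₘ X.p) ≫ E.evaluation' = Y.p ▷ X.X ≫ E.evaluation' := by
      rw [MonoidalCategory.tensorHom_def, Category.assoc, ← h, ← comp_whiskerRight_assoc, Y.idem]
    have h₂ : (Y.p ⊗ₘ (E.coevaluation' ≫ (X.p ⊗ₘ Y.p))) =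
        Y.X ◁ E.coevaluation' ≫ (Y.p ⊗ₘ (X.p ⊗ₘ Y.p)) := by
      rw [← id_tensorHom, tensorHom_comp_tensorHom, Category.id_comp]
    have h₃ : ((Y.p ⊗ₘ X.p) ⊗ₘ Y.p) ≫ (((Y.p ⊗ₘ X.p) ≫ E.evaluation') ⊗ₘ Y.p) =
        (Y.p ▷ X.X) ▷ Y.X ≫ E.evaluation' ▷ Y.X ≫ _ ◁ Y.p := by
      rw [tensorHom_comp_tensorHom, Y.idem, tensorHom_comp_tensorHom_assoc, Y.idem, X.idem, h₁,
        MonoidalCategory.tensorHom_def, comp_whiskerRight, Category.assoc]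
    have h₄ := E.coevaluation_evaluation'
    rw [h₂]
    simp only [Category.assoc]
    rw [tensorHom_comp_tensorHom_assoc, tensorHom_comp_tensorHom, Y.idem, X.idem,
      associator_inv_naturality_assoc, h₃, ← associator_inv_naturality_left_assoc,
      whisker_exchange_assoc, reassoc_of% h₄]
    simp
  evaluation_coevaluation' := by
    ext
    change ((E.coevaluation' ≫ (X.p ⊗ₘ Y.p)) ⊗ₘ X.p) ≫ (((X.p ⊗ₘ Y.p) ⊗ₘ X.p) ≫ (α_ _ _ _).hom) ≫
      (X.p ⊗ₘ ((Y.p ⊗ₘ X.p) ≫ E.evaluation')) =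
        ((𝟙 (𝟙_ D) ⊗ₘ X.p) ≫ (λ_ X.X).hom) ≫ (X.p ≫ (ρ_ X.X).inv)
    have h₁ : (Y.p ⊗ₘ X.p) ≫ E.evaluation' = Y.X ◁ X.p ≫ E.evaluation' := by
      rw [MonoidalCategory.tensorHom_def', Category.assoc, h,
        ← MonoidalCategory.whiskerLeft_comp_assoc, X.idem]
    have h₂ : ((E.coevaluation' ≫ (X.p ⊗ₘ Y.p)) ⊗ₘ X.p) =
        E.coevaluation' ▷ X.X ≫ ((X.p ⊗ₘ Y.p) ⊗ₘ X.p) := by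
      rw [← tensorHom_id, tensorHom_comp_tensorHom, Category.id_comp]
    have h₃ : (X.p ⊗ₘ (Y.p ⊗ₘ X.p)) ≫ (X.p ⊗ₘ ((Y.p ⊗ₘ X.p) ≫ E.evaluation')) =
        X.X ◁ (Y.X ◁ X.p) ≫ X.X ◁ E.evaluation' ≫ X.p ▷ _ := by
      rw [tensorHom_comp_tensorHom, X.idem, tensorHom_comp_tensorHom_assoc, Y.idem, X.idem, h₁,
        MonoidalCategory.tensorHom_def', MonoidalCategory.whiskerLeft_comp, Category.assoc]
    have h₄ := E.evaluation_coevaluation'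
    rw [h₂]
    simp only [Category.assoc]
    rw [tensorHom_comp_tensorHom_assoc, tensorHom_comp_tensorHom, Y.idem, X.idem,
      associator_naturality_assoc, h₃, ← associator_naturality_right_assoc,
      ← whisker_exchange_assoc, reassoc_of% h₄]
    simp

theorem karoubiPairing_tensor {X₁ X₂ Y₁ Y₂ : Karoubi D} (E₁ : ExactPairing X₁.X Y₁.X)
    (E₂ : ExactPairing X₂.X Y₂.X)
    (h₁ : Y₁.p ▷ X₁.X ≫ E₁.evaluation' = Y₁.X ◁ X₁.p ≫ E₁.evaluation')
    (h₂ : Y₂.p ▷ X₂.X ≫ E₂.evaluation' = Y₂.X ◁ X₂.p ≫ E₂.evaluation') :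
    ((@ExactPairing.tensor (Karoubi D) _ _ _ _ _ _ (karoubiPairing E₁ h₁)
      (karoubiPairing E₂ h₂)).evaluation').f =
      ((Y₂.p ⊗ₘ Y₁.p) ⊗ₘ (X₁.p ⊗ₘ X₂.p)) ≫
        (@ExactPairing.tensor D _ _ X₁.X X₂.X Y₁.X Y₂.X E₁ E₂).evaluation' := by
  rw [Crossed.tensorEvaluation_eq, Crossed.tensorEvaluation_eq]
  change (((Y₂.p ⊗ₘ Y₁.p) ⊗ₘ (X₁.p ⊗ₘ X₂.p)) ≫ (α_ _ _ _).hom) ≫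
    (Y₂.p ⊗ₘ (((Y₁.p ⊗ₘ (X₁.p ⊗ₘ X₂.p)) ≫ (α_ _ _ _).inv) ≫
      (((Y₁.p ⊗ₘ X₁.p) ≫ E₁.evaluation') ⊗ₘ X₂.p) ≫ (𝟙 (𝟙_ D) ⊗ₘ X₂.p) ≫ (λ_ X₂.X).hom)) ≫
      (Y₂.p ⊗ₘ X₂.p) ≫ E₂.evaluation' = _
  have e₁ : (((Y₁.p ⊗ₘ (X₁.p ⊗ₘ X₂.p)) ≫ (α_ _ _ _).inv) ≫
      (((Y₁.p ⊗ₘ X₁.p) ≫ E₁.evaluation') ⊗ₘ X₂.p) ≫ (𝟙 (𝟙_ D) ⊗ₘ X₂.p) ≫ (λ_ X₂.X).hom) =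
      (Y₁.p ⊗ₘ (X₁.p ⊗ₘ X₂.p)) ≫ (α_ _ _ _).inv ≫ E₁.evaluation' ▷ X₂.X ≫ (λ_ X₂.X).hom := by
    have h : ((Y₁.p ⊗ₘ X₁.p) ≫ E₁.evaluation') ⊗ₘ X₂.p =
        ((Y₁.p ⊗ₘ X₁.p) ⊗ₘ X₂.p) ≫ E₁.evaluation' ▷ X₂.X := by
      rw [← tensorHom_id, tensorHom_comp_tensorHom, Category.comp_id]
    have h' : E₁.evaluation' ▷ X₂.X ≫ 𝟙_ D ◁ X₂.p = _ ◁ X₂.p ≫ E₁.evaluation' ▷ X₂.X :=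
      (whisker_exchange _ _).symm
    rw [h, Category.assoc, Category.assoc, ← associator_inv_naturality_assoc,
      tensorHom_comp_tensorHom_assoc, tensorHom_comp_tensorHom, id_tensorHom, reassoc_of% h',
      ← associator_inv_naturality_right_assoc, ← id_tensorHom, ← id_tensorHom,
      tensorHom_comp_tensorHom_assoc, tensorHom_comp_tensorHom]
    simp
  have e₂ : Y₂.p ⊗ₘ ((Y₁.p ⊗ₘ (X₁.p ⊗ₘ X₂.p)) ≫ (α_ _ _ _).inv ≫ E₁.evaluation' ▷ X₂.X ≫
      (λ_ X₂.X).hom) = (Y₂.p ⊗ₘ (Y₁.p ⊗ₘ (X₁.p ⊗ₘ X₂.p))) ≫ Y₂.X ◁ ((α_ _ _ _).inv ≫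
        E₁.evaluation' ▷ X₂.X ≫ (λ_ X₂.X).hom) := by
    rw [← id_tensorHom, tensorHom_comp_tensorHom, Category.comp_id]
  have e₃ : (α_ _ _ _).inv ≫ E₁.evaluation' ▷ X₂.X ≫ (λ_ X₂.X).hom ≫ X₂.p =
      (Y₁.X ◁ (X₁.X ◁ X₂.p)) ≫ (α_ _ _ _).inv ≫ E₁.evaluation' ▷ X₂.X ≫ (λ_ X₂.X).hom := by
    rw [← leftUnitor_naturality, ← whisker_exchange_assoc, associator_inv_naturality_right_assoc]
  have e₄ : Y₂.X ◁ ((α_ _ _ _).inv ≫ E₁.evaluation' ▷ X₂.X ≫ (λ_ X₂.X).hom) ≫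
      (Y₂.p ⊗ₘ X₂.p) = (Y₂.p ⊗ₘ (Y₁.X ◁ (X₁.X ◁ X₂.p))) ≫
        Y₂.X ◁ ((α_ _ _ _).inv ≫ E₁.evaluation' ▷ X₂.X ≫ (λ_ X₂.X).hom) := by
    rw [← id_tensorHom, tensorHom_comp_tensorHom, ← id_tensorHom, tensorHom_comp_tensorHom,
      Category.assoc, Category.assoc, e₃]
    simp
  rw [e₁, e₂, Category.assoc, Category.assoc, reassoc_of% e₄, ← associator_naturality_assoc,
    tensorHom_comp_tensorHom_assoc, tensorHom_comp_tensorHom, tensorHom_comp_tensorHom,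
    associator_naturality_assoc, tensorHom_comp_tensorHom_assoc, ← id_tensorHom, ← id_tensorHom,
    tensorHom_comp_tensorHom, tensorHom_comp_tensorHom, associator_naturality_assoc]
  simp only [Karoubi.idem, Category.comp_id]

/-- The pairings of `(X, p)` and `(X*, p*)`. -/
@[reducible]
def karoubiRight (X : Karoubi D) : ExactPairing X (P.karoubiDual X) :=
  karoubiPairing (X := X) (Y := P.karoubiDual X) (P.rightPairing X.X) (P.dualMap_ev X.p)

@[reducible]
def karoubiLeft (X : Karoubi D) : ExactPairing (P.karoubiDual X) X :=
  karoubiPairing (X := P.karoubiDual X) (Y := X) (P.leftPairing X.X) (P.dualMap_evTilde X.p).symm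

/-- Two maps into a dual agree if they agree after evaluation, and there both sides slide into `f ⊗
g` on the undualised strands. For idempotents, this is what lets the isomorphism of duals restrict
to the completion. -/
theorem tensorDual_natural {X Y X' Y' : D} (f : X ⟶ X') (g : Y ⟶ Y')
    (e : P.dual Y ⊗ P.dual X ⟶ P.dual (X ⊗ Y)) (e' : P.dual Y' ⊗ P.dual X' ⟶ P.dual (X' ⊗ Y'))
    (he : e ▷ (X ⊗ Y) ≫ P.ev (X ⊗ Y) = (@ExactPairing.tensor D _ _ X Y (P.dual X) (P.dual Y)
      (P.rightPairing X) (P.rightPairing Y)).evaluation')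
    (he' : e' ▷ (X' ⊗ Y') ≫ P.ev (X' ⊗ Y') =
      (@ExactPairing.tensor D _ _ X' Y' (P.dual X') (P.dual Y')
      (P.rightPairing X') (P.rightPairing Y')).evaluation') :
    (P.dualMap g ⊗ₘ P.dualMap f) ≫ e = e' ≫ P.dualMap (f ⊗ₘ g) := by
  apply P.hom_ext_ev
  rw [comp_whiskerRight, Category.assoc, he, comp_whiskerRight, Category.assoc, dualMap_ev,
    ← whisker_exchange_assoc, he', Crossed.tensorEvaluation_eq, Crossed.tensorEvaluation_eq]
  change _ ≫ (α_ _ _ _).hom ≫ _ ◁ (_ ≫ P.ev X ▷ _ ≫ _) ≫ P.ev Y =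
    _ ≫ (α_ _ _ _).hom ≫ _ ◁ (_ ≫ P.ev X' ▷ _ ≫ _) ≫ P.ev Y'
  have h₁ : P.dualMap f ▷ (X ⊗ Y) ≫ (α_ _ _ _).inv ≫ P.ev X ▷ Y ≫ (λ_ Y).hom ≫ g =
      P.dual X' ◁ (f ⊗ₘ g) ≫ (α_ _ _ _).inv ≫ P.ev X' ▷ Y' ≫ (λ_ Y').hom := by
    rw [associator_inv_naturality_left_assoc, ← comp_whiskerRight_assoc, dualMap_ev,
      MonoidalCategory.tensorHom_def, MonoidalCategory.whiskerLeft_comp, Category.assoc,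
      associator_inv_naturality_right_assoc, whisker_exchange_assoc, leftUnitor_naturality]
    simp
  rw [MonoidalCategory.tensorHom_def', comp_whiskerRight, Category.assoc,
    associator_naturality_left_assoc, ← whisker_exchange_assoc, dualMap_ev,
    associator_naturality_middle_assoc, associator_naturality_right_assoc,
    ← MonoidalCategory.whiskerLeft_comp_assoc, ← MonoidalCategory.whiskerLeft_comp_assoc,
    ← MonoidalCategory.whiskerLeft_comp_assoc, ← h₁]
  simp only [Category.assoc]

/-- The pivotal structure of the idempotent completion. -/
def karoubi : PivotalStructure (Karoubi D) where
  dual := P.karoubiDual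
  rightPairing := P.karoubiRight
  leftPairing := P.karoubiLeft
  mate_eq {X Y} f := by
    let g : P.karoubiDual Y ⟶ P.karoubiDual X := ⟨P.dualMap f.f, by
      change P.dualMap Y.p ≫ P.dualMap f.f ≫ P.dualMap X.p = _
      rw [← dualMap_comp, ← dualMap_comp]
      simp⟩
    refine (rightAdjointMate_eq _ _ (g := g) ?_).trans (leftAdjointMate_eq _ _ ?_).symm
    · ext
      change (P.dualMap f.f ⊗ₘ X.p) ≫ (P.dualMap X.p ⊗ₘ X.p) ≫ P.ev X.X =
        (P.dualMap Y.p ⊗ₘ f.f) ≫ (P.dualMap Y.p ⊗ₘ Y.p) ≫ P.ev Y.X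
      rw [tensorHom_comp_tensorHom_assoc, ← dualMap_comp, tensor_ev,
        tensorHom_comp_tensorHom_assoc, ← dualMap_comp, tensor_ev]
      simp
    · ext
      change (X.p ⊗ₘ P.dualMap f.f) ≫ (X.p ⊗ₘ P.dualMap X.p) ≫ P.evTilde X.X =
        (f.f ⊗ₘ P.dualMap Y.p) ≫ (Y.p ⊗ₘ P.dualMap Y.p) ≫ P.evTilde Y.X
      rw [tensorHom_comp_tensorHom_assoc, ← dualMap_comp, tensor_evTilde,
        tensorHom_comp_tensorHom_assoc, ← dualMap_comp, tensor_evTilde]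
      simp
  tensor_eq X Y := by
    obtain ⟨e, h₁, h₂⟩ := P.tensor_eq X.X Y.X
    have hn := P.tensorDual_natural X.p Y.p e.hom e.hom h₁ h₁
    have hn' : e.inv ≫ (P.dualMap Y.p ⊗ₘ P.dualMap X.p) = P.dualMap (X.p ⊗ₘ Y.p) ≫ e.inv := by
      rw [Iso.inv_comp_eq, ← reassoc_of% hn, Iso.hom_inv_id, Category.comp_id]
    have hq : (P.dualMap Y.p ⊗ₘ P.dualMap X.p) ≫ (P.dualMap Y.p ⊗ₘ P.dualMap X.p) =
        P.dualMap Y.p ⊗ₘ P.dualMap X.p := by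
      rw [tensorHom_comp_tensorHom, dualMap_idem, dualMap_idem]
    have hr : P.dualMap (X.p ⊗ₘ Y.p) ≫ P.dualMap (X.p ⊗ₘ Y.p) = P.dualMap (X.p ⊗ₘ Y.p) :=
      P.dualMap_idem (X ⊗ Y)
    have hp : (X.p ⊗ₘ Y.p) ≫ (X.p ⊗ₘ Y.p) = X.p ⊗ₘ Y.p := (X ⊗ Y).idem
    refine ⟨⟨⟨(P.dualMap Y.p ⊗ₘ P.dualMap X.p) ≫ e.hom, ?_⟩,
      ⟨e.inv ≫ (P.dualMap Y.p ⊗ₘ P.dualMap X.p), ?_⟩, ?_, ?_⟩, ?_, ?_⟩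
    · change (P.dualMap Y.p ⊗ₘ P.dualMap X.p) ≫ ((P.dualMap Y.p ⊗ₘ P.dualMap X.p) ≫ e.hom) ≫
        P.dualMap (X.p ⊗ₘ Y.p) = _
      rw [Category.assoc, ← hn, reassoc_of% hq, reassoc_of% hq]
      rfl
    · change P.dualMap (X.p ⊗ₘ Y.p) ≫ (e.inv ≫ (P.dualMap Y.p ⊗ₘ P.dualMap X.p)) ≫
        (P.dualMap Y.p ⊗ₘ P.dualMap X.p) = _
      rw [Category.assoc, hq, hn', reassoc_of% hr]
      exact hn'.symm
    · ext
      change ((P.dualMap Y.p ⊗ₘ P.dualMap X.p) ≫ e.hom) ≫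
        (e.inv ≫ (P.dualMap Y.p ⊗ₘ P.dualMap X.p)) = P.dualMap Y.p ⊗ₘ P.dualMap X.p
      rw [Category.assoc, Iso.hom_inv_id_assoc, hq]
    · ext
      change (e.inv ≫ (P.dualMap Y.p ⊗ₘ P.dualMap X.p)) ≫
        ((P.dualMap Y.p ⊗ₘ P.dualMap X.p) ≫ e.hom) = P.dualMap (X.p ⊗ₘ Y.p)
      rw [Category.assoc, reassoc_of% hq, hn, Iso.inv_hom_id_assoc]
    · ext
      refine Eq.trans ?_ (Eq.trans (congrArg (((P.dualMap Y.p ⊗ₘ P.dualMap X.p) ⊗ₘ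
        (X.p ⊗ₘ Y.p)) ≫ ·) h₁) (karoubiPairing_tensor (Y₁ := P.karoubiDual X)
        (Y₂ := P.karoubiDual Y) (P.rightPairing X.X) (P.rightPairing Y.X) (P.dualMap_ev X.p)
        (P.dualMap_ev Y.p)).symm)
      change (((P.dualMap Y.p ⊗ₘ P.dualMap X.p) ≫ e.hom) ⊗ₘ (X.p ⊗ₘ Y.p)) ≫
        (P.dualMap (X.p ⊗ₘ Y.p) ⊗ₘ (X.p ⊗ₘ Y.p)) ≫ P.ev (X.X ⊗ Y.X) =
        ((P.dualMap Y.p ⊗ₘ P.dualMap X.p) ⊗ₘ (X.p ⊗ₘ Y.p)) ≫ e.hom ▷ (X.X ⊗ Y.X) ≫ P.ev _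
      rw [tensorHom_comp_tensorHom_assoc, hp, Category.assoc, ← hn, reassoc_of% hq,
        ← tensorHom_id, tensorHom_comp_tensorHom_assoc, Category.comp_id]
    · ext
      refine Eq.trans ?_ (Eq.trans (congrArg (((X.p ⊗ₘ Y.p) ⊗ₘ
        (P.dualMap Y.p ⊗ₘ P.dualMap X.p)) ≫ ·) h₂) (karoubiPairing_tensor
        (X₁ := P.karoubiDual Y) (X₂ := P.karoubiDual X) (P.leftPairing Y.X) (P.leftPairing X.X)
        (P.dualMap_evTilde Y.p).symm (P.dualMap_evTilde X.p).symm).symm)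
      change ((X.p ⊗ₘ Y.p) ⊗ₘ ((P.dualMap Y.p ⊗ₘ P.dualMap X.p) ≫ e.hom)) ≫
        ((X.p ⊗ₘ Y.p) ⊗ₘ P.dualMap (X.p ⊗ₘ Y.p)) ≫ P.evTilde (X.X ⊗ Y.X) =
        ((X.p ⊗ₘ Y.p) ⊗ₘ (P.dualMap Y.p ⊗ₘ P.dualMap X.p)) ≫ (X.X ⊗ Y.X) ◁ e.hom ≫
          P.evTilde _
      rw [tensorHom_comp_tensorHom_assoc, hp, Category.assoc, ← hn, reassoc_of% hq,
        ← id_tensorHom, tensorHom_comp_tensorHom_assoc, Category.comp_id]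
  unit_eq := by
    obtain ⟨e, h₁, h₂⟩ := P.unit_eq
    refine ⟨⟨⟨e.hom, ?_⟩, ⟨e.inv, ?_⟩, ?_, ?_⟩, ?_, ?_⟩
    · change 𝟙 _ ≫ e.hom ≫ P.dualMap (𝟙 _) = e.hom
      simp
    · change P.dualMap (𝟙 _) ≫ e.inv ≫ 𝟙 _ = e.inv
      simp
    · ext
      exact e.hom_inv_id
    · ext
      refine e.inv_hom_id.trans (P.dualMap_id).symm
    · ext
      change (e.hom ⊗ₘ 𝟙 (𝟙_ D)) ≫ (P.dualMap (𝟙 _) ⊗ₘ 𝟙 _) ≫ P.ev (𝟙_ D) =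
        (𝟙 (𝟙_ D) ⊗ₘ 𝟙 (𝟙_ D)) ≫ (λ_ (𝟙_ D)).hom
      rw [dualMap_id, id_tensorHom_id, id_tensorHom_id, Category.id_comp, Category.id_comp,
        tensorHom_id]
      exact h₁
    · ext
      change (𝟙 (𝟙_ D) ⊗ₘ e.hom) ≫ (𝟙 _ ⊗ₘ P.dualMap (𝟙 _)) ≫ P.evTilde (𝟙_ D) =
        (𝟙 (𝟙_ D) ⊗ₘ 𝟙 (𝟙_ D)) ≫ (λ_ (𝟙_ D)).hom
      rw [dualMap_id, id_tensorHom_id, id_tensorHom_id, Category.id_comp, Category.id_comp,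
        id_tensorHom]
      exact h₂

theorem karoubi_leftTrace {X : Karoubi D} (f : X ⟶ X) :
    (P.karoubi.leftTrace f).f = P.leftTrace f.f := by
  change (P.coevTilde X.X ≫ (P.dualMap X.p ⊗ₘ X.p)) ≫ (P.dualMap X.p ⊗ₘ f.f) ≫
    (P.dualMap X.p ⊗ₘ X.p) ≫ P.ev X.X = _
  rw [leftTrace, tensorHom_comp_tensorHom_assoc, Category.assoc, tensorHom_comp_tensorHom_assoc,
    dualMap_idem, dualMap_idem, tensor_ev]
  simp

theorem karoubi_rightTrace {X : Karoubi D} (f : X ⟶ X) :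
    (P.karoubi.rightTrace f).f = P.rightTrace f.f := by
  change (P.coev X.X ≫ (X.p ⊗ₘ P.dualMap X.p)) ≫ (f.f ⊗ₘ P.dualMap X.p) ≫
    (X.p ⊗ₘ P.dualMap X.p) ≫ P.evTilde X.X = _
  rw [rightTrace, tensorHom_comp_tensorHom_assoc, Category.assoc, tensorHom_comp_tensorHom_assoc,
    dualMap_idem, dualMap_idem, tensor_evTilde]
  simp

theorem karoubi_isSpherical (h : P.IsSpherical) : P.karoubi.IsSpherical := by
  intro X f
  ext
  rw [karoubi_leftTrace, karoubi_rightTrace, h]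

theorem karoubi_extends : P.Extends (toKaroubi D) P.karoubi := by
  have hd : ∀ X, P.karoubi.dual ((toKaroubi D).obj X) = (toKaroubi D).obj (P.dual X) := fun X =>
    Karoubi.ext rfl (by
      change P.dualMap (𝟙 X) ≫ 𝟙 _ = 𝟙 _ ≫ 𝟙 _
      simp)
  have ht := (isStrictMonoidalFunctor_toKaroubi D).obj_tensor
  refine ⟨hd, fun X => ?_, fun X => ?_, fun X => ?_, fun X => ?_⟩
  · refine KaroubiTensor.heq_of_f (by rw [hd, ht]) rfl (heq_of_eq ?_)
    change (P.dualMap (𝟙 X) ⊗ₘ 𝟙 X) ≫ P.ev X = P.ev X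
    simp
  · refine KaroubiTensor.heq_of_f rfl (by rw [hd, ht]) (heq_of_eq ?_)
    change P.coev X ≫ (𝟙 X ⊗ₘ P.dualMap (𝟙 X)) = P.coev X
    simp
  · refine KaroubiTensor.heq_of_f (by rw [hd, ht]) rfl (heq_of_eq ?_)
    change (𝟙 X ⊗ₘ P.dualMap (𝟙 X)) ≫ P.evTilde X = P.evTilde X
    simp
  · refine KaroubiTensor.heq_of_f rfl (by rw [hd, ht]) (heq_of_eq ?_)
    change P.coevTilde X ≫ (P.dualMap (𝟙 X) ⊗ₘ 𝟙 X) = P.coevTilde X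
    simp

end PivotalStructure

end karoubiPivotal

/-! ### The regular representation -/

section regular

open MonObj ComonObj TensorProduct TannakaDuality.FiniteGroup

variable {F G : Type u} [Field F] [Group G] [Fintype G]

theorem delta_mul_self (g : G) : delta F G g * delta F G g = delta F G g := by
  classical
  ext t
  simp [delta, Pi.single_apply]

theorem delta_mul_of_ne {g h : G} (hgh : g ≠ h) : delta F G g * delta F G h = 0 := by
  classical
  ext t
  by_cases ht : t = g <;> simp_all [delta, Pi.single_apply]

theorem sum_delta : ∑ g : G, delta F G g = 1 := by
  classical
  ext t
  simp [delta, Pi.single_apply, Finset.sum_apply]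

theorem rightRegular_delta (k g : G) :
    rightRegular (k := F) k (delta F G g) = delta F G (g * k⁻¹) := by
  classical
  ext t
  simp [delta, Pi.single_apply, eq_mul_inv_iff_mul_eq]

theorem regularCounit_one [CharZero F] : regularCounit F G 1 = 1 := by
  rw [← sum_delta, map_sum]
  simp [regularCounit_delta]

theorem delta_ext_tensor {M : Type*} [AddCommGroup M] [Module F M]
    {f g : (G → F) ⊗[F] (G → F) →ₗ[F] M}
    (h : ∀ x y, f (delta F G x ⊗ₜ delta F G y) = g (delta F G x ⊗ₜ delta F G y)) : f = g := by
  apply TensorProduct.ext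
  refine delta_ext fun x => delta_ext fun y => ?_
  exact h x y

/-- Right translation by `k`, as an endomorphism of the left regular representation. -/
def translation (k : G) : regularRep F G ⟶ regularRep F G where
  hom := InducedCategory.homMk (ModuleCat.ofHom (rightRegular (k := F) k))
  comm := by
    intro s
    ext f
    refine funext fun t => ?_
    let f' : G → F := f
    change f' (s⁻¹ * (t * k)) = f' (s⁻¹ * t * k)
    rw [_root_.mul_assoc]

variable [CharZero F]

theorem regularRep_one_counit : η[regularRep F G] ≫ ε[regularRep F G] = 𝟙 _ := by
  apply fdRep_hom_ext
  refine LinearMap.ext_ring (R := F) ?_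
  change regularCounit F G ((1 : F) • 1) = 1
  rw [one_smul, regularCounit_one]

theorem regularRep_comul_mul :
    Δ[regularRep F G] ≫ μ[regularRep F G] = (Fintype.card G : F) • 𝟙 _ := by
  apply fdRep_hom_ext
  refine delta_ext (M := G → F) fun x => ?_
  change LinearMap.mul' F (G → F) (regularComul F G (delta F G x)) =
    (Fintype.card G : F) • delta F G x
  rw [regularComul_delta, map_smul, LinearMap.mul'_apply, delta_mul_self]

theorem regularRep_mul_comm :
    (β_ (regularRep F G) (regularRep F G)).hom ≫ μ[regularRep F G] = μ := by
  apply fdRep_hom_ext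
  refine delta_ext_tensor (M := G → F) fun x y => ?_
  change delta F G y * delta F G x = delta F G x * delta F G y
  rw [mul_comm]

theorem regularRep_associator (t : ((G → F) ⊗[F] (G → F)) ⊗[F] (G → F)) :
    (α_ (regularRep F G) (regularRep F G) (regularRep F G)).hom.hom.hom.hom t =
      TensorProduct.assoc F (G → F) (G → F) (G → F) t := by
  let A : ((G → F) ⊗[F] (G → F)) ⊗[F] (G → F) →ₗ[F] (G → F) ⊗[F] ((G → F) ⊗[F] (G → F)) :=
    (α_ (regularRep F G) (regularRep F G) (regularRep F G)).hom.hom.hom.hom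
  have h : A = (TensorProduct.assoc F (G → F) (G → F) (G → F)).toLinearMap :=
    TensorProduct.ext_threefold fun a b c => rfl
  exact LinearMap.congr_fun h t

theorem regularRep_associator_symm (t : (G → F) ⊗[F] ((G → F) ⊗[F] (G → F))) :
    (α_ (regularRep F G) (regularRep F G) (regularRep F G)).inv.hom.hom.hom t =
      (TensorProduct.assoc F (G → F) (G → F) (G → F)).symm t := by
  let A : (G → F) ⊗[F] ((G → F) ⊗[F] (G → F)) →ₗ[F] ((G → F) ⊗[F] (G → F)) ⊗[F] (G → F) :=
    (α_ (regularRep F G) (regularRep F G) (regularRep F G)).inv.hom.hom.hom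
  have h : A = (TensorProduct.assoc F (G → F) (G → F) (G → F)).symm.toLinearMap :=
    TensorProduct.ext_threefold' fun a b c => rfl
  exact LinearMap.congr_fun h t

/-- On `δ_x ⊗ δ_y` both sides are `|G| δ_x ⊗ δ_x` if `x = y`, and zero otherwise. The other
Frobenius relation is alike. -/
theorem regularRep_frobenius_left : Δ[regularRep F G] ▷ regularRep F G ≫ (α_ _ _ _).hom ≫
    regularRep F G ◁ μ[regularRep F G] = μ[regularRep F G] ≫ Δ[regularRep F G] := by
  apply fdRep_hom_ext
  refine delta_ext_tensor (M := (G → F) ⊗[F] (G → F)) fun x y => ?_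
  refine (congrArg (LinearMap.lTensor (G → F) (LinearMap.mul' F (G → F)))
    (regularRep_associator ((regularComul F G).rTensor (G → F)
      (delta F G x ⊗ₜ delta F G y)))).trans ?_
  change _ = regularComul F G (delta F G x * delta F G y)
  rw [LinearMap.rTensor_tmul, regularComul_delta, ← TensorProduct.smul_tmul', map_smul,
    map_smul, TensorProduct.assoc_tmul, LinearMap.lTensor_tmul, LinearMap.mul'_apply]
  by_cases h : x = y
  · rw [h, delta_mul_self, regularComul_delta]
  · rw [delta_mul_of_ne h]
    simp

theorem regularRep_frobenius_right : regularRep F G ◁ Δ[regularRep F G] ≫ (α_ _ _ _).inv ≫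
    μ[regularRep F G] ▷ regularRep F G = μ[regularRep F G] ≫ Δ[regularRep F G] := by
  apply fdRep_hom_ext
  refine delta_ext_tensor (M := (G → F) ⊗[F] (G → F)) fun x y => ?_
  refine (congrArg (LinearMap.rTensor (G → F) (LinearMap.mul' F (G → F)))
    (regularRep_associator_symm ((regularComul F G).lTensor (G → F)
      (delta F G x ⊗ₜ delta F G y)))).trans ?_
  change _ = regularComul F G (delta F G x * delta F G y)
  rw [LinearMap.lTensor_tmul, regularComul_delta, TensorProduct.tmul_smul, map_smul,
    map_smul, TensorProduct.assoc_symm_tmul, LinearMap.rTensor_tmul, LinearMap.mul'_apply]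
  by_cases h : x = y
  · rw [h, delta_mul_self, regularComul_delta]
  · rw [delta_mul_of_ne h]
    simp

/-- An invariant functional takes the same value on all delta functions, since left translation is
transitive. -/
theorem regularRep_span_counit (f : regularRep F G ⟶ 𝟙_ (FDRep F G)) :
    ∃ a : F, f = a • ε[regularRep F G] := by
  let f' : (G → F) →ₗ[F] F := f.hom.hom.hom
  have hf (s : G) : f' (delta F G s) = f' (delta F G 1) := by
    have := congrArg (fun u => u.hom.hom (delta F G 1)) (f.comm s)
    change f' (leftRegular s (delta F G 1)) = f' (delta F G 1) at this
    rwa [leftRegular_delta, _root_.mul_one] at this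
  refine ⟨(Fintype.card G : F) * f' (delta F G 1), ?_⟩
  apply fdRep_hom_ext
  refine delta_ext (M := F) fun x => ?_
  change f' (delta F G x) = ((Fintype.card G : F) * f' (delta F G 1)) • regularCounit F G _
  rw [regularCounit_delta, hf, smul_eq_mul, mul_right_comm, mul_inv_cancel₀ (by simp), _root_.one_mul]

theorem regularRep_isGaloisAlgebra :
    IsGaloisAlgebra (F := F) (regularRep F G) (Fintype.card G : F) where
  ne_zero := by simp
  one_counit := regularRep_one_counit
  comul_mul := regularRep_comul_mul
  frobenius_left := regularRep_frobenius_left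
  frobenius_right := regularRep_frobenius_right
  span_counit := regularRep_span_counit

/-! ### Translations -/

instance isMonHom_translation (k : G) : IsMonHom (translation (F := F) k) where
  one_hom := by
    apply fdRep_hom_ext
    refine LinearMap.ext_ring (R := F) ?_
    rfl
  mul_hom := by
    apply fdRep_hom_ext
    refine TensorProduct.ext' (R := F) (M := G → F) (N := G → F) fun f g => ?_
    rfl

theorem translation_one : translation (F := F) (1 : G) = 𝟙 _ := by
  apply fdRep_hom_ext
  exact map_one (rightRegular (k := F) (G := G))

theorem translation_mul (k l : G) :
    translation (F := F) (k * l) = translation l ≫ translation k := by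
  apply fdRep_hom_ext
  exact map_mul (rightRegular (k := F) (G := G)) k l

theorem translation_counit (k : G) : translation (F := F) k ≫ ε[regularRep F G] = ε := by
  apply fdRep_hom_ext
  refine delta_ext (M := F) fun x => ?_
  change regularCounit F G (rightRegular k (delta F G x)) = regularCounit F G (delta F G x)
  rw [rightRegular_delta, regularCounit_delta, regularCounit_delta]

theorem translation_comul (k : G) : translation (F := F) k ≫ Δ[regularRep F G] =
    Δ ≫ (translation k ⊗ₘ translation k) := by
  apply fdRep_hom_ext
  refine delta_ext (M := (G → F) ⊗[F] (G → F)) fun x => ?_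
  change regularComul F G (rightRegular k (delta F G x)) =
    TensorProduct.map (rightRegular k) (rightRegular k) (regularComul F G (delta F G x))
  rw [rightRegular_delta, regularComul_delta, regularComul_delta, map_smul,
    TensorProduct.map_tmul, rightRegular_delta]

theorem fdRep_sum_apply {V W : FDRep F G} {I : Type*} (s : Finset I) (f : I → (V ⟶ W)) (v : V) :
    (∑ i ∈ s, f i).hom.hom.hom v = ∑ i ∈ s, (f i).hom.hom.hom v := by
  classical
  induction s using Finset.induction_on with
  | empty => simp
  | insert a s ha ih =>
    rw [Finset.sum_insert ha, Finset.sum_insert ha, ← ih]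
    rfl

/-- The right translates of one delta function add up to the constant function `1`. The factor `|G|`
cancels the normalisation of `ε`. -/
theorem sum_translation : ∑ k : G, translation (F := F) k =
    (Fintype.card G : F) • (ε[regularRep F G] ≫ η) := by
  apply fdRep_hom_ext
  refine delta_ext (M := G → F) fun x => ?_
  refine (fdRep_sum_apply _ _ _).trans ?_
  change ∑ k : G, rightRegular k (delta F G x) =
    (Fintype.card G : F) • (regularCounit F G (delta F G x) • (1 : G → F))
  rw [regularCounit_delta, smul_smul, mul_inv_cancel₀ (by simp), one_smul, ← sum_delta]
  refine Fintype.sum_equiv ((Equiv.inv G).trans (Equiv.mulLeft x)) _ _ fun k => ?_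
  exact rightRegular_delta k x

/-- The Galois property of `Γ`: its tensor square is a sum of copies of `Γ` indexed by `G`. On `δ_x
⊗ δ_y` only the translation with `y k = x` contributes. -/
theorem sum_translation_comul : ∑ k : G, regularRep F G ◁ translation (F := F) k⁻¹ ≫
    μ[regularRep F G] ≫ Δ[regularRep F G] ≫ regularRep F G ◁ translation (F := F) k =
      (Fintype.card G : F) • 𝟙 _ := by
  apply fdRep_hom_ext
  refine delta_ext_tensor (M := (G → F) ⊗[F] (G → F)) fun x y => ?_
  refine (fdRep_sum_apply _ _ _).trans ?_
  change ∑ k : G, (rightRegular k).lTensor (G → F) (regularComul F G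
    (delta F G x * rightRegular k⁻¹ (delta F G y))) =
    (Fintype.card G : F) • (delta F G x ⊗ₜ delta F G y)
  rw [Finset.sum_eq_single (y⁻¹ * x)]
  · rw [rightRegular_delta, inv_inv, mul_inv_cancel_left, delta_mul_self, regularComul_delta,
      map_smul, LinearMap.lTensor_tmul, rightRegular_delta]
    simp
  · intro k _ hk
    rw [rightRegular_delta, inv_inv, delta_mul_of_ne]
    · simp
    · rintro h
      exact hk (by rw [h, inv_mul_cancel_left])
  · simp

/-- An algebra map followed by evaluation at the unit of `G` is a character of the algebra of
functions, hence evaluation at some point `k`. Equivariance then determines the map everywhere.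
Invertibility is not assumed, so algebra endomorphisms are automatically automorphisms. -/
theorem exists_translation (f : regularRep F G ⟶ regularRep F G) [IsMonHom f] :
    ∃ k, f = translation k := by
  let f' : (G → F) →ₗ[F] (G → F) := f.hom.hom.hom
  have h1 : f' 1 = 1 := by
    have h := congrArg (fun u => u.hom.hom.hom (1 : F)) (IsMonHom.one_hom f)
    change f' ((1 : F) • 1) = (1 : F) • 1 at h
    rwa [one_smul] at h
  have hm (a b : G → F) : f' (a * b) = f' a * f' b :=
    congrArg (fun u => u.hom.hom.hom (a ⊗ₜ[F] b)) (IsMonHom.mul_hom f)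
  have hl (s : G) (a : G → F) : f' (leftRegular s a) = leftRegular s (f' a) :=
    congrArg (fun u => u.hom.hom a) (f.comm s)
  obtain ⟨k, hk⟩ : ∃ k, f' (delta F G k) 1 ≠ 0 := by
    by_contra! h
    have := congrFun h1 1
    rw [← sum_delta, map_sum, Finset.sum_apply, ← Finset.sum_apply, sum_delta] at this
    simp [h] at this
  -- The value is a nonzero idempotent of the field. Orthogonality of the delta functions then kills
  -- all the other values.
  have hk1 : f' (delta F G k) 1 = 1 := by
    have h := congrFun (hm (delta F G k) (delta F G k)) 1
    rw [delta_mul_self, Pi.mul_apply] at h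
    exact mul_left_cancel₀ hk (by rw [← h, _root_.mul_one])
  have hne (j : G) (hj : j ≠ k) : f' (delta F G j) 1 = 0 := by
    have h := congrFun (hm (delta F G k) (delta F G j)) 1
    rw [delta_mul_of_ne hj.symm, map_zero, Pi.mul_apply, hk1, _root_.one_mul] at h
    exact h.symm
  refine ⟨k, fdRep_hom_ext (delta_ext (M := G → F) fun x => ?_)⟩
  change f' (delta F G x) = rightRegular k (delta F G x)
  classical
  ext t
  have h := congrFun (hl t (delta F G (t⁻¹ * x))) t
  rw [leftRegular_delta, mul_inv_cancel_left, leftRegular_apply, inv_mul_cancel] at h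
  rw [h, rightRegular_delta]
  by_cases hx : t⁻¹ * x = k
  · rw [hx, hk1, ← hx]
    simp [delta]
  · rw [hne _ hx]
    symm
    simp only [delta, Pi.single_apply, ite_eq_right_iff, one_ne_zero, imp_false]
    rintro rfl
    exact hx (by group)

theorem translation_injective : Function.Injective (translation (F := F) (G := G)) := by
  intro k l h
  have h' := congrArg (fun u => u.hom.hom.hom (delta F G 1)) h
  change rightRegular k (delta F G 1) = rightRegular l (delta F G 1) at h'
  rw [rightRegular_delta, rightRegular_delta, _root_.one_mul, _root_.one_mul] at h'
  classical
  have := congrFun h' k⁻¹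
  by_contra hkl
  simp [delta, hkl] at this

/-! ### Traces -/

/-- The copairing `Δ ∘ η` is `|G| ∑ δ_g ⊗ δ_g`, and the pairing `ε ∘ m` extracts the diagonal entry
of `f` at `g` with the factor `1 / |G|`. So the categorical expression is the matrix trace. -/
theorem regularRep_trace (f : regularRep F G ⟶ regularRep F G) :
    η[regularRep F G] ≫ Δ[regularRep F G] ≫ regularRep F G ◁ f ≫ μ[regularRep F G] ≫
      ε[regularRep F G] = (LinearMap.trace F (G → F) f.hom.hom.hom) • 𝟙 _ := by
  classical
  let f' : (G → F) →ₗ[F] (G → F) := f.hom.hom.hom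
  apply fdRep_hom_ext
  refine LinearMap.ext_ring (R := F) ?_
  change regularCounit F G (LinearMap.mul' F (G → F) (f'.lTensor (G → F) (regularComul F G
    ((1 : F) • 1)))) = LinearMap.trace F (G → F) f' • (1 : F)
  have h (g : G) : delta F G g * f' (delta F G g) = f' (delta F G g) g • delta F G g := by
    ext t
    by_cases ht : t = g <;> simp_all [delta]
  rw [one_smul, ← sum_delta]
  simp only [map_sum, regularComul_delta, map_smul, LinearMap.lTensor_tmul, LinearMap.mul'_apply, h,
    regularCounit_delta, smul_eq_mul]
  rw [LinearMap.trace_eq_matrix_trace F (Pi.basisFun F G), Matrix.trace, _root_.mul_one]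
  refine Finset.sum_congr rfl fun g _ => ?_
  rw [mul_left_comm, mul_inv_cancel₀ (by simp), _root_.mul_one]
  simp [delta]

end regular

section

open MonObj ComonObj

/-- A group of automorphisms of the Frobenius algebra `Γ` for which `Γ` is a Galois extension of
the unit object, of degree `n`. -/
structure IsTranslations {F : Type u} [Field F] {G : Type*} [Group G] [Fintype G] {C : Type v}
    [Category.{w} C] [Preadditive C] [Linear F C] [MonoidalCategory C] (Γ : C) [MonObj Γ]
    [ComonObj Γ] (n : F) (r : G → (Γ ⟶ Γ)) : Prop where
  degree : n = Fintype.card G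
  isMonHom (k : G) : IsMonHom (r k)
  one : r 1 = 𝟙 Γ
  mul (k l : G) : r (k * l) = r l ≫ r k
  counit (k : G) : r k ≫ ε[Γ] = ε[Γ]
  comul (k : G) : r k ≫ Δ[Γ] = Δ[Γ] ≫ (r k ⊗ₘ r k)
  sum : ∑ k, r k = n • (ε[Γ] ≫ η[Γ])
  sum_comul : ∑ k, Γ ◁ r k⁻¹ ≫ μ[Γ] ≫ Δ[Γ] ≫ Γ ◁ r k = n • 𝟙 (Γ ⊗ Γ)
  exists_eq (f : Γ ⟶ Γ) : IsMonHom f → ∃ k, f = r k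
  injective : Function.Injective r

/-! ### Transport along a monoidal functor -/

section transport

open scoped Obj

open Functor.Monoidal Functor.LaxMonoidal Functor.OplaxMonoidal

variable {F : Type u} [Field F] {A : Type*} [Category* A] [Preadditive A] [Linear F A]
  [MonoidalCategory A] {C : Type v} [Category.{w} C] [Preadditive C] [Linear F C]
  [MonoidalCategory C] (Φ : A ⥤ C) [Φ.Monoidal] [Φ.Additive] [Φ.Linear F]
  (R : A) [MonObj R] [ComonObj R]

attribute [local instance] Functor.obj.instComonObj

/-- The equational conditions pass along any linear monoidal functor. Fullness serves only to lift a
map `Γ ⟶ 𝟙` in `span_counit`. -/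
theorem IsGaloisAlgebra.map [Φ.Full] {n : F} (hR : IsGaloisAlgebra R n) :
    IsGaloisAlgebra (Φ.obj R) n where
  ne_zero := hR.ne_zero
  one_counit := by
    rw [Functor.obj.η_def, Functor.obj.ε_def, Category.assoc, ← Functor.map_comp_assoc,
      hR.one_counit]
    simp
  comul_mul := by
    rw [Functor.obj.μ_def, Functor.obj.Δ_def, Category.assoc, δ_μ_assoc, ← Functor.map_comp,
      hR.comul_mul, Functor.map_smul, CategoryTheory.Functor.map_id]
  frobenius_left := by
    have h := congrArg Φ.map hR.frobenius_left
    simp only [Functor.map_comp, map_whiskerRight, map_associator, map_whiskerLeft] at h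
    rw [Functor.obj.μ_def, Functor.obj.Δ_def, ← cancel_epi (Functor.OplaxMonoidal.δ Φ R R),
      ← cancel_mono (Functor.LaxMonoidal.μ Φ R R)]
    simp only [comp_whiskerRight, MonoidalCategory.whiskerLeft_comp, Category.assoc, δ_μ,
      δ_μ_assoc, Category.comp_id]
    simp only [Category.assoc, μ_δ_assoc] at h
    rw [← h]
  frobenius_right := by
    have h := congrArg Φ.map hR.frobenius_right
    simp only [Functor.map_comp, map_whiskerRight, map_associator_inv, map_whiskerLeft] at h
    rw [Functor.obj.μ_def, Functor.obj.Δ_def, ← cancel_epi (Functor.OplaxMonoidal.δ Φ R R),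
      ← cancel_mono (Functor.LaxMonoidal.μ Φ R R)]
    simp only [comp_whiskerRight, MonoidalCategory.whiskerLeft_comp, Category.assoc, δ_μ,
      δ_μ_assoc, Category.comp_id]
    simp only [Category.assoc, μ_δ_assoc] at h
    rw [← h]
  span_counit f := by
    obtain ⟨g, hg⟩ := Φ.map_surjective (f ≫ Functor.LaxMonoidal.ε Φ)
    obtain ⟨a, rfl⟩ := hR.span_counit g
    refine ⟨a, ?_⟩
    rw [← cancel_mono (Functor.LaxMonoidal.ε Φ), ← hg, Functor.obj.ε_def, Functor.map_smul]
    simp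

theorem IsTranslations.map {G : Type*} [Group G] [Fintype G] [Φ.Full] [Φ.Faithful] {n : F}
    {r : G → (R ⟶ R)} (hr : IsTranslations R n r) :
    IsTranslations (Φ.obj R) n fun k => Φ.map (r k) where
  degree := hr.degree
  isMonHom k := by
    have := hr.isMonHom k
    infer_instance
  one := by rw [hr.one, CategoryTheory.Functor.map_id]
  mul k l := by rw [hr.mul, Functor.map_comp]
  counit k := by
    rw [Functor.obj.ε_def, ← Functor.map_comp_assoc, hr.counit]
  comul k := by
    rw [Functor.obj.Δ_def, ← Functor.map_comp_assoc, hr.comul, Functor.map_comp, Category.assoc,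
      Category.assoc, δ_natural]
  sum := by
    rw [← Functor.map_sum, hr.sum, Functor.map_smul, Functor.obj.ε_def, Functor.obj.η_def]
    simp
  sum_comul := by
    have h := congrArg Φ.map hr.sum_comul
    rw [Functor.map_sum, Functor.map_smul, CategoryTheory.Functor.map_id] at h
    have h' := congrArg (fun u => Functor.LaxMonoidal.μ Φ R R ≫ u ≫ Functor.OplaxMonoidal.δ Φ R R) h
    simp only [Preadditive.sum_comp, Preadditive.comp_sum, Linear.smul_comp, Linear.comp_smul] at h'
    simp only [Category.id_comp, μ_δ] at h'
    rw [← h']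
    refine Finset.sum_congr rfl fun k _ => ?_
    rw [Functor.obj.Δ_def, Functor.obj.μ_def]
    simp
  exists_eq f hf := by
    let hΦ := Functor.FullyFaithful.ofFullyFaithful Φ
    obtain ⟨k, hk⟩ := hr.exists_eq (hΦ.preimage f) inferInstance
    exact ⟨k, by rw [← hk, hΦ.map_preimage]⟩
  injective := Φ.map_injective.comp hr.injective

theorem map_trace (f : R ⟶ R) (a : F) (h : η[R] ≫ Δ[R] ≫ R ◁ f ≫ μ[R] ≫ ε[R] = a • 𝟙 _) :
    η[Φ.obj R] ≫ Δ[Φ.obj R] ≫ Φ.obj R ◁ Φ.map f ≫ μ[Φ.obj R] ≫ ε[Φ.obj R] = a • 𝟙 _ := by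
  have h' := congrArg Φ.map h
  simp only [Functor.map_comp, map_whiskerLeft, Functor.map_smul] at h'
  have h'' := congrArg (fun u => Functor.LaxMonoidal.ε Φ ≫ u ≫ Functor.OplaxMonoidal.η Φ) h'
  simp only [Linear.smul_comp, Linear.comp_smul] at h''
  simp only [CategoryTheory.Functor.map_id, Category.id_comp, ε_η] at h''
  rw [← h'', Functor.obj.Δ_def, Functor.obj.μ_def, Functor.obj.ε_def, Functor.obj.η_def]
  simp

end transport

/-! ### The algebra `Γ` inside `C` -/

section regular

variable {F G : Type u} [Field F] [CharZero F] [Group G] [Fintype G]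

theorem isTranslations_translation :
    IsTranslations (F := F) (regularRep F G) (Fintype.card G : F) (translation (F := F)) where
  degree := rfl
  isMonHom := inferInstance
  one := translation_one
  mul := translation_mul
  counit := translation_counit
  comul := translation_comul
  sum := sum_translation
  sum_comul := sum_translation_comul
  exists_eq f _ := exists_translation f
  injective := translation_injective

instance : IsCommMonObj (regularRep F G) := ⟨regularRep_mul_comm⟩

variable {C : Type v} [Category.{w} C] [Preadditive C] [Linear F C] [MonoidalCategory C]
  [BraidedCategory C] (S : ObjectProperty C) [S.IsMonoidal] (K : FDRep F G ⥤ S.FullSubcategory)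
  [K.Additive] [K.Linear F] [K.Braided] [K.IsEquivalence]

theorem regularObj_isGaloisAlgebra :
    IsGaloisAlgebra (F := F) (regularObj S K) (Fintype.card G : F) :=
  IsGaloisAlgebra.map (K ⋙ S.ι) (regularRep F G) regularRep_isGaloisAlgebra

/-- Right translation by `k`, as an endomorphism of `Γ`. -/
def translationObj (k : G) : regularObj S K ⟶ regularObj S K := (K ⋙ S.ι).map (translation k)

theorem regularObj_isTranslations :
    IsTranslations (F := F) (regularObj S K) (Fintype.card G : F) (translationObj S K) :=
  IsTranslations.map (K ⋙ S.ι) (regularRep F G) isTranslations_translation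

instance : IsCommMonObj (regularObj S K) :=
  open scoped Obj in inferInstanceAs (IsCommMonObj ((K ⋙ S.ι).obj (regularRep F G)))

theorem regularObj_trace (f : regularRep F G ⟶ regularRep F G) :
    η[regularObj S K] ≫ Δ[regularObj S K] ≫ regularObj S K ◁ (K ⋙ S.ι).map f ≫
      μ[regularObj S K] ≫ ε[regularObj S K] =
        (LinearMap.trace F (G → F) f.hom.hom.hom) • 𝟙 (𝟙_ C) :=
  map_trace (K ⋙ S.ι) (regularRep F G) f _ (regularRep_trace f)

end regular

end

section

open MonObj ComonObj

/-! ### Traces of endomorphisms of a Frobenius algebra -/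

section frobenius

variable {F : Type u} [Field F] {C : Type v} [Category.{w} C] [Preadditive C]
    [Linear F C] [MonoidalCategory C] {Γ : C} [MonObj Γ] [ComonObj Γ] {n : F}

theorem IsGaloisAlgebra.snake (hΓ : IsGaloisAlgebra Γ n) :
    Γ ◁ (η[Γ] ≫ Δ[Γ]) ≫ (α_ Γ Γ Γ).inv ≫ (μ[Γ] ≫ ε[Γ]) ▷ Γ = (ρ_ Γ).hom ≫ (λ_ Γ).inv := by
  have h := hΓ.frobenius_right
  rw [MonoidalCategory.whiskerLeft_comp, comp_whiskerRight, Category.assoc, reassoc_of% h,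
    MonObj.mul_one_assoc, counit_comul]

theorem IsGaloisAlgebra.snake' (hΓ : IsGaloisAlgebra Γ n) :
    (η[Γ] ≫ Δ[Γ]) ▷ Γ ≫ (α_ Γ Γ Γ).hom ≫ Γ ◁ (μ[Γ] ≫ ε[Γ]) = (λ_ Γ).hom ≫ (ρ_ Γ).inv := by
  have h := hΓ.frobenius_left
  rw [MonoidalCategory.whiskerLeft_comp, comp_whiskerRight, Category.assoc, reassoc_of% h,
    MonObj.one_mul_assoc, comul_counit]

/-- The pairing of a Frobenius algebra with itself. -/
@[reducible]
def IsGaloisAlgebra.pairing (hΓ : IsGaloisAlgebra Γ n) : ExactPairing Γ Γ where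
  coevaluation' := η[Γ] ≫ Δ[Γ]
  evaluation' := μ[Γ] ≫ ε[Γ]
  coevaluation_evaluation' := hΓ.snake
  evaluation_coevaluation' := hΓ.snake'

/-- Universality of the dual. Applied to `ε ∘ m`, it compares the self-duality of the Frobenius
algebra with the chosen dual of `Γ`. -/
theorem PivotalStructure.exists_evTilde (P : PivotalStructure C) {X Z : C} (t : X ⊗ Z ⟶ 𝟙_ C) :
    ∃ e : Z ⟶ P.dual X, X ◁ e ≫ P.evTilde X = t := by
  let _ := P.leftPairing X
  let u := tensorLeftHomEquiv Z (P.dual X) X (𝟙_ C) t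
  refine ⟨u ≫ (ρ_ _).hom, ?_⟩
  have h := (tensorLeftHomEquiv Z (P.dual X) X (𝟙_ C)).symm_apply_apply t
  refine Eq.trans ?_ h
  change _ = X ◁ u ≫ (α_ _ _ _).inv ≫ P.evTilde X ▷ _ ≫ (λ_ _).hom
  monoidal

/-- The comparison `e` of `Γ` with its dual replaces the chosen pairings by `ε ∘ m` and `Δ ∘ η`.
Turning `ev` into `evTilde` costs a braiding and a twist; commutativity of `m` absorbs the braiding,
and the twist stays. -/
theorem IsGaloisAlgebra.leftTrace [BraidedCategory C] [IsCommMonObj Γ]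
    (hΓ : IsGaloisAlgebra Γ n) (P : PivotalStructure C) (f : Γ ⟶ Γ) :
    P.leftTrace f = η[Γ] ≫ Δ[Γ] ≫ Γ ◁ (f ≫ P.twist Γ) ≫ μ[Γ] ≫ ε[Γ] := by
  obtain ⟨e, he⟩ := P.exists_evTilde (μ[Γ] ≫ ε[Γ])
  have hc : (η[Γ] ≫ Δ[Γ]) ≫ e ▷ Γ = P.coevTilde Γ :=
    coevaluation_comp_of_evaluation hΓ.pairing (P.leftPairing Γ) e he
  have hev : e ▷ Γ ≫ P.ev Γ = Γ ◁ P.twist Γ ≫ μ[Γ] ≫ ε[Γ] := by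
    have h : P.ev Γ = (β_ (P.dual Γ) Γ).hom ≫ P.twist Γ ▷ P.dual Γ ≫ P.evTilde Γ := by
      rw [← P.twist_evTilde, Iso.hom_inv_id_assoc]
    rw [h, BraidedCategory.braiding_naturality_left_assoc, whisker_exchange_assoc, he,
      ← BraidedCategory.braiding_naturality_right_assoc, IsCommMonObj.mul_comm_assoc]
  rw [PivotalStructure.leftTrace, ← hc, Category.assoc, Category.assoc,
    ← whisker_exchange_assoc, hev, MonoidalCategory.whiskerLeft_comp, Category.assoc]

end frobenius

section dim

variable {F : Type u} [Field F] {D : Type v} [Category.{w} D] [Preadditive D] [Linear F D]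
  [MonoidalCategory D]

theorem IsLinearTensor.leftTrace_id (h : IsLinearTensor F D) (P : PivotalStructure D) (X : D) :
    P.leftTrace (𝟙 X) = P.dim F X • 𝟙 (𝟙_ D) := by
  obtain ⟨a, ha⟩ := h.end_unit.2 (P.leftTrace (𝟙 X))
  exact Classical.epsilon_spec (p := fun a : F => P.leftTrace (𝟙 X) = a • 𝟙 (𝟙_ D)) ⟨a, ha.symm⟩

theorem IsLinearTensor.dim_eq (h : IsLinearTensor F D) (P : PivotalStructure D) {X : D} {a : F}
    (ha : P.leftTrace (𝟙 X) = a • 𝟙 (𝟙_ D)) : P.dim F X = a :=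
  h.end_unit.1 ((h.leftTrace_id P X).symm.trans ha)

/-- The dimension of a retract. -/
theorem PivotalStructure.leftTrace_retract (P : PivotalStructure D) {X Y : D} (i : X ⟶ Y)
    (p : Y ⟶ X) (h : i ≫ p = 𝟙 X) : P.leftTrace (𝟙 X) = P.leftTrace (p ≫ i) := by
  rw [← h, P.leftTrace_comp]

end dim

/-! ### The twist of the regular representation -/

section twist

variable {F G : Type u} [Field F] [CharZero F] [Group G] [Fintype G]
  {C : Type v} [Category.{w} C] [Preadditive C] [Linear F C] [MonoidalCategory C]
  [MonoidalPreadditive C] [MonoidalLinear F C]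
  [BraidedCategory C] {P : PivotalStructure C} {S : ObjectProperty C} [S.IsMonoidal]
  (K : FDRep F G ⥤ S.FullSubcategory)
  [K.Additive] [K.Linear F] [K.Braided] [K.IsEquivalence]

theorem regularObj_mem : S (regularObj S K) := (K.obj (regularRep F G)).property

variable (S) in
/-- An endomorphism of the regular representation, as one of `Γ`. -/
def regularEnd (f : regularRep F G ⟶ regularRep F G) : regularObj S K ⟶ regularObj S K :=
  (K ⋙ S.ι).map f

theorem regularEnd_comp (f g : regularRep F G ⟶ regularRep F G) :
    regularEnd S K (f ≫ g) = regularEnd S K f ≫ regularEnd S K g := (K ⋙ S.ι).map_comp f g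

theorem regularEnd_id : regularEnd S K (𝟙 _) = 𝟙 _ := (K ⋙ S.ι).map_id _

theorem regularEnd_smul (a : F) (f : regularRep F G ⟶ regularRep F G) :
    regularEnd S K (a • f) = a • regularEnd S K f := (K ⋙ S.ι).map_smul a f

theorem regularEnd_injective : Function.Injective (regularEnd (F := F) S K) :=
  (K ⋙ S.ι).map_injective

theorem regularEnd_surjective : Function.Surjective (regularEnd (F := F) S K) :=
  (K ⋙ S.ι).map_surjective

theorem regularEnd_trace (f : regularRep F G ⟶ regularRep F G) :
    η[regularObj S K] ≫ Δ[regularObj S K] ≫ regularObj S K ◁ regularEnd S K f ≫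
      μ[regularObj S K] ≫ ε[regularObj S K] =
        (LinearMap.trace F (G → F) f.hom.hom.hom) • 𝟙 (𝟙_ C) := regularObj_trace S K f

/-- In the star case this is assumed. In the other case the twist is an involution by symmetry, and
on the image `E` of its `-1` eigenprojection the trace formula gives `d(E) = -rank`. As `d(E)` is a
natural number and the characteristic is zero, the rank vanishes. -/
theorem twist_regularObj (hC : IsBTC F P) (hS : IsSubSTC P S) (hadm : IsAdmissible F P S) :
    P.twist (regularObj S K) = 𝟙 _ := by
  have hmem : S (regularObj S K) := regularObj_mem K
  rcases hadm with ⟨φ, T, -, h⟩ | ⟨-, hdim⟩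
  · exact h _ hmem
  have hsq := PivotalStructure.twist_sq hC.ribbon (regularObj S K)
    (hS.symmetric _ _ hmem (hS.dual_mem _ hmem))
  obtain ⟨θ, hθ⟩ := regularEnd_surjective K (P.twist (regularObj S K))
  have hθ2 : θ ≫ θ = 𝟙 _ := regularEnd_injective K (by
    rw [regularEnd_comp, hθ, regularEnd_id, hsq])
  -- The projection onto the `-1` eigenspace of the twist, pulled back to representations.
  let e : regularRep F G ⟶ regularRep F G := (2 : F)⁻¹ • (𝟙 _ - θ)
  have h2 : (2 : F) ≠ 0 := two_ne_zero
  have hθe : e ≫ θ = -e := by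
    simp only [e, Linear.smul_comp, Preadditive.sub_comp, Category.id_comp, hθ2]
    rw [← smul_neg, neg_sub]
  have he : e ≫ e = e := by
    have : e ≫ e = (2 : F)⁻¹ • (e - e ≫ θ) := by
      conv_lhs => rhs; unfold e
      rw [Linear.comp_smul, Preadditive.comp_sub, Category.comp_id]
    rw [this, hθe, sub_neg_eq_add, ← two_smul F e, smul_smul, inv_mul_cancel₀ h2, one_smul]
  obtain ⟨E, i, p, hip, hpi⟩ := hS.semisimple.isIdempotentComplete.idempotents_split
    (K.obj (regularRep F G)) (K.map e) (by rw [← Functor.map_comp, he])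
  obtain ⟨m, hm⟩ := hdim E.obj E.property
  -- The sign comes from the twist in the trace formula `IsGaloisAlgebra.leftTrace`, which acts as
  -- `-1` on the image of `e`.
  have htr : P.leftTrace (𝟙 E.obj) = (-(LinearMap.trace F (G → F) e.hom.hom.hom)) • 𝟙 _ := by
    have h₁ : S.ι.map i ≫ S.ι.map p = 𝟙 E.obj := by
      rw [← Functor.map_comp, hip]
      exact S.ι.map_id E
    have h₂ : S.ι.map p ≫ S.ι.map i = regularEnd S K e := by
      rw [← Functor.map_comp, hpi]
      rfl
    have h₃ : regularEnd S K e ≫ P.twist (regularObj S K) = (-1 : F) • regularEnd S K e := by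
      rw [← hθ, ← regularEnd_comp, hθe, ← regularEnd_smul, neg_one_smul]
    refine (P.leftTrace_retract _ _ h₁).trans ((congrArg P.leftTrace h₂).trans ?_)
    change P.leftTrace (regularEnd S K e) = _
    rw [(regularObj_isGaloisAlgebra S K).leftTrace P, h₃, MonoidalLinear.whiskerLeft_smul,
      Linear.smul_comp, Linear.comp_smul, Linear.comp_smul, regularEnd_trace, smul_smul,
      neg_one_mul]
  have htr' := hC.toIsLinearTensor.dim_eq P htr
  let e' : (G → F) →ₗ[F] (G → F) := e.hom.hom.hom
  have hid : IsIdempotentElem e' :=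
    congrArg (fun u : regularRep F G ⟶ regularRep F G => u.hom.hom.hom) he
  have hzero : LinearMap.trace F (G → F) e' = 0 := by
    have h₁ := (LinearMap.IsIdempotentElem.isProj_range e' hid).trace
    change P.dim F E.obj = -LinearMap.trace F (G → F) e' at htr'
    rw [hm, h₁] at htr'
    rw [h₁]
    -- A sum of two natural numbers that is zero in characteristic zero; both summands vanish.
    have h₂ : ((m + Module.finrank F (LinearMap.range e') : ℕ) : F) = 0 := by
      rw [Nat.cast_add, htr', neg_add_cancel]
    have h₃ := Nat.cast_eq_zero.mp h₂
    rw [(Nat.add_eq_zero_iff.mp h₃).2, Nat.cast_zero]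
  have he0 : e = 0 := fdRep_hom_ext ((LinearMap.IsIdempotentElem.trace_eq_zero_iff hid).mp hzero)
  have hθ1 : θ = 𝟙 _ := by
    have h := congrArg ((2 : F) • ·) he0
    simp only [e, smul_smul, mul_inv_cancel₀ h2, one_smul, smul_zero] at h
    exact (sub_eq_zero.mp h).symm
  rw [← hθ, hθ1, regularEnd_id]

theorem regularObj_braiding_ev (hC : IsBTC F P) (hS : IsSubSTC P S) (hadm : IsAdmissible F P S) :
    (β_ (regularObj S K) (P.dual (regularObj S K))).hom ≫ P.ev (regularObj S K) =
      P.evTilde (regularObj S K) := by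
  have hmem : S (regularObj S K) := regularObj_mem K
  have h := P.twist_evTilde (regularObj S K)
  rw [twist_regularObj K hC hS hadm, id_whiskerRight, Category.id_comp] at h
  rw [← h]
  congr 1
  rw [← cancel_mono (β_ (P.dual (regularObj S K)) (regularObj S K)).hom, Iso.inv_hom_id]
  exact hS.symmetric _ _ hmem (hS.dual_mem _ hmem)

theorem leftTrace_regularObj (hC : IsBTC F P) (hS : IsSubSTC P S) (hadm : IsAdmissible F P S)
    (f : regularRep F G ⟶ regularRep F G) :
    P.leftTrace (regularEnd S K f) = (LinearMap.trace F (G → F) f.hom.hom.hom) • 𝟙 (𝟙_ C) := by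
  rw [(regularObj_isGaloisAlgebra S K).leftTrace P, twist_regularObj K hC hS hadm,
    Category.comp_id, regularEnd_trace]

end twist

end

section

open MonObj ComonObj

/-! ### Extension of strict monoidal functors to idempotent completions -/

section extension

variable {D : Type v} [Category.{w} D] {E : Type v} [Category.{w} E]

theorem comp_eqToHom_of_heq {X Y X' Y' : D} {f : X ⟶ Y} {g : X' ⟶ Y'} (hX : X = X') (hY : Y = Y')
    (h : HEq f g) : f ≫ eqToHom hY = eqToHom hX ≫ g := by
  subst hX hY
  simpa using eq_of_heq h

variable [MonoidalCategory D] [MonoidalCategory E]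

theorem IsStrictMonoidalFunctor.functorExtension {J : D ⥤ E} (hJ : IsStrictMonoidalFunctor J) :
    IsStrictMonoidalFunctor ((functorExtension₂ D E).obj J) := by
  have hu : ((functorExtension₂ D E).obj J).obj (𝟙_ _) = 𝟙_ (Karoubi E) :=
    Karoubi.ext hJ.obj_unit (comp_eqToHom_of_heq _ _ (by
      change HEq (J.map (𝟙 (𝟙_ D))) (𝟙 (𝟙_ E))
      rw [CategoryTheory.Functor.map_id, hJ.obj_unit]))
  have ht : ∀ X Y : Karoubi D, ((functorExtension₂ D E).obj J).obj (X ⊗ Y) =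
      ((functorExtension₂ D E).obj J).obj X ⊗ ((functorExtension₂ D E).obj J).obj Y := fun X Y =>
    Karoubi.ext (hJ.obj_tensor X.X Y.X) (comp_eqToHom_of_heq _ _ (hJ.map_tensor X.p Y.p))
  refine ⟨hu, ht, fun f g => ?_, fun X Y Z => ?_, fun X => ?_, fun X => ?_⟩
  · exact KaroubiTensor.heq_of_f (ht _ _) (ht _ _) (hJ.map_tensor f.f g.f)
  · refine KaroubiTensor.heq_of_f (by rw [ht, ht]) (by rw [ht, ht]) ?_
    change HEq (J.map (((X.p ⊗ₘ Y.p) ⊗ₘ Z.p) ≫ (α_ X.X Y.X Z.X).hom))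
      (((J.map X.p ⊗ₘ J.map Y.p) ⊗ₘ J.map Z.p) ≫ (α_ (J.obj X.X) (J.obj Y.X) (J.obj Z.X)).hom)
    rw [Functor.map_comp]
    refine heq_comp (by rw [hJ.obj_tensor, hJ.obj_tensor]) (by rw [hJ.obj_tensor, hJ.obj_tensor])
      (by rw [hJ.obj_tensor, hJ.obj_tensor]) ?_ (hJ.map_associator _ _ _)
    exact (hJ.map_tensor _ _).trans (StrictAction.heq_tensorHom (hJ.obj_tensor _ _)
      (hJ.obj_tensor _ _) rfl rfl (hJ.map_tensor _ _) HEq.rfl)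
  · refine KaroubiTensor.heq_of_f (by rw [ht, hu]) rfl ?_
    change HEq (J.map ((𝟙 (𝟙_ D) ⊗ₘ X.p) ≫ (λ_ X.X).hom))
      ((𝟙 (𝟙_ E) ⊗ₘ J.map X.p) ≫ (λ_ (J.obj X.X)).hom)
    rw [Functor.map_comp]
    refine heq_comp (by rw [hJ.obj_tensor, hJ.obj_unit]) (by rw [hJ.obj_tensor, hJ.obj_unit])
      rfl ?_ (hJ.map_leftUnitor _)
    refine (hJ.map_tensor _ _).trans (StrictAction.heq_tensorHom hJ.obj_unit hJ.obj_unit rfl rfl ?_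
      HEq.rfl)
    rw [CategoryTheory.Functor.map_id, hJ.obj_unit]
  · refine KaroubiTensor.heq_of_f (by rw [ht, hu]) rfl ?_
    change HEq (J.map ((X.p ⊗ₘ 𝟙 (𝟙_ D)) ≫ (ρ_ X.X).hom))
      ((J.map X.p ⊗ₘ 𝟙 (𝟙_ E)) ≫ (ρ_ (J.obj X.X)).hom)
    rw [Functor.map_comp]
    refine heq_comp (by rw [hJ.obj_tensor, hJ.obj_unit]) (by rw [hJ.obj_tensor, hJ.obj_unit])
      rfl ?_ (hJ.map_rightUnitor _)
    refine (hJ.map_tensor _ _).trans (StrictAction.heq_tensorHom rfl rfl hJ.obj_unit hJ.obj_unit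
      HEq.rfl ?_)
    rw [CategoryTheory.Functor.map_id, hJ.obj_unit]

/-- The action on the idempotent completion. -/
def StrictAction.karoubi {H : Type*} [Group H] (A : StrictAction H D) :
    StrictAction H (Karoubi D) where
  functor g := (functorExtension₂ D D).obj (A.functor g)
  functor_one := by
    rw [A.functor_one]
    rfl
  functor_mul g h := by
    rw [A.functor_mul]
    rfl
  strict g := (A.strict g).functorExtension

theorem StrictAction.Fixed.heq_of_hom {H : Type*} [Group H] {A : StrictAction H D}
    {X X' Y Y' : A.Fixed} (hX : X = X') (hY : Y = Y') {s : X ⟶ Y} {t : X' ⟶ Y'}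
    (h : HEq s.hom t.hom) : HEq s t := by
  subst hX hY
  exact heq_of_eq (StrictAction.Fixed.hom_ext (eq_of_heq h))

theorem StrictAction.Fixed.obj_ext {H : Type*} [Group H] {A : StrictAction H D} {X X' : A.Fixed}
    (h : X.obj = X'.obj) : X = X' := by
  cases X
  cases X'
  subst h
  rfl

end extension

/-! ### The action of the automorphisms of the algebra -/

section action

variable {C : Type v} [Category.{w} C] [MonoidalCategory C] {Γ : C} [MonObj Γ] [ComonObj Γ]

theorem gammaHom_hom (g : algAut Γ) {X Y : Crossed Γ} (s : X ⟶ Y) :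
    (gammaHom g s).hom = (g⁻¹ : algAut Γ).1.hom ▷ X.obj ≫ s.hom := rfl

theorem gammaHom_one {X Y : Crossed Γ} (s : X ⟶ Y) : gammaHom (1 : algAut Γ) s = s := by
  ext
  rw [gammaHom_hom, inv_one]
  change 𝟙 Γ ▷ X.obj ≫ s.hom = s.hom
  simp

theorem gammaHom_mul (g h : algAut Γ) {X Y : Crossed Γ} (s : X ⟶ Y) :
    gammaHom (g * h) s = gammaHom g (gammaHom h s) := by
  ext
  rw [gammaHom_hom, gammaHom_hom, gammaHom_hom, mul_inv_rev, ← comp_whiskerRight_assoc]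
  rfl

variable (hcom : ∀ g : algAut Γ, IsComonHom g.1.hom)

theorem gammaHom_incl (hcom : ∀ g : algAut Γ, IsComonHom g.1.hom) (g : algAut Γ) {X Y : C}
    (s : X ⟶ Y) : gammaHom g ((Crossed.incl Γ).map s) = (Crossed.incl Γ).map s := by
  ext
  have := hcom g⁻¹
  have h : ∀ g : Γ ⟶ Γ, g ≫ ε[Γ] = ε[Γ] →
      g ▷ X ≫ ε[Γ] ▷ X ≫ (λ_ X).hom ≫ s = ε[Γ] ▷ X ≫ (λ_ X).hom ≫ s := fun g hg => by
    rw [← comp_whiskerRight_assoc, hg]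
  exact h _ (IsComonHom.hom_counit _)

theorem gammaHom_id (hcom : ∀ g : algAut Γ, IsComonHom g.1.hom) (g : algAut Γ) (X : Crossed Γ) :
    gammaHom g (𝟙 X) = 𝟙 X := by
  have h := gammaHom_incl hcom g (𝟙 X.obj)
  rw [CategoryTheory.Functor.map_id] at h
  exact h

/-- `γ_g`, as a functor. -/
def gammaFunctor (g : algAut Γ) : Crossed Γ ⥤ Crossed Γ where
  obj X := X
  map s := gammaHom g s
  map_id X := gammaHom_id hcom g X
  map_comp {X Y Z} s t := by
    ext
    have := hcom g⁻¹
    rw [gammaHom_hom, Crossed.comp_hom, Crossed.comp_hom, gammaHom_hom, gammaHom_hom,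
      ← comp_whiskerRight_assoc, IsComonHom.hom_comul, MonoidalCategory.tensorHom_def,
      comp_whiskerRight, comp_whiskerRight]
    simp only [MonoidalCategory.whiskerLeft_comp, Category.assoc]
    rw [whisker_exchange_assoc, whisker_exchange_assoc, ← associator_naturality_left_assoc,
      ← associator_naturality_middle_assoc]

variable [BraidedCategory C] [IsCommComonObj Γ]

theorem gammaHom_tensor (hcom : ∀ g : algAut Γ, IsComonHom g.1.hom) (g : algAut Γ)
    {X Y Z W : Crossed Γ} (s : X ⟶ Y) (t : Z ⟶ W) :
    gammaHom g (s ⊗ₘ t) = gammaHom g s ⊗ₘ gammaHom g t := by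
  ext
  have := hcom g⁻¹
  rw [gammaHom_hom, Crossed.tensorHom_hom, Crossed.tensorHom_hom, gammaHom_hom, gammaHom_hom,
    ← tensorHom_comp_tensorHom, Crossed.split, Category.assoc, Category.assoc,
    ← tensorμ_natural_left_assoc, ← comp_whiskerRight_assoc, ← IsComonHom.hom_comul]
  simp only [comp_whiskerRight, Category.assoc]
  rfl

/-- The action on `Crossed Γ` of the automorphisms of `Γ`. -/
def gammaAction : StrictAction (algAut Γ) (Crossed Γ) where
  functor g := gammaFunctor hcom g
  functor_one := CategoryTheory.Functor.hext (fun _ => rfl) (fun _ _ s => heq_of_eq (gammaHom_one s))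
  functor_mul g h := CategoryTheory.Functor.hext (fun _ => rfl) (fun _ _ s =>
    heq_of_eq (gammaHom_mul g h s))
  strict g :=
    { obj_unit := rfl
      obj_tensor := fun _ _ => rfl
      map_tensor := fun s t => heq_of_eq (gammaHom_tensor hcom g s t)
      map_associator := fun _ _ _ => heq_of_eq (gammaHom_incl hcom g _)
      map_leftUnitor := fun _ => heq_of_eq (gammaHom_incl hcom g _)
      map_rightUnitor := fun _ => heq_of_eq (gammaHom_incl hcom g _) }

/-- The functor from `C` to the fixed points of `Crossed Γ`. -/
def inclFixed : C ⥤ (gammaAction hcom).Fixed where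
  obj X := ⟨Crossed.of X, fun _ => rfl⟩
  map s := ⟨(Crossed.incl Γ).map s, fun g => heq_of_eq (gammaHom_incl hcom g s)⟩
  map_id X := StrictAction.Fixed.hom_ext ((Crossed.incl Γ).map_id X)
  map_comp s t := StrictAction.Fixed.hom_ext ((Crossed.incl Γ).map_comp s t)

theorem isStrictMonoidalFunctor_inclFixed : IsStrictMonoidalFunctor (inclFixed hcom) where
  obj_unit := rfl
  obj_tensor _ _ := rfl
  map_tensor f g := heq_of_eq (StrictAction.Fixed.hom_ext (Crossed.incl_tensor f g).symm)
  map_associator _ _ _ := HEq.rfl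
  map_leftUnitor _ := HEq.rfl
  map_rightUnitor _ := HEq.rfl

theorem inclFixed_bijective : Function.Bijective (inclFixed hcom).obj :=
  ⟨fun _ _ h => congrArg (fun Z : (gammaAction hcom).Fixed => Z.obj.obj) h,
    fun Z => ⟨Z.obj.obj, rfl⟩⟩

/-- The functor from `C` to the fixed points of the idempotent completion of `Crossed Γ`. -/
def inclKaroubiFixed : C ⥤ (gammaAction hcom).karoubi.Fixed where
  obj X := ⟨(toKaroubi _).obj (Crossed.of X), fun g => Karoubi.ext rfl
    (comp_eqToHom_of_heq rfl rfl (heq_of_eq (gammaHom_id hcom g _)))⟩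
  map s := ⟨(toKaroubi _).map ((Crossed.incl Γ).map s), fun g => KaroubiTensor.heq_of_f
    (Karoubi.ext rfl (comp_eqToHom_of_heq rfl rfl (heq_of_eq (gammaHom_id hcom g _))))
    (Karoubi.ext rfl (comp_eqToHom_of_heq rfl rfl (heq_of_eq (gammaHom_id hcom g _))))
    (heq_of_eq (gammaHom_incl hcom g s))⟩
  map_id X := StrictAction.Fixed.hom_ext ((Crossed.incl Γ ⋙ toKaroubi _).map_id X)
  map_comp s t := StrictAction.Fixed.hom_ext ((Crossed.incl Γ ⋙ toKaroubi _).map_comp s t)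

theorem IsStrictMonoidalFunctor.comp {A B D : Type*} [Category* A] [Category* B] [Category* D]
    [MonoidalCategory A] [MonoidalCategory B] [MonoidalCategory D] {J : A ⥤ B} {L : B ⥤ D}
    (hJ : IsStrictMonoidalFunctor J) (hL : IsStrictMonoidalFunctor L) :
    IsStrictMonoidalFunctor (J ⋙ L) where
  obj_unit := by rw [Functor.comp_obj, hJ.obj_unit, hL.obj_unit]
  obj_tensor X Y := by
    rw [Functor.comp_obj, hJ.obj_tensor, hL.obj_tensor]
    rfl
  map_tensor {X Y X' Y'} f g := by
    refine HEq.trans ?_ (hL.map_tensor (J.map f) (J.map g))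
    have h := hJ.map_tensor f g
    have h₁ := hJ.obj_tensor X X'
    have h₂ := hJ.obj_tensor Y Y'
    rw [Functor.comp_map]
    congr 1
  map_associator X Y Z := by
    refine HEq.trans ?_ (hL.map_associator (J.obj X) (J.obj Y) (J.obj Z))
    rw [Functor.comp_map]
    have h := hJ.map_associator X Y Z
    congr 1 <;> simp only [hJ.obj_tensor]
  map_leftUnitor X := by
    refine HEq.trans ?_ (hL.map_leftUnitor (J.obj X))
    rw [Functor.comp_map]
    have h := hJ.map_leftUnitor X
    congr 1
    simp only [hJ.obj_tensor, hJ.obj_unit]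
  map_rightUnitor X := by
    refine HEq.trans ?_ (hL.map_rightUnitor (J.obj X))
    rw [Functor.comp_map]
    have h := hJ.map_rightUnitor X
    congr 1
    simp only [hJ.obj_tensor, hJ.obj_unit]

theorem isStrictMonoidalFunctor_inclKaroubi :
    IsStrictMonoidalFunctor (Crossed.incl Γ ⋙ toKaroubi (Crossed Γ)) :=
  (Crossed.isStrictMonoidalFunctor_incl Γ).comp (isStrictMonoidalFunctor_toKaroubi _)

theorem isStrictMonoidalFunctor_inclKaroubiFixed :
    IsStrictMonoidalFunctor (inclKaroubiFixed hcom) := by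
  have h := isStrictMonoidalFunctor_inclKaroubi (Γ := Γ)
  have ht : ∀ X Y : C, (inclKaroubiFixed hcom).obj (X ⊗ Y) =
      (inclKaroubiFixed hcom).obj X ⊗ (inclKaroubiFixed hcom).obj Y := fun X Y =>
    StrictAction.Fixed.obj_ext (h.obj_tensor X Y)
  refine ⟨rfl, ht, fun f g => ?_, fun X Y Z => ?_, fun X => ?_, fun X => ?_⟩
  · exact StrictAction.Fixed.heq_of_hom (ht _ _) (ht _ _) (h.map_tensor f g)
  · exact StrictAction.Fixed.heq_of_hom (by rw [ht, ht]) (by rw [ht, ht]) (h.map_associator X Y Z)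
  · exact StrictAction.Fixed.heq_of_hom (by rw [ht]; rfl) rfl (h.map_leftUnitor X)
  · exact StrictAction.Fixed.heq_of_hom (by rw [ht]; rfl) rfl (h.map_rightUnitor X)

end action

/-! ### Fixed points of the action -/

section fixed

variable {F : Type u} [Field F] {G : Type*} [Group G] [Fintype G] {C : Type v} [Category.{w} C]
  [Preadditive C] [Linear F C] [MonoidalCategory C] [MonoidalPreadditive C] [MonoidalLinear F C]
  {Γ : C} [MonObj Γ] [ComonObj Γ] {n : F} {r : G → (Γ ⟶ Γ)}

theorem IsTranslations.isIso (hr : IsTranslations Γ n r) (k : G) : IsIso (r k) :=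
  ⟨r k⁻¹, by rw [← hr.mul, inv_mul_cancel, hr.one], by rw [← hr.mul, mul_inv_cancel, hr.one]⟩

/-- The elements of `algAut` are only required to respect `m` and `η`, but `γ_g` must respect `Δ`
and `ε`, which define composition and identities. This holds because every algebra automorphism is a
translation. -/
theorem IsTranslations.isComonHom (hr : IsTranslations Γ n r) (g : algAut Γ) :
    IsComonHom g.1.hom := by
  obtain ⟨k, hk⟩ := hr.exists_eq g.1.hom g.2
  exact ⟨by rw [hk, hr.counit], by rw [hk, hr.comul]⟩

/-- The automorphism given by a translation. -/
def IsTranslations.toAut (hr : IsTranslations Γ n r) : G →* algAut Γ where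
  toFun k := ⟨⟨r k, r k⁻¹, by rw [← hr.mul, inv_mul_cancel, hr.one],
    by rw [← hr.mul, mul_inv_cancel, hr.one]⟩, hr.isMonHom k⟩
  map_one' := Subtype.ext (Iso.ext hr.one)
  map_mul' k l := Subtype.ext (Iso.ext (hr.mul k l))

theorem IsTranslations.toAut_bijective (hr : IsTranslations Γ n r) :
    Function.Bijective hr.toAut := by
  refine ⟨fun k l h => hr.injective (congrArg (fun g : algAut Γ => g.1.hom) h), fun g => ?_⟩
  obtain ⟨k, hk⟩ := hr.exists_eq g.1.hom g.2
  exact ⟨k, Subtype.ext (Iso.ext hk.symm)⟩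

/-- Summing the invariance of `s` over all translations gives `n s` on one side and, by `sum`, `n`
times `s ∘ (ηε ⊗ 1)` on the other. -/
theorem IsTranslations.eq_incl_of_fixed (hr : IsTranslations Γ n r) (hn : n ≠ 0)
    {X Y : Crossed Γ} (s : X ⟶ Y) (hs : ∀ g : algAut Γ, gammaHom g s = s) :
    s = (Crossed.incl Γ).map ((λ_ X.obj).inv ≫ η[Γ] ▷ X.obj ≫ s.hom) := by
  have h (k : G) : r k ▷ X.obj ≫ s.hom = s.hom := by
    have := congrArg Crossed.Hom.hom (hs (hr.toAut k)⁻¹)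
    rw [gammaHom_hom, inv_inv] at this
    exact this
  have h' : (∑ k, r k) ▷ X.obj ≫ s.hom = n • s.hom := by
    rw [sum_whiskerRight, Preadditive.sum_comp, Finset.sum_congr rfl fun k _ => h k,
      Finset.sum_const, Finset.card_univ, hr.degree, Nat.cast_smul_eq_nsmul]
  rw [hr.sum, MonoidalLinear.smul_whiskerRight, Linear.smul_comp] at h'
  have h'' := congrArg (n⁻¹ • ·) h'
  simp only [smul_smul, inv_mul_cancel₀ hn, one_smul] at h''
  ext
  rw [Crossed.incl_map_hom]
  conv_lhs => rw [← h'']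
  simp

theorem IsGaloisAlgebra.incl_injective (hΓ : IsGaloisAlgebra Γ n) {X Y : C} {s t : X ⟶ Y}
    (h : (Crossed.incl Γ).map s = (Crossed.incl Γ).map t) : s = t := by
  have h' := congrArg (fun u => (λ_ X).inv ≫ η[Γ] ▷ X ≫ Crossed.Hom.hom u) h
  simp only [Crossed.incl_map_hom] at h'
  have key : ∀ s : X ⟶ Y, (λ_ X).inv ≫ η[Γ] ▷ X ≫ ε[Γ] ▷ X ≫ (λ_ X).hom ≫ s = s := fun s => by
    rw [← comp_whiskerRight_assoc, hΓ.one_counit]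
    simp
  exact (key s).symm.trans (h'.trans (key t))

variable [BraidedCategory C] [IsCommComonObj Γ]

theorem IsTranslations.inclFixed_full (hr : IsTranslations Γ n r) (hn : n ≠ 0) :
    (inclFixed hr.isComonHom).Full where
  map_surjective s := ⟨_, StrictAction.Fixed.hom_ext
    (hr.eq_incl_of_fixed hn s.hom fun g => eq_of_heq (s.fixed g)).symm⟩

theorem IsTranslations.inclFixed_faithful (hr : IsTranslations Γ n r)
    (hΓ : IsGaloisAlgebra Γ n) : (inclFixed hr.isComonHom).Faithful where
  map_injective h := hΓ.incl_injective (congrArg StrictAction.Fixed.Hom.hom h)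

theorem karoubi_heq_f {D : Type*} [Category* D] {P Q P' Q' : Karoubi D} (hP : P = P')
    (hQ : Q = Q') {f : P ⟶ Q} {f' : P' ⟶ Q'} (h : HEq f f') : HEq f.f f'.f := by
  subst hP hQ
  rw [eq_of_heq h]

/-- Full faithfulness is that of the fixed morphisms. An object `(X, p)` is fixed only if `p` is, so
`p` comes from an idempotent `p₀` of `C`. The image of `p₀` in `C` is the required preimage up to
isomorphism. -/
theorem IsTranslations.inclKaroubiFixed_isEquivalence (hr : IsTranslations Γ n r)
    (hΓ : IsGaloisAlgebra Γ n) [IsIdempotentComplete C] :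
    (inclKaroubiFixed hr.isComonHom).IsEquivalence where
  faithful := ⟨fun h => hΓ.incl_injective (congrArg (fun u => u.hom.f) h)⟩
  full := ⟨fun {X Y} s => by
    have h := hr.eq_incl_of_fixed hΓ.ne_zero s.hom.f fun g => eq_of_heq
      (karoubi_heq_f (((inclKaroubiFixed hr.isComonHom).obj X).fixed g)
        (((inclKaroubiFixed hr.isComonHom).obj Y).fixed g) (s.fixed g))
    exact ⟨_, StrictAction.Fixed.hom_ext (Karoubi.hom_ext _ _ h.symm)⟩⟩
  essSurj := ⟨fun Z => by
    have hp : ∀ g, gammaHom g Z.obj.p = Z.obj.p := fun g => by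
      have h : ∀ {P Q : Karoubi (Crossed Γ)}, P = Q → HEq P.p Q.p := fun h => by rw [h]
      exact eq_of_heq (h (Z.fixed g))
    have hZ := hr.eq_incl_of_fixed hΓ.ne_zero Z.obj.p hp
    generalize (λ_ Z.obj.X.obj).inv ≫ η[Γ] ▷ Z.obj.X.obj ≫ Crossed.Hom.hom Z.obj.p = p₀ at hZ
    have hp₀ : p₀ ≫ p₀ = p₀ := hΓ.incl_injective (by
      refine ((Crossed.incl Γ).map_comp p₀ p₀).trans ?_
      have h := Z.obj.idem
      rw [hZ] at h
      exact h)
    obtain ⟨Y, i, e, hie, hei⟩ := IsIdempotentComplete.idempotents_split _ p₀ hp₀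
    refine ⟨Y, ⟨StrictAction.Fixed.isoMk ⟨⟨(Crossed.incl Γ).map i, ?_⟩,
      ⟨(Crossed.incl Γ).map e, ?_⟩, ?_, ?_⟩ fun g => ?_⟩⟩
    · change 𝟙 _ ≫ (Crossed.incl Γ).map i ≫ Z.obj.p = (Crossed.incl Γ).map i
      rw [hZ, Category.id_comp]
      refine ((Crossed.incl Γ).map_comp i p₀).symm.trans (congrArg _ ?_)
      rw [← hei, reassoc_of% hie]
    · change Z.obj.p ≫ (Crossed.incl Γ).map e ≫ 𝟙 _ = (Crossed.incl Γ).map e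
      rw [hZ]
      refine (congrArg (_ ≫ ·) (Category.comp_id _)).trans
        (((Crossed.incl Γ).map_comp p₀ e).symm.trans (congrArg _ ?_))
      rw [← hei, Category.assoc, hie, Category.comp_id]
    · ext1
      refine ((Crossed.incl Γ).map_comp i e).symm.trans ?_
      rw [hie, CategoryTheory.Functor.map_id]
      rfl
    · ext1
      refine ((Crossed.incl Γ).map_comp e i).symm.trans ?_
      rw [hei]
      exact hZ.symm
    · exact KaroubiTensor.heq_of_f (((inclKaroubiFixed hr.isComonHom).obj Y).fixed g) (Z.fixed g)
        (heq_of_eq (gammaHom_incl hr.isComonHom g i))⟩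

end fixed

end

section

open MonObj ComonObj

/-! ### Star operations -/

namespace StarOperation

section basic

variable {F : Type u} [Field F] {φ : F ≃+* ℂ} {D : Type v} [Category.{w} D] [Preadditive D]
  [Linear F D] [MonoidalCategory D] (T : StarOperation φ D)

theorem star_id (X : D) : T.star (𝟙 X) = 𝟙 X := by
  have h := T.star_comp (T.star (𝟙 X)) (𝟙 X)
  rw [Category.comp_id, T.star_star, Category.comp_id] at h
  exact h.symm

theorem star_whiskerLeft (X : D) {Y Z : D} (f : Y ⟶ Z) : T.star (X ◁ f) = X ◁ T.star f := by
  rw [← id_tensorHom, T.star_tensor, T.star_id, id_tensorHom]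

theorem star_whiskerRight {Y Z : D} (f : Y ⟶ Z) (X : D) : T.star (f ▷ X) = T.star f ▷ X := by
  rw [← tensorHom_id, T.star_tensor, T.star_id, tensorHom_id]

theorem star_eqToHom {X Y : D} (h : X = Y) : T.star (eqToHom h) = eqToHom h.symm := by
  subst h
  exact T.star_id X

theorem star_zero (X Y : D) : T.star (0 : X ⟶ Y) = 0 := by
  have h := T.star_add (0 : X ⟶ Y) 0
  rw [add_zero] at h
  exact left_eq_add.mp h

theorem star_injective {X Y : D} {f g : X ⟶ Y} (h : T.star f = T.star g) : f = g := by
  rw [← T.star_star f, h, T.star_star]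

variable [IsStrictMonoidal D]

theorem star_associator (X Y Z : D) : T.star (α_ X Y Z).hom = (α_ X Y Z).inv := by
  rw [IsStrictMonoidal.associator_eq, star_eqToHom, ← cancel_mono (α_ X Y Z).hom, Iso.inv_hom_id,
    IsStrictMonoidal.associator_eq, eqToHom_trans, eqToHom_refl]

theorem star_associator_inv (X Y Z : D) : T.star (α_ X Y Z).inv = (α_ X Y Z).hom := by
  rw [← T.star_associator, T.star_star]

theorem star_leftUnitor (X : D) : T.star (λ_ X).hom = (λ_ X).inv := by
  rw [IsStrictMonoidal.leftUnitor_eq, star_eqToHom, ← cancel_mono (λ_ X).hom, Iso.inv_hom_id,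
    IsStrictMonoidal.leftUnitor_eq, eqToHom_trans, eqToHom_refl]

theorem star_leftUnitor_inv (X : D) : T.star (λ_ X).inv = (λ_ X).hom := by
  rw [← T.star_leftUnitor, T.star_star]

end basic

/-! ### The star operation of the idempotent completion -/

section karoubi

variable {F : Type u} [Field F] {φ : F ≃+* ℂ} {D : Type v} [Category.{w} D] [Preadditive D]
  [Linear F D] [MonoidalCategory D] (T : StarOperation φ D)

/-- From `s = p ∘ s` one gets `s* ∘ s = s* ∘ p* ∘ s`, so positivity applies. Consequently `p*` may
be cancelled on the image of `p`. -/
theorem eq_zero_of_comp_star {X Y : D} {p : X ⟶ X} {s : Y ⟶ X}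
    (hs : s ≫ p = s) (h : s ≫ T.star p = 0) : s = 0 := by
  apply T.positive
  have h' : s ≫ T.star s = (s ≫ T.star p) ≫ T.star s := by
    conv_lhs => rw [← hs, T.star_comp]
    rw [hs, Category.assoc]
  rw [h', h, zero_comp]

/-- The inverse of `p* ∘ p`, from the image of `p` to the image of `p*`. -/
structure IsGramInverse {X : D} (p k : X ⟶ X) : Prop where
  eq : T.star p ≫ k ≫ p = k
  left : p ≫ T.star p ≫ k = p
  right : k ≫ p ≫ T.star p = T.star p

variable {T}

theorem IsGramInverse.unique {X : D} {p k k' : X ⟶ X} (h : IsGramInverse T p k)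
    (h' : IsGramInverse T p k') (hp : p ≫ p = p) : k = k' := by
  have hp' : T.star p ≫ T.star p = T.star p := by rw [← T.star_comp, hp]
  calc k = T.star p ≫ k := by
        conv_rhs => rw [← h.eq, reassoc_of% hp']
        rw [h.eq]
    _ = (k' ≫ p ≫ T.star p) ≫ k := by rw [h'.right]
    _ = k' ≫ p := by simp only [Category.assoc, h.left]
    _ = k' := by
        conv_lhs => rw [← h'.eq, Category.assoc, Category.assoc, hp]
        rw [h'.eq]

theorem IsGramInverse.star {X : D} {p k : X ⟶ X} (h : IsGramInverse T p k) :
    IsGramInverse T p (T.star k) where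
  eq := by
    conv_rhs => rw [← h.eq]
    simp only [T.star_comp, T.star_star, Category.assoc]
  left := by
    have := congrArg T.star h.right
    simpa only [T.star_comp, T.star_star, Category.assoc] using this
  right := by
    have := congrArg T.star h.left
    simpa only [T.star_comp, T.star_star, Category.assoc] using this

theorem IsGramInverse.tensor {X Y : D} {p k : X ⟶ X} {q l : Y ⟶ Y} (h : IsGramInverse T p k)
    (h' : IsGramInverse T q l) : IsGramInverse T (p ⊗ₘ q) (k ⊗ₘ l) where
  eq := by
    rw [T.star_tensor, tensorHom_comp_tensorHom, tensorHom_comp_tensorHom, h.eq, h'.eq]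
  left := by
    rw [T.star_tensor, tensorHom_comp_tensorHom, tensorHom_comp_tensorHom, h.left, h'.left]
  right := by
    rw [T.star_tensor, tensorHom_comp_tensorHom, tensorHom_comp_tensorHom, h.right, h'.right]

theorem isGramInverse_id (X : D) : IsGramInverse T (𝟙 X) (𝟙 X) :=
  ⟨by simp [T.star_id], by simp [T.star_id], by simp [T.star_id]⟩

variable (T)

/-- A quasi-inverse of `p* ∘ p` satisfies the required identities only after a further composition
with `p` or `p*`. Positivity removes that extra factor, by `eq_zero_of_comp_star`. -/
theorem exists_isGramInverse {X : D} {p : X ⟶ X} (hp : p ≫ p = p)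
    (hreg : ∀ f : X ⟶ X, IsRegularHom f) : ∃ k, IsGramInverse T p k := by
  obtain ⟨g, hg⟩ := hreg (p ≫ T.star p)
  have hp' : T.star p ≫ T.star p = T.star p := by rw [← T.star_comp, hp]
  have h₁ : p ≫ T.star p ≫ g ≫ p = p := by
    rw [← sub_eq_zero]
    refine T.eq_zero_of_comp_star (p := p) ?_ ?_
    · simp only [Preadditive.sub_comp, Category.assoc, hp]
    · rw [Preadditive.sub_comp, sub_eq_zero]
      simpa only [Category.assoc] using hg
  have h₂ : T.star p ≫ g ≫ p ≫ T.star p = T.star p := by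
    rw [← sub_eq_zero]
    apply T.star_injective
    rw [T.star_zero]
    refine T.eq_zero_of_comp_star (p := p) ?_ ?_
    · have h := T.star_comp (T.star p) (T.star p ≫ g ≫ p ≫ T.star p - T.star p)
      rw [Preadditive.comp_sub, reassoc_of% hp', hp', T.star_star] at h
      exact h.symm
    · rw [← T.star_comp, Preadditive.comp_sub, sub_eq_zero.mpr, T.star_zero]
      simpa only [Category.assoc] using hg
  exact ⟨T.star p ≫ g ≫ p, by simp only [Category.assoc, hp, reassoc_of% hp'],
    by rw [reassoc_of% hp', h₁], by simp only [Category.assoc, reassoc_of% hp, h₂]⟩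

/-- The star operation of the idempotent completion. -/
def karoubi (hreg : ∀ {X Y : D} (f : X ⟶ Y), IsRegularHom f) : StarOperation φ (Karoubi D) :=
  have hk : ∀ P : Karoubi D, ∃ k, IsGramInverse T P.p k := fun P =>
    T.exists_isGramInverse P.idem hreg
  let k := fun P : Karoubi D => (hk P).choose
  have k_spec : ∀ P : Karoubi D, IsGramInverse T P.p (k P) := fun P => (hk P).choose_spec
  -- Gram inverses are unique, so `k P` equals its own adjoint. Uniqueness also gives
  -- multiplicativity under tensor products below.
  have k_star : ∀ P : Karoubi D, T.star (k P) = k P := fun P =>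
    (k_spec P).star.unique (k_spec P) P.idem
  have star_p : ∀ {P Q : Karoubi D} (f : P ⟶ Q), T.star Q.p ≫ T.star f.f = T.star f.f :=
    fun {P Q} f => by rw [← T.star_comp, Karoubi.comp_p]
  have p_star : ∀ {P Q : Karoubi D} (f : P ⟶ Q), T.star f.f ≫ T.star P.p = T.star f.f :=
    fun {P Q} f => by rw [← T.star_comp, Karoubi.p_comp]
  -- The adjoint of `f` for the Hermitian forms `p* ∘ p`: the form of `Q`, then the adjoint in `D`,
  -- then the inverse of the form of `P`.
  { star := fun {P Q} f => ⟨(Q.p ≫ T.star Q.p) ≫ T.star f.f ≫ k P, by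
      have h := (k_spec P).eq
      have h' : k P ≫ P.p = k P := by
        rw [← h, Category.assoc, Category.assoc, P.idem]
      simp only [Category.assoc, h', Karoubi.idem_assoc]⟩
    star_star := fun {P Q} f => by
      ext
      change (P.p ≫ T.star P.p) ≫ T.star ((Q.p ≫ T.star Q.p) ≫ T.star f.f ≫ k P) ≫ k Q = f.f
      have h₁ := (k_spec P).left
      have h₂ := (k_spec Q).left
      simp only [T.star_comp, T.star_star, k_star, Category.assoc]
      rw [reassoc_of% h₁, h₂, Karoubi.comp_p, Karoubi.p_comp]
    star_comp := fun {P Q R} f g => by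
      ext
      change (R.p ≫ T.star R.p) ≫ T.star (f.f ≫ g.f) ≫ k P =
        ((R.p ≫ T.star R.p) ≫ T.star g.f ≫ k Q) ≫ (Q.p ≫ T.star Q.p) ≫ T.star f.f ≫ k P
      have h := (k_spec Q).right
      simp only [Category.assoc, T.star_comp]
      rw [reassoc_of% h, reassoc_of% (star_p f)]
    star_tensor := fun {P Q P' Q'} f g => by
      ext
      change ((Q.p ⊗ₘ Q'.p) ≫ T.star (Q.p ⊗ₘ Q'.p)) ≫ T.star (f.f ⊗ₘ g.f) ≫ k (P ⊗ P') =
        ((Q.p ≫ T.star Q.p) ≫ T.star f.f ≫ k P) ⊗ₘ ((Q'.p ≫ T.star Q'.p) ≫ T.star g.f ≫ k P')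
      have h : k (P ⊗ P') = k P ⊗ₘ k P' :=
        (k_spec (P ⊗ P')).unique ((k_spec P).tensor (k_spec P')) (P ⊗ P').idem
      rw [h, T.star_tensor, T.star_tensor, tensorHom_comp_tensorHom]
      erw [tensorHom_comp_tensorHom, tensorHom_comp_tensorHom]
    star_add := fun {P Q} f g => by
      ext
      change (Q.p ≫ T.star Q.p) ≫ T.star (f.f + g.f) ≫ k P = (Q.p ≫ T.star Q.p) ≫ T.star f.f ≫ k P +
        (Q.p ≫ T.star Q.p) ≫ T.star g.f ≫ k P
      rw [T.star_add, Preadditive.add_comp, Preadditive.comp_add]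
    star_smul := fun {P Q} a f => by
      ext
      change (Q.p ≫ T.star Q.p) ≫ T.star (a • f.f) ≫ k P =
        _ • ((Q.p ≫ T.star Q.p) ≫ T.star f.f ≫ k P)
      rw [T.star_smul, Linear.smul_comp, Linear.comp_smul]
    positive := fun {P Q} f h => by
      have h' := congrArg Karoubi.Hom.f h
      change f.f ≫ (Q.p ≫ T.star Q.p) ≫ T.star f.f ≫ k P = 0 at h'
      have h₁ := (k_spec P).right
      have h₂ := congrArg (· ≫ P.p ≫ T.star P.p) h'
      simp only [Category.assoc, h₁, zero_comp, p_star, star_p, Karoubi.comp_p_assoc] at h₂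
      ext
      exact T.positive _ h₂ }

theorem karoubi_toKaroubi (hreg : ∀ {X Y : D} (f : X ⟶ Y), IsRegularHom f) {X Y : D}
    (s : X ⟶ Y) : (T.karoubi hreg).star ((toKaroubi D).map s) = (toKaroubi D).map (T.star s) := by
  ext
  have hk := T.exists_isGramInverse (show 𝟙 X ≫ 𝟙 X = 𝟙 X from Category.comp_id _) hreg
  change (𝟙 Y ≫ T.star (𝟙 Y)) ≫ T.star s ≫ hk.choose = T.star s
  have h := hk.choose_spec.unique (isGramInverse_id X) (Category.comp_id _)
  rw [h, T.star_id]
  simp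

end karoubi

end StarOperation

end

section

open MonObj ComonObj

/-! ### Unitarity of the braiding with `Γ` -/

section unitary

variable {F : Type u} [Field F] {φ : F ≃+* ℂ} {C : Type v} [Category.{w} C] [Preadditive C]
  [Linear F C] [MonoidalCategory C] [MonoidalPreadditive C] [MonoidalLinear F C]
  [IsStrictMonoidal C] [BraidedCategory C] (T : StarOperation φ C)

namespace StarOperation

/-- The positive endomorphism `c* ∘ c` of `W ⊗ X`. -/
def gram (W X : C) : W ⊗ X ⟶ W ⊗ X := (β_ W X).hom ≫ T.star (β_ W X).hom

/-- Naturality of the braiding in `u`, combined with the adjoint of its naturality in `u*`. -/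
theorem gram_natural {W W' : C} (u : W ⟶ W') (X : C) :
    u ▷ X ≫ T.gram W' X = T.gram W X ≫ u ▷ X := by
  have h := congrArg T.star (BraidedCategory.braiding_naturality_left (T.star u) X)
  simp only [T.star_comp, T.star_whiskerLeft, T.star_whiskerRight, T.star_star] at h
  rw [gram, gram, BraidedCategory.braiding_naturality_left_assoc, Category.assoc, h]

theorem gram_tensor (V W X : C) : T.gram (V ⊗ W) X = (α_ _ _ _).hom ≫ V ◁ (β_ W X).hom ≫
    (α_ _ _ _).inv ≫ T.gram V X ▷ W ≫ (α_ _ _ _).hom ≫ V ◁ T.star (β_ W X).hom ≫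
      (α_ _ _ _).inv := by
  rw [gram, BraidedCategory.braiding_tensor_left_hom]
  simp only [T.star_comp, T.star_whiskerLeft, T.star_whiskerRight, T.star_associator,
    T.star_associator_inv, gram, comp_whiskerRight, Category.assoc, Iso.hom_inv_id_assoc]

end StarOperation

variable {G : Type*} [Group G] [Fintype G] {Γ : C} [MonObj Γ] [ComonObj Γ] {n : F}
  {r : G → (Γ ⟶ Γ)}

theorem IsTranslations.averageMap_invariant (hr : IsTranslations Γ n r) {X Y : C}
    {h : Γ ⊗ X ⟶ Γ ⊗ Y} (hh : ∀ k, r k ▷ X ≫ h = h ≫ r k ▷ Y) (k : G) :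
    r k ▷ X ≫ averageMap h = averageMap h ≫ r k ▷ Y := by
  have := hr.isMonHom k
  have h₁ : r k ▷ X ≫ Δ[Γ] ▷ X ≫ (α_ _ _ _).hom =
      Δ[Γ] ▷ X ≫ (α_ _ _ _).hom ≫ r k ▷ (Γ ⊗ X) ≫ Γ ◁ (r k ▷ X) := by
    rw [← comp_whiskerRight_assoc, hr.comul, MonoidalCategory.tensorHom_def]
    simp
  have h₂ : r k ▷ (Γ ⊗ Y) ≫ Γ ◁ (r k ▷ Y) ≫ (α_ _ _ _).inv ≫ μ[Γ] ▷ Y =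
      (α_ _ _ _).inv ≫ μ[Γ] ▷ Y ≫ r k ▷ Y := by
    rw [← comp_whiskerRight, IsMonHom.mul_hom, MonoidalCategory.tensorHom_def]
    simp
  simp only [averageMap, Category.assoc]
  rw [reassoc_of% h₁, ← h₂, ← MonoidalCategory.whiskerLeft_comp_assoc, hh,
    MonoidalCategory.whiskerLeft_comp_assoc, whisker_exchange_assoc]

/-- The average of an invariant endomorphism is a scalar. -/
theorem IsTranslations.averageMap_eq (hr : IsTranslations Γ n r) (hΓ : IsGaloisAlgebra Γ n)
    {X : C} {h : Γ ⊗ X ⟶ Γ ⊗ X} (hh : ∀ k, r k ▷ X ≫ h = h ≫ r k ▷ X) :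
    averageMap h = Γ ◁ ((λ_ X).inv ≫ η[Γ] ▷ X ≫ averageMap h ≫ ε[Γ] ▷ X ≫ (λ_ X).hom) := by
  -- The average is colinear, hence a morphism of the crossed product, and it is fixed by all
  -- translations. By `eq_incl_of_fixed` it comes from `C`.
  let s : Crossed.of (Γ := Γ) X ⟶ Crossed.of X := ⟨averageMap h ≫ ε[Γ] ▷ X ≫ (λ_ X).hom⟩
  have hs := congrArg Crossed.Hom.hom (hr.eq_incl_of_fixed hΓ.ne_zero s fun g => by
    obtain ⟨k, hk⟩ := hr.exists_eq (g⁻¹ : algAut Γ).1.hom (g⁻¹ : algAut Γ).2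
    ext
    rw [gammaHom_hom, hk]
    change r k ▷ X ≫ averageMap h ≫ ε[Γ] ▷ X ≫ (λ_ X).hom = _
    rw [reassoc_of% (hr.averageMap_invariant hh k), ← comp_whiskerRight_assoc, hr.counit])
  have hq := cofreeMap_of_colinear (hΓ.averageMap_colinear h)
  rw [← hq]
  change averageMap h ≫ ε[Γ] ▷ X ≫ (λ_ X).hom = ε[Γ] ▷ X ≫ (λ_ X).hom ≫ (λ_ X).inv ≫ η[Γ] ▷ X ≫
    averageMap h ≫ ε[Γ] ▷ X ≫ (λ_ X).hom at hs
  conv_lhs => rw [hs]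
  rw [hq]
  have key := Crossed.counit_comp (Γ := Γ)
    ((λ_ X).inv ≫ η[Γ] ▷ X ≫ averageMap h ≫ ε[Γ] ▷ X ≫ (λ_ X).hom) (𝟙 _)
  simpa [cofreeMap] using key

/-- The Gram endomorphism of `Γ ⊗ Γ` and `X` is traced over the first `Γ` in two ways. By
`gram_tensor` the result is the left side. By the Galois relation the identity of `Γ ⊗ Γ` is a sum
of maps through `Γ`, where naturality reduces to the Gram endomorphism of `Γ`; each summand yields
its average. -/
theorem IsTranslations.braiding_average (hr : IsTranslations Γ n r) (hΓ : IsGaloisAlgebra Γ n)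
    (X : C) : (β_ Γ X).hom ≫ ((λ_ X).inv ≫ η[Γ] ▷ X ≫ averageMap (T.gram Γ X) ≫ ε[Γ] ▷ X ≫
      (λ_ X).hom) ▷ Γ ≫ T.star (β_ Γ X).hom = averageMap (T.gram Γ X) := by
  have hinv : ∀ k, r k ▷ X ≫ T.gram Γ X = T.gram Γ X ≫ r k ▷ X := fun k => T.gram_natural _ _
  -- The partial trace over the first factor, closed by the Frobenius pairing.
  let E (u : Γ ⊗ Γ ⊗ X ⟶ Γ ⊗ Γ ⊗ X) : Γ ⊗ X ⟶ Γ ⊗ X :=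
    (λ_ (Γ ⊗ X)).inv ≫ (η[Γ] ≫ Δ[Γ]) ▷ (Γ ⊗ X) ≫ (α_ _ _ _).hom ≫ Γ ◁ u ≫ (α_ _ _ _).inv ≫
      (μ[Γ] ≫ ε[Γ]) ▷ (Γ ⊗ X) ≫ (λ_ (Γ ⊗ X)).hom
  let u₀ := (α_ _ _ _).inv ≫ T.gram (Γ ⊗ Γ) X ≫ (α_ _ _ _).hom
  have h₁ : (β_ Γ X).hom ≫ ((λ_ X).inv ≫ η[Γ] ▷ X ≫ averageMap (T.gram Γ X) ≫ ε[Γ] ▷ X ≫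
      (λ_ X).hom) ▷ Γ ≫ T.star (β_ Γ X).hom = E u₀ := by
    simp only [E, u₀, T.gram_tensor, averageMap]
    calc _ = (β_ Γ X).hom ⊗≫ (η[Γ] ≫ Δ[Γ]) ▷ (X ⊗ Γ) ⊗≫ Γ ◁ T.gram Γ X ▷ Γ ⊗≫
          ((μ[Γ] ≫ ε[Γ]) ▷ (X ⊗ Γ) ≫ _ ◁ T.star (β_ Γ X).hom) ⊗≫ 𝟙 _ := by monoidal
      _ = 𝟙 _ ⊗≫ (𝟙_ C ◁ (β_ Γ X).hom ≫ (η[Γ] ≫ Δ[Γ]) ▷ (X ⊗ Γ)) ⊗≫ Γ ◁ T.gram Γ X ▷ Γ ⊗≫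
          (Γ ⊗ Γ) ◁ T.star (β_ Γ X).hom ⊗≫ (μ[Γ] ≫ ε[Γ]) ▷ (Γ ⊗ X) ⊗≫ 𝟙 _ := by
          rw [← whisker_exchange]
          monoidal
      _ = _ := by
          rw [whisker_exchange]
          monoidal
  have h₂ (k : G) : E ((α_ _ _ _).inv ≫ (Γ ◁ r k⁻¹ ≫ μ[Γ]) ▷ X ≫ T.gram Γ X ≫
      (Δ[Γ] ≫ Γ ◁ r k) ▷ X ≫ (α_ _ _ _).hom) = averageMap (T.gram Γ X) := by
    have e₁ : (λ_ Γ).inv ≫ (η[Γ] ≫ Δ[Γ]) ▷ Γ ≫ (α_ _ _ _).hom ≫ Γ ◁ (Γ ◁ r k⁻¹ ≫ μ[Γ]) =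
        r k⁻¹ ≫ Δ[Γ] := by
      rw [MonoidalCategory.whiskerLeft_comp, ← associator_naturality_right_assoc,
        ← whisker_exchange_assoc, comp_whiskerRight, Category.assoc, hΓ.frobenius_left,
        MonObj.one_mul_assoc]
      simp
    have e₂ : Γ ◁ (Δ[Γ] ≫ Γ ◁ r k) ≫ (α_ _ _ _).inv ≫ (μ[Γ] ≫ ε[Γ]) ▷ Γ ≫ (λ_ Γ).hom =
        μ[Γ] ≫ r k := by
      have h := hΓ.frobenius_right
      rw [MonoidalCategory.whiskerLeft_comp, Category.assoc,
        associator_inv_naturality_right_assoc, whisker_exchange_assoc, comp_whiskerRight,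
        Category.assoc, reassoc_of% h, counit_comul_assoc]
      simp
    calc _ = ((λ_ Γ).inv ≫ (η[Γ] ≫ Δ[Γ]) ▷ Γ ≫ (α_ _ _ _).hom ≫ Γ ◁ (Γ ◁ r k⁻¹ ≫ μ[Γ])) ▷ X ⊗≫
          Γ ◁ T.gram Γ X ⊗≫ (Γ ◁ (Δ[Γ] ≫ Γ ◁ r k) ≫ (α_ _ _ _).inv ≫ (μ[Γ] ≫ ε[Γ]) ▷ Γ ≫
            (λ_ Γ).hom) ▷ X := by
          simp only [E]
          monoidal
      _ = r k⁻¹ ▷ X ≫ averageMap (T.gram Γ X) ≫ r k ▷ X := by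
          rw [e₁, e₂, averageMap]
          monoidal
      _ = _ := by
          rw [← hr.averageMap_invariant hinv k, ← comp_whiskerRight_assoc, ← hr.mul,
            mul_inv_cancel, hr.one]
          simp
  have h₃ : n • u₀ = ∑ k, (α_ _ _ _).inv ≫ (Γ ◁ r k⁻¹ ≫ μ[Γ]) ▷ X ≫ T.gram Γ X ≫
      (Δ[Γ] ≫ Γ ◁ r k) ▷ X ≫ (α_ _ _ _).hom := by
    have h := congrArg (fun v => (α_ _ _ _).inv ≫ v ▷ X ≫ T.gram (Γ ⊗ Γ) X ≫ (α_ _ _ _).hom)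
      hr.sum_comul
    simp only [MonoidalLinear.smul_whiskerRight, Linear.smul_comp, Linear.comp_smul,
      sum_whiskerRight, Preadditive.sum_comp, Preadditive.comp_sum, id_whiskerRight,
      Category.id_comp] at h
    rw [← h]
    refine Finset.sum_congr rfl fun k _ => ?_
    rw [← reassoc_of% (T.gram_natural (Δ[Γ] ≫ Γ ◁ r k) X)]
    simp only [comp_whiskerRight, Category.assoc]
  have hE : n • E u₀ = n • averageMap (T.gram Γ X) := by
    have e₁ : n • E u₀ = E (n • u₀) := by
      simp only [E, MonoidalLinear.whiskerLeft_smul, Linear.smul_comp, Linear.comp_smul]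
    have e₂ : E (n • u₀) = ∑ k, E ((α_ _ _ _).inv ≫ (Γ ◁ r k⁻¹ ≫ μ[Γ]) ▷ X ≫ T.gram Γ X ≫
        (Δ[Γ] ≫ Γ ◁ r k) ▷ X ≫ (α_ _ _ _).hom) := by
      rw [h₃]
      simp only [E, whiskerLeft_sum, Preadditive.sum_comp, Preadditive.comp_sum]
    rw [e₁, e₂, Finset.sum_congr rfl fun k _ => h₂ k, Finset.sum_const, Finset.card_univ,
      hr.degree, Nat.cast_smul_eq_nsmul]
  rw [h₁]
  have := congrArg (n⁻¹ • ·) hE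
  simpa only [smul_smul, inv_mul_cancel₀ hΓ.ne_zero, one_smul] using this

/-- The average of the Gram endomorphism is `1 ⊗ a` with `a` an endomorphism of `X`, and
`braiding_average` says that `1 ⊗ a` absorbs the Gram endomorphism. Positivity makes `a`
cancellable, so the Gram endomorphism is the identity. -/
theorem IsTranslations.star_braiding (hr : IsTranslations Γ n r) (hΓ : IsGaloisAlgebra Γ n)
    (hmul : T.star μ[Γ] = Δ[Γ]) (hone : T.star η[Γ] = ε[Γ])
    (hreg : ∀ {X Y : C} (f : X ⟶ Y), IsRegularHom f) (X : C) :
    T.star (β_ Γ X).hom = (β_ Γ X).inv := by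
  have hq := hr.averageMap_eq hΓ fun k => T.gram_natural (r k) X
  have hb := hr.braiding_average T hΓ X
  -- Half of the diagram of `a`, cut through the middle of the closed strand of `Γ`; the other half
  -- is its adjoint.
  let y : X ⟶ Γ ⊗ X ⊗ Γ :=
    (λ_ X).inv ≫ (η[Γ] ≫ Δ[Γ]) ▷ X ≫ (α_ _ _ _).hom ≫ Γ ◁ (β_ Γ X).hom
  have hcomul : T.star Δ[Γ] = μ[Γ] := by rw [← hmul, T.star_star]
  have ha : (λ_ X).inv ≫ η[Γ] ▷ X ≫ averageMap (T.gram Γ X) ≫ ε[Γ] ▷ X ≫ (λ_ X).hom =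
      y ≫ T.star y := by
    simp only [y, T.star_comp, T.star_whiskerLeft, T.star_whiskerRight, T.star_associator, hcomul,
      hone, T.star_leftUnitor_inv, averageMap, StarOperation.gram, comp_whiskerRight,
      MonoidalCategory.whiskerLeft_comp, Category.assoc]
  generalize (λ_ X).inv ≫ η[Γ] ▷ X ≫ averageMap (T.gram Γ X) ≫ ε[Γ] ▷ X ≫ (λ_ X).hom = a at hq hb ha
  -- Undoing the braiding in `y` and closing the strand gives the scalar `ε ∘ m ∘ Δ ∘ η = n`, which
  -- is invertible.
  have hy : ∀ {Z : C} (s : Z ⟶ X), s ≫ y = 0 → s = 0 := fun {Z} s hs => by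
    have e : y ≫ Γ ◁ (β_ Γ X).inv ≫ (α_ _ _ _).inv ≫ (μ[Γ] ≫ ε[Γ]) ▷ X ≫ (λ_ X).hom = n • 𝟙 X := by
      have h : (η[Γ] ≫ Δ[Γ]) ≫ μ[Γ] ≫ ε[Γ] = n • 𝟙 _ := by
        have h₁ := hΓ.comul_mul
        rw [Category.assoc, reassoc_of% h₁, Linear.smul_comp, Category.id_comp, Linear.comp_smul,
          hΓ.one_counit]
      simp only [y, Category.assoc, whiskerLeft_hom_inv_assoc, Iso.hom_inv_id_assoc]
      rw [← comp_whiskerRight_assoc, h, MonoidalLinear.smul_whiskerRight, Linear.smul_comp,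
        Linear.comp_smul]
      simp
    have h := congrArg (s ≫ ·) e
    simp only [reassoc_of% hs, zero_comp, Linear.comp_smul, Category.comp_id] at h
    exact (smul_eq_zero.mp h.symm).resolve_left hΓ.ne_zero
  have hmono : Mono a := Preadditive.mono_of_cancel_zero _ fun {Z} s hs => hy s (T.positive _ (by
    rw [T.star_comp, Category.assoc]
    rw [ha] at hs
    rw [reassoc_of% hs, zero_comp]))
  obtain ⟨b, hab⟩ := exists_retraction_of_mono hreg a
  have hq' : Γ ◁ a ≫ T.gram Γ X = Γ ◁ a := by
    rw [StarOperation.gram, BraidedCategory.braiding_naturality_right_assoc, hb, hq]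
  -- As `a` is self-adjoint, a retraction of it becomes a section on taking adjoints.
  have hba : T.star b ≫ a = 𝟙 X := by
    have h := congrArg T.star hab
    rw [T.star_comp, T.star_id, ha, T.star_comp, T.star_star, ← ha] at h
    exact h
  have hg : T.gram Γ X = 𝟙 _ := by
    have h := congrArg (Γ ◁ T.star b ≫ ·) hq'
    rwa [← MonoidalCategory.whiskerLeft_comp_assoc, ← MonoidalCategory.whiskerLeft_comp, hba,
      MonoidalCategory.whiskerLeft_id, Category.id_comp] at h
  rw [← cancel_epi (β_ Γ X).hom, Iso.hom_inv_id]
  exact hg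

end unitary

/-! ### The star operation of the crossed product -/

section crossed

variable {F : Type u} [Field F] {φ : F ≃+* ℂ} {C : Type v} [Category.{w} C] [Preadditive C]
  [Linear F C] [MonoidalCategory C] [MonoidalPreadditive C] [MonoidalLinear F C]
  [IsStrictMonoidal C] [BraidedCategory C] (T : StarOperation φ C) {Γ : C} [MonObj Γ] [ComonObj Γ]
  {n : F} [IsCommComonObj Γ]

open Crossed

theorem cofreeMap_injective {X Y : C} {s t : Γ ⊗ X ⟶ Y} (h : cofreeMap s = cofreeMap t) :
    s = t := by
  rw [← cofreeMap_counit s, h, cofreeMap_counit]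

theorem cofreeMap_counit_comp {X Y : C} (s : X ⟶ Y) :
    cofreeMap (ε[Γ] ▷ X ≫ (λ_ X).hom ≫ s) = Γ ◁ s := by
  have key := Crossed.counit_comp (Γ := Γ) s (𝟙 _)
  simpa only [cofreeMap, Category.comp_id] using key

theorem cofreeMap_whiskerRight {X Y : C} (s : Γ ⊗ X ⟶ Y) (Z : C) :
    cofreeMap ((α_ Γ X Z).inv ≫ s ▷ Z) =
      (α_ Γ X Z).inv ≫ cofreeMap s ▷ Z ≫ (α_ Γ Y Z).hom := by
  simp only [cofreeMap]
  monoidal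

/-- On colinear extensions, whiskering on the left is conjugated by the braiding with `Γ`. The star
therefore respects it once that braiding is unitary. -/
theorem cofreeMap_whiskerLeft (Z : C) {X Y : C} (t : Γ ⊗ X ⟶ Y) :
    cofreeMap ((α_ Γ Z X).inv ≫ (β_ Γ Z).hom ▷ X ≫ (α_ Z Γ X).hom ≫ Z ◁ t) =
      (α_ Γ Z X).inv ≫ (β_ Γ Z).hom ▷ X ≫ (α_ Z Γ X).hom ≫ Z ◁ cofreeMap t ≫
        (α_ Z Γ Y).inv ≫ (β_ Γ Z).inv ▷ Y ≫ (α_ Γ Z Y).hom := by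
  have h := BraidedCategory.braiding_naturality_left Δ[Γ] Z
  rw [BraidedCategory.braiding_tensor_left_hom] at h
  simp only [cofreeMap]
  symm
  calc _ = 𝟙 _ ⊗≫ ((β_ Γ Z).hom ≫ Z ◁ Δ[Γ]) ▷ X ⊗≫ ((Z ⊗ Γ) ◁ t ≫ (β_ Γ Z).inv ▷ Y) ⊗≫ 𝟙 _ := by
        monoidal
    _ = 𝟙 _ ⊗≫ (Δ[Γ] ▷ Z ≫ (α_ Γ Γ Z).hom ≫ Γ ◁ (β_ Γ Z).hom ≫ (α_ Γ Z Γ).inv ≫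
          ((β_ Γ Z).hom ≫ (β_ Γ Z).inv) ▷ Γ) ▷ X ⊗≫ (Γ ⊗ Z) ◁ t ⊗≫ 𝟙 _ := by
        rw [← h, whisker_exchange]
        monoidal
    _ = _ := by
        rw [Iso.hom_inv_id]
        monoidal

/-- Colinear extensions are linear, and since `m* = Δ` the adjoint of a linear map is colinear. So
the star of `C` acts on morphisms of the crossed product. -/
theorem IsGaloisAlgebra.cofreeMap_star (hΓ : IsGaloisAlgebra Γ n)
    (hmul : T.star μ[Γ] = Δ[Γ]) {X Y : C} (s : Γ ⊗ X ⟶ Y) :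
    cofreeMap (T.star (cofreeMap s) ≫ ε[Γ] ▷ X ≫ (λ_ X).hom) = T.star (cofreeMap s) := by
  apply cofreeMap_of_colinear
  have h := congrArg T.star (hΓ.cofreeMap_linear s)
  simp only [T.star_comp, T.star_whiskerLeft, T.star_whiskerRight, T.star_associator_inv, hmul,
    Category.assoc] at h
  exact h

/-- The star operation of the crossed product. -/
def StarOperation.crossed (hΓ : IsGaloisAlgebra Γ n) (hmul : T.star μ[Γ] = Δ[Γ])
    (hβ : ∀ X, T.star (β_ Γ X).hom = (β_ Γ X).inv) : StarOperation φ (Crossed Γ) :=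
  let st {X Y : Crossed Γ} (s : X ⟶ Y) : Y ⟶ X :=
    ⟨T.star (cofreeMap s.hom) ≫ ε[Γ] ▷ X.obj ≫ (λ_ X.obj).hom⟩
  have hst {X Y : Crossed Γ} (s : X ⟶ Y) :
      cofreeMap (st s).hom = T.star (cofreeMap s.hom) := hΓ.cofreeMap_star T hmul s.hom
  have hext {X Y : Crossed Γ} {s t : X ⟶ Y} (h : cofreeMap s.hom = cofreeMap t.hom) : s = t :=
    Hom.ext (cofreeMap_injective h)
  have hcomp {X Y Z : Crossed Γ} (s : X ⟶ Y) (t : Y ⟶ Z) :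
      cofreeMap (s ≫ t).hom = cofreeMap s.hom ≫ cofreeMap t.hom := by
    rw [comp_hom', cofreeMap_comp]
  have st_comp {X Y Z : Crossed Γ} (s : X ⟶ Y) (t : Y ⟶ Z) : st (s ≫ t) = st t ≫ st s :=
    hext (by rw [hst, hcomp, hcomp, T.star_comp, hst, hst])
  have st_right {X Y : Crossed Γ} (s : X ⟶ Y) (Z : Crossed Γ) : st (s ▷ Z) = st s ▷ Z :=
    hext (by
      rw [hst, whiskerRight_hom, whiskerRight_hom]
      refine (congrArg T.star (cofreeMap_whiskerRight s.hom Z.obj)).trans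
        (Eq.trans ?_ (cofreeMap_whiskerRight (st s).hom Z.obj).symm)
      simp only [T.star_comp, T.star_whiskerRight, T.star_associator, T.star_associator_inv, hst,
        Category.assoc])
  have hβ' (X : C) : T.star (β_ Γ X).inv = (β_ Γ X).hom := by rw [← hβ, T.star_star]
  have st_left (Z : Crossed Γ) {X Y : Crossed Γ} (s : X ⟶ Y) : st (Z ◁ s) = Z ◁ st s :=
    hext (by
      rw [hst, whiskerLeft_hom, whiskerLeft_hom]
      refine (congrArg T.star (cofreeMap_whiskerLeft Z.obj s.hom)).trans
        (Eq.trans ?_ (cofreeMap_whiskerLeft Z.obj (st s).hom).symm)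
      simp only [T.star_comp, T.star_whiskerRight, T.star_whiskerLeft, T.star_associator,
        T.star_associator_inv, hst, hβ, hβ', Category.assoc])
  { star := st
    star_star := fun s => hext (by rw [hst, hst, T.star_star])
    star_comp := st_comp
    star_tensor := fun s t => by
      rw [MonoidalCategory.tensorHom_def, st_comp, st_right, st_left,
        MonoidalCategory.tensorHom_def']
    star_add := fun {X Y} s t => by
      ext
      change T.star (cofreeMap (s.hom + t.hom)) ≫ _ = T.star (cofreeMap s.hom) ≫ _ +
        T.star (cofreeMap t.hom) ≫ _
      rw [← Preadditive.add_comp, ← T.star_add]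
      simp [cofreeMap]
    star_smul := fun {X Y} a s => by
      ext
      change T.star (cofreeMap (a • s.hom)) ≫ _ = _ • (T.star (cofreeMap s.hom) ≫ _)
      rw [← Linear.smul_comp, ← T.star_smul]
      simp [cofreeMap]
    positive := fun {X Y} s h => hext (by
      have h₁ := congrArg (fun u => cofreeMap (Hom.hom u)) h
      have h₂ : cofreeMap (Hom.hom (0 : X ⟶ X)) = 0 := by simp [cofreeMap, zero_hom]
      have h₃ : cofreeMap (Hom.hom (0 : X ⟶ Y)) = 0 := by simp [cofreeMap, zero_hom]
      rw [hcomp, hst, h₂] at h₁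
      rw [T.positive _ h₁, h₃]) }

theorem StarOperation.crossed_incl (hΓ : IsGaloisAlgebra Γ n) (hmul : T.star μ[Γ] = Δ[Γ])
    (hβ : ∀ X, T.star (β_ Γ X).hom = (β_ Γ X).inv) {X Y : C} (s : X ⟶ Y) :
    (T.crossed hΓ hmul hβ).star ((incl Γ).map s) = (incl Γ).map (T.star s) := by
  refine Hom.ext (cofreeMap_injective ?_)
  refine (hΓ.cofreeMap_star T hmul _).trans ?_
  refine (congrArg T.star (cofreeMap_counit_comp s)).trans
    (Eq.trans ?_ (cofreeMap_counit_comp (T.star s)).symm)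
  exact T.star_whiskerLeft _ _

end crossed

end

section

open MonObj ComonObj

/-! ### Dimensions in the crossed product -/

section additive

variable {F : Type u} [Field F] {D : Type v} [Category.{w} D] [Preadditive D] [Linear F D]
  [MonoidalCategory D]

theorem PivotalStructure.leftTrace_sum [MonoidalPreadditive D] (P : PivotalStructure D) {X : D}
    {J : Type*} (s : Finset J) (f : J → (X ⟶ X)) :
    P.leftTrace (∑ j ∈ s, f j) = ∑ j ∈ s, P.leftTrace (f j) := by
  simp only [leftTrace]
  rw [whiskerLeft_sum, Preadditive.sum_comp, Preadditive.comp_sum]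

/-- The dimension is additive. -/
theorem IsLinearTensor.dim_eq_sum (h : IsLinearTensor F D) (P : PivotalStructure D) {X : D}
    {J : Type*} [Fintype J] {Y : J → D} (i : ∀ j, Y j ⟶ X) (p : ∀ j, X ⟶ Y j)
    (hip : ∀ j, i j ≫ p j = 𝟙 _) (ht : ∑ j, p j ≫ i j = 𝟙 X) :
    P.dim F X = ∑ j, P.dim F (Y j) := by
  have := h.preadditive
  apply h.dim_eq P
  rw [← ht, P.leftTrace_sum, Finset.sum_smul]
  refine Finset.sum_congr rfl fun j _ => ?_
  rw [← P.leftTrace_retract _ _ (hip j), h.leftTrace_id]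

theorem IsLinearTensor.isAdditiveDim (h : IsLinearTensor F D) (P : PivotalStructure D) :
    IsAdditiveDim (P.dim F) :=
  fun _ d => h.dim_eq_sum P d.incl d.proj d.incl_proj d.total

theorem IsLinearTensor.isAdditiveDim_fullSubcategory (h : IsLinearTensor F D)
    (P : PivotalStructure D) (S : ObjectProperty D) :
    IsAdditiveDim fun X : S.FullSubcategory => P.dim F X.obj := fun X d =>
  h.dim_eq_sum P (fun j => S.ι.map (d.incl j)) (fun j => S.ι.map (d.proj j))
    (fun j => by rw [← Functor.map_comp, d.incl_proj]; exact S.ι.map_id _) (by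
      simp only [← Functor.map_comp]
      rw [← S.ι.map_sum, d.total]
      exact S.ι.map_id _)

end additive

section crossed

variable {F : Type u} [Field F] {C : Type v} [Category.{w} C] [Preadditive C]
    [Linear F C] [MonoidalCategory C] [MonoidalPreadditive C] [MonoidalLinear F C]
    [BraidedCategory C] {Γ : C} [MonObj Γ] [ComonObj Γ] [IsCommMonObj Γ] {n : F}

/-- With trivial twist, the chosen pairings of `Γ` may be replaced by the Frobenius ones. The closed
loop then becomes `m ∘ Δ = n` applied to the unit. -/
theorem IsGaloisAlgebra.comul_leftTrace (hΓ : IsGaloisAlgebra Γ n) (P : PivotalStructure C)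
    (hθ : P.twist Γ = 𝟙 Γ) :
    P.coevTilde Γ ≫ P.dual Γ ◁ Δ[Γ] ≫ (α_ _ _ _).inv ≫ P.ev Γ ▷ Γ ≫ (λ_ Γ).hom = n • η[Γ] := by
  obtain ⟨e, he⟩ := P.exists_evTilde (μ[Γ] ≫ ε[Γ])
  have hc : (η[Γ] ≫ Δ[Γ]) ≫ e ▷ Γ = P.coevTilde Γ :=
    coevaluation_comp_of_evaluation hΓ.pairing (P.leftPairing Γ) e he
  have hev : e ▷ Γ ≫ P.ev Γ = μ[Γ] ≫ ε[Γ] := by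
    have h : P.ev Γ = (β_ (P.dual Γ) Γ).hom ≫ P.evTilde Γ := by
      have h := P.twist_evTilde Γ
      rw [hθ, id_whiskerRight, Category.id_comp] at h
      rw [← h, Iso.hom_inv_id_assoc]
    rw [h, BraidedCategory.braiding_naturality_left_assoc, he, IsCommMonObj.mul_comm_assoc]
  have hf := hΓ.frobenius_right
  have hm := hΓ.comul_mul
  rw [← hc, Category.assoc, Category.assoc, ← whisker_exchange_assoc,
    associator_inv_naturality_left_assoc, ← comp_whiskerRight_assoc, hev, comp_whiskerRight,
    Category.assoc, reassoc_of% hf, reassoc_of% hm, counit_comul_assoc]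
  simp

/-- Tracing over `Γ` first leaves `n` times the unit in the `Γ` input of `s`. This is the source of
the factor `|G|` in the dimension formula. -/
theorem IsGaloisAlgebra.leftTrace_cofreeMap (hΓ : IsGaloisAlgebra Γ n) (P : PivotalStructure C)
    (hθ : P.twist Γ = 𝟙 Γ) {X : C} (s : Γ ⊗ X ⟶ X) :
    P.leftTrace (cofreeMap s) = n • P.leftTrace ((λ_ X).inv ≫ η[Γ] ▷ X ≫ s) := by
  have h : (λ_ X).inv ≫ P.coevTilde Γ ▷ X ≫ (α_ _ _ _).hom ≫ P.dual Γ ◁ cofreeMap s ≫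
      (α_ _ _ _).inv ≫ P.ev Γ ▷ X ≫ (λ_ X).hom = (λ_ X).inv ≫ (n • η[Γ]) ▷ X ≫ s := by
    rw [← hΓ.comul_leftTrace P hθ, cofreeMap]
    calc
      _ = (λ_ X).inv ≫ P.coevTilde Γ ▷ X ⊗≫ P.dual Γ ◁ Δ[Γ] ▷ X ⊗≫
          ((P.dual Γ ⊗ Γ) ◁ s ≫ P.ev Γ ▷ X) ⊗≫ 𝟙 X := by monoidal
      _ = _ := by
        rw [whisker_exchange]
        monoidal
  rw [P.leftTrace_tensor, h, MonoidalLinear.smul_whiskerRight]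
  simp [PivotalStructure.leftTrace]

variable [IsCommComonObj Γ] {P : PivotalStructure C}
  (hev : (β_ Γ (P.dual Γ)).hom ≫ P.ev Γ = P.evTilde Γ)

theorem IsGaloisAlgebra.one_leftTrace_karoubi (hΓ : IsGaloisAlgebra Γ n)
    (h : IsLinearTensor F (Karoubi (Crossed Γ))) (Y : Karoubi (Crossed Γ)) :
    P.leftTrace ((λ_ Y.X.obj).inv ≫ η[Γ] ▷ Y.X.obj ≫ Y.p.hom) =
      ((Crossed.pivotalStructure P hev).karoubi.dim F Y) • 𝟙 (𝟙_ C) := by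
  have h₁ := congrArg Karoubi.Hom.f (h.leftTrace_id (Crossed.pivotalStructure P hev).karoubi Y)
  rw [PivotalStructure.karoubi_leftTrace] at h₁
  have h₂ := congrArg Crossed.Hom.hom h₁
  have h₃ := Crossed.one_leftTrace hev Y.p
  refine h₃.symm.trans ((congrArg (fun t => (λ_ _).inv ≫ η[Γ] ▷ 𝟙_ C ≫ t) h₂).trans ?_)
  change (λ_ (𝟙_ C)).inv ≫ η[Γ] ▷ 𝟙_ C ≫ (_ • (ε[Γ] ▷ 𝟙_ C ≫ (λ_ (𝟙_ C)).hom)) = _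
  rw [Linear.comp_smul, Linear.comp_smul, ← comp_whiskerRight_assoc, hΓ.one_counit]
  simp

/-- The dimension of an object of `C` does not change in the crossed product. -/
theorem IsGaloisAlgebra.dim_incl (hΓ : IsGaloisAlgebra Γ n) (hC : IsLinearTensor F C)
    (h : IsLinearTensor F (Karoubi (Crossed Γ))) (X : C) :
    (Crossed.pivotalStructure P hev).karoubi.dim F
      ((Crossed.incl Γ ⋙ toKaroubi (Crossed Γ)).obj X) = P.dim F X := by
  refine (hC.dim_eq P ?_).symm
  refine Eq.trans ?_ (hΓ.one_leftTrace_karoubi hev h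
    ((Crossed.incl Γ ⋙ toKaroubi (Crossed Γ)).obj X))
  congr 1
  change _ = (λ_ X).inv ≫ η[Γ] ▷ X ≫ ε[Γ] ▷ X ≫ (λ_ X).hom
  rw [← comp_whiskerRight_assoc, hΓ.one_counit]
  simp

/-- The idempotent of `Γ ⊗ X` that belongs to an object `(X, p)` of the crossed product. -/
theorem karoubi_cofreeMap_idem (Y : Karoubi (Crossed Γ)) :
    cofreeMap Y.p.hom ≫ cofreeMap Y.p.hom = cofreeMap Y.p.hom := by
  rw [← cofreeMap_comp, ← Crossed.comp_hom', Y.idem]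

variable [IsIdempotentComplete C]

/-- The image in `C` of an object of the crossed product, under the adjoint of the inclusion. -/
theorem exists_restriction (Y : Karoubi (Crossed Γ)) : ∃ (Z : C) (i : Z ⟶ Γ ⊗ Y.X.obj)
    (q : Γ ⊗ Y.X.obj ⟶ Z), i ≫ q = 𝟙 Z ∧ q ≫ i = cofreeMap Y.p.hom :=
  IsIdempotentComplete.idempotents_split _ _ (karoubi_cofreeMap_idem Y)

def restriction (Y : Karoubi (Crossed Γ)) : C := (exists_restriction Y).choose

def restrictionIncl (Y : Karoubi (Crossed Γ)) : restriction Y ⟶ Γ ⊗ Y.X.obj :=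
  (exists_restriction Y).choose_spec.choose

def restrictionProj (Y : Karoubi (Crossed Γ)) : Γ ⊗ Y.X.obj ⟶ restriction Y :=
  (exists_restriction Y).choose_spec.choose_spec.choose

theorem restrictionIncl_proj (Y : Karoubi (Crossed Γ)) :
    restrictionIncl Y ≫ restrictionProj Y = 𝟙 _ :=
  (exists_restriction Y).choose_spec.choose_spec.choose_spec.1

theorem restrictionProj_incl (Y : Karoubi (Crossed Γ)) :
    restrictionProj Y ≫ restrictionIncl Y = cofreeMap Y.p.hom :=
  (exists_restriction Y).choose_spec.choose_spec.choose_spec.2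

theorem IsGaloisAlgebra.dim_restriction (hΓ : IsGaloisAlgebra Γ n) (hθ : P.twist Γ = 𝟙 Γ)
    (hC : IsLinearTensor F C) (h : IsLinearTensor F (Karoubi (Crossed Γ)))
    (Y : Karoubi (Crossed Γ)) :
    P.dim F (restriction Y) = n * (Crossed.pivotalStructure P hev).karoubi.dim F Y := by
  apply hC.dim_eq P
  rw [P.leftTrace_retract _ _ (restrictionIncl_proj Y), restrictionProj_incl, hΓ.leftTrace_cofreeMap P hθ, hΓ.one_leftTrace_karoubi hev h, smul_smul]

variable (F) in
/-- The adjunction between restriction and the inclusion of `C`. -/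
def restrictionEquiv (Y : Karoubi (Crossed Γ)) (X : C) :
    (Y ⟶ (Crossed.incl Γ ⋙ toKaroubi (Crossed Γ)).obj X) ≃ₗ[F] (restriction Y ⟶ X) where
  toFun f := restrictionIncl Y ≫ Crossed.Hom.hom f.f
  map_add' f g := Preadditive.comp_add _ _ _ _ _ _
  map_smul' a f := Linear.comp_smul _ _ _ _ _ _
  invFun g := ⟨⟨restrictionProj Y ≫ g⟩, by
    refine (congrArg (Y.p ≫ ·) (Category.comp_id _)).trans (Crossed.hom_ext ?_)
    refine (Crossed.comp_hom' _ _).trans ?_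
    change cofreeMap Y.p.hom ≫ restrictionProj Y ≫ g = restrictionProj Y ≫ g
    rw [← restrictionProj_incl, Category.assoc, reassoc_of% restrictionIncl_proj Y]⟩
  left_inv f := by
    refine Karoubi.hom_ext _ _ (Crossed.hom_ext ?_)
    change restrictionProj Y ≫ restrictionIncl Y ≫ f.f.hom = f.f.hom
    rw [reassoc_of% restrictionProj_incl Y, ← Crossed.comp_hom', Karoubi.p_comp]
  right_inv g := (reassoc_of% restrictionIncl_proj Y) g

variable [IsAlgClosed F]

/-- The restriction of a simple `Y` is nonzero, since otherwise its idempotent would vanish. A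
projection onto a simple summand of it corresponds, under the adjunction, to a nonzero map from `Y`
into the image of a simple object of `C`. -/
theorem finite_simpleClass_crossed (F : Type u) [Field F] [Linear F C] [MonoidalLinear F C]
    (hCs : IsSemisimple C) (hD : IsSemisimple (Karoubi (Crossed Γ)))
    [Finite (SimpleClass C)] : Finite (SimpleClass (Karoubi (Crossed Γ))) := by
  have := hCs.kernels
  have := hD.kernels
  refine finite_simpleClass hD.hasSimpleDecompositions
    (Crossed.incl Γ ⋙ toKaroubi (Crossed Γ)) fun Y hY => ?_
  let d := (hCs.hasSimpleDecompositions (restriction Y)).some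
  obtain ⟨j, hj⟩ : ∃ j, d.proj j ≠ 0 := by
    by_contra! h0
    have h1 : 𝟙 (restriction Y) = 0 :=
      d.hom_eq_zero' _ fun j => by rw [Category.id_comp, h0]
    have h2 : cofreeMap Y.p.hom = 0 := by
      rw [← restrictionProj_incl, ← Category.comp_id (restrictionProj Y), h1, comp_zero, zero_comp]
    have h3 : Y.p = 0 := Crossed.hom_ext (by
      rw [← cofreeMap_counit Y.p.hom, h2, zero_comp]
      rfl)
    exact id_nonzero Y (Karoubi.hom_ext _ _ h3)
  refine ⟨d.summand j, d.simple j, (restrictionEquiv F Y _).symm (d.proj j), ?_⟩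
  rwa [Ne, LinearEquiv.map_eq_zero_iff]

theorem IsGaloisAlgebra.globalDim_eq_mul (hΓ : IsGaloisAlgebra Γ n) (hθ : P.twist Γ = 𝟙 Γ)
    (hC : IsLinearTensor F C) (hCs : IsSemisimple C) (h : IsLinearTensor F (Karoubi (Crossed Γ)))
    (hD : IsSemisimple (Karoubi (Crossed Γ))) [Finite (SimpleClass C)]
    [Finite (SimpleClass (Karoubi (Crossed Γ)))] :
    globalDim (P.dim F) = n * globalDim ((Crossed.pivotalStructure P hev).karoubi.dim F) := by
  have := hCs.kernels
  have := hD.kernels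
  exact GaloisExt.globalDim_eq_mul F hC.hom_finite h.hom_finite hCs.hasSimpleDecompositions
    hD.hasSimpleDecompositions (hC.isAdditiveDim P) (h.isAdditiveDim _)
    (Crossed.incl Γ ⋙ toKaroubi (Crossed Γ)).obj restriction n (hΓ.dim_incl hev hC h)
    (hΓ.dim_restriction hev hθ hC h) fun X Y => (restrictionEquiv F Y X).finrank_eq

end crossed

end

/-! ### The dimension of the symmetric subcategory -/

section reciprocity

open TannakaDuality.FiniteGroup

variable {F G : Type u} [Field F] [Group G] [Fintype G]

/-- Frobenius reciprocity for the regular representation: a morphism `V ⟶ F[G]` is determined by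
its value at `1`. -/
def regularHomEquiv (V : FDRep F G) : (V ⟶ regularRep F G) ≃ₗ[F] Module.Dual F V where
  toFun φ := LinearMap.proj (R := F) (φ := fun _ : G => F) 1 ∘ₗ
    (show V →ₗ[F] (G → F) from φ.hom.hom.hom)
  map_add' _ _ := rfl
  map_smul' _ _ := rfl
  invFun l :=
    { hom := InducedCategory.homMk (ModuleCat.ofHom
        (LinearMap.pi (φ := fun _ : G => F) fun g : G => l ∘ₗ V.ρ g⁻¹))
      comm := by
        intro s
        ext v
        refine funext fun t => ?_
        change l (V.ρ t⁻¹ (V.ρ s v)) = l (V.ρ (s⁻¹ * t)⁻¹ v)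
        rw [mul_inv_rev, inv_inv, map_mul]
        rfl }
  left_inv φ := by
    apply fdRep_hom_ext
    refine LinearMap.ext fun v => ?_
    refine funext fun t => ?_
    let φ' : V →ₗ[F] (G → F) := φ.hom.hom.hom
    have h : φ' (V.ρ t⁻¹ v) = leftRegular t⁻¹ (φ' v) := congrArg (fun u => u.hom.hom v) (φ.comm t⁻¹)
    change φ' (V.ρ t⁻¹ v) 1 = φ' v t
    rw [h, leftRegular_apply, inv_inv, mul_one]
  right_inv l := by
    refine LinearMap.ext fun v => ?_
    change l (V.ρ 1⁻¹ v) = l v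
    rw [inv_one, map_one]
    rfl

theorem finrank_hom_regularRep (V : FDRep F G) :
    Module.finrank F (V ⟶ regularRep F G) = Module.finrank F V := by
  rw [(regularHomEquiv V).finrank_eq, Subspace.dual_finrank_eq]

end reciprocity

section dim

variable {F G : Type u} [Field F] [CharZero F] [Group G] [Fintype G]
  {C : Type v} [Category.{w} C] [Preadditive C] [Linear F C] [MonoidalCategory C]
  [MonoidalPreadditive C] [MonoidalLinear F C]
  [BraidedCategory C] {P : PivotalStructure C} {S : ObjectProperty C} [S.IsMonoidal]
  (K : FDRep F G ⥤ S.FullSubcategory)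
  [K.Additive] [K.Linear F] [K.Braided] [K.IsEquivalence]

theorem dim_regularObj (hC : IsBTC F P) (hS : IsSubSTC P S) (hadm : IsAdmissible F P S) :
    P.dim F (regularObj S K) = (Fintype.card G : F) := by
  apply hC.toIsLinearTensor.dim_eq P
  rw [← regularEnd_id, leftTrace_regularObj K hC hS hadm]
  congr 1
  exact (LinearMap.trace_id F (G → F)).trans (by simp)

theorem finrank_hom_regularObj (V : FDRep F G) (X : S.FullSubcategory) (e : K.obj V ≅ X) :
    Module.finrank F (X ⟶ K.obj (regularRep F G)) = Module.finrank F V := by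
  rw [← finrank_hom_regularRep]
  refine LinearEquiv.finrank_eq ?_
  exact
    { toFun := fun f => K.preimage (e.hom ≫ f)
      map_add' := fun f g => K.map_injective (by simp)
      map_smul' := fun a f => K.map_injective (by simp)
      invFun := fun f => e.inv ≫ K.map f
      left_inv := fun f => by simp
      right_inv := fun f => K.map_injective (by simp) }

/-- The dimension of a simple object of `S` is that of the corresponding representation. -/
theorem dim_eq_finrank (hC : IsBTC F P) (hS : IsSubSTC P S) (hadm : IsAdmissible F P S)
    (X : S.FullSubcategory) [Simple X] :
    P.dim F X.obj = (Module.finrank F (X ⟶ K.obj (regularRep F G)) : F) := by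
  have := hS.semisimple.kernels
  let V := K.objPreimage X
  let e : K.obj V ≅ X := K.objObjPreimageIso X
  have hr := finrank_hom_regularObj K V X e
  rw [hr]
  -- By Frobenius reciprocity the maps into the regular representation form the dual of `V`, which
  -- is nonzero. So `X` is a retract of `Γ`, and its dimension is the trace of the corresponding
  -- idempotent matrix.
  obtain ⟨i, hi⟩ : ∃ i : X ⟶ K.obj (regularRep F G), i ≠ 0 := by
    by_contra! h0
    have : Subsingleton (X ⟶ K.obj (regularRep F G)) := ⟨fun a b => by rw [h0 a, h0 b]⟩
    rw [Module.finrank_zero_of_subsingleton] at hr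
    have hV : Subsingleton V := Module.finrank_zero_iff.mp hr.symm
    have h1 : 𝟙 V = 0 := fdRep_hom_ext (LinearMap.ext fun v => hV.elim _ _)
    apply id_nonzero X
    rw [← e.inv_hom_id, ← Category.id_comp e.hom, ← K.map_id, h1]
    simp
  obtain ⟨r, hir⟩ := (hS.semisimple.hasSimpleDecompositions _).some.exists_retraction i hi
  let i' : V ⟶ regularRep F G := K.preimage (e.hom ≫ i)
  let r' : regularRep F G ⟶ V := K.preimage (r ≫ e.inv)
  have h₁ : i' ≫ r' = 𝟙 V := K.map_injective (by simp [i', r', reassoc_of% hir])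
  have h₂ : K.map (r' ≫ i') = r ≫ i := by simp [i', r']
  have h₃ : S.ι.map i ≫ S.ι.map r = 𝟙 X.obj := by
    rw [← Functor.map_comp, hir]
    exact S.ι.map_id X
  have h₄ : S.ι.map r ≫ S.ι.map i = regularEnd S K (r' ≫ i') := by
    rw [← Functor.map_comp, ← h₂]
    rfl
  apply hC.toIsLinearTensor.dim_eq P
  refine (P.leftTrace_retract _ _ h₃).trans ((congrArg P.leftTrace h₄).trans ?_)
  refine (leftTrace_regularObj K hC hS hadm _).trans ?_
  congr 1
  let a : V →ₗ[F] (G → F) := i'.hom.hom.hom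
  let b : (G → F) →ₗ[F] V := r'.hom.hom.hom
  have hab : b ∘ₗ a = LinearMap.id :=
    congrArg (fun u : V ⟶ V => u.hom.hom.hom) h₁
  change LinearMap.trace F (G → F) (a ∘ₗ b) = _
  rw [LinearMap.trace_comp_comm', hab, LinearMap.trace_id]

/-- Each simple object occurs in `Γ` with multiplicity equal to its dimension. Hence `∑ d(X)²` is
the additive expansion of `d(Γ) = |G|`. -/
theorem globalDim_fullSubcategory (K : FDRep F G ⥤ S.FullSubcategory) [K.Additive] [K.Linear F]
    [K.Braided] [K.IsEquivalence] [IsAlgClosed F] (hC : IsBTC F P) (hS : IsSubSTC P S)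
    (hadm : IsAdmissible F P S) [Finite (SimpleClass S.FullSubcategory)] :
    globalDim (fun X : S.FullSubcategory => P.dim F X.obj) = (Fintype.card G : F) := by
  have := hS.semisimple.kernels
  have := Fintype.ofFinite (SimpleClass S.FullSubcategory)
  have hfin : ∀ X Y : S.FullSubcategory, FiniteDimensional F (X ⟶ Y) := fun X Y =>
    have : FiniteDimensional F (S.ι.obj X ⟶ S.ι.obj Y) := hC.hom_finite X.obj Y.obj
    FiniteDimensional.of_injective (S.ι.mapLinearMap F (X := X) (Y := Y)) S.ι.map_injective
  rw [globalDim, finsum_eq_sum_of_fintype, ← dim_regularObj K hC hS hadm]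
  refine Eq.trans ?_ ((hC.toIsLinearTensor.isAdditiveDim_fullSubcategory P S).eq_sum F hfin
    (hS.semisimple.hasSimpleDecompositions (K.obj (regularRep F G))).some).symm
  refine Finset.sum_congr rfl fun c _ => ?_
  have : Simple c.out.1 := c.out.2
  rw [← dim_eq_finrank K hC hS hadm, sq]

end dim

end GaloisExt

end

/-! ### The main theorem -/

theorem mainTheorem7 {F G : Type u} [Field F] [IsAlgClosed F] [CharZero F] [Group G] [Fintype G]
    {C : Type v} [Category.{w} C] [Preadditive C] [Linear F C]
    [MonoidalCategory C] [MonoidalPreadditive C] [MonoidalLinear F C] [IsStrictMonoidal C]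
    [BraidedCategory C] (P : PivotalStructure C) (hC : IsBTC F P)
    (S : ObjectProperty C) [S.IsMonoidal] (hS : IsSubSTC P S)
    (hfin : Finite (SimpleClass S.FullSubcategory)) (hadm : IsAdmissible F P S)
    (K : FDRep F G ⥤ S.FullSubcategory) [K.Additive] [K.Linear F] [K.Braided]
    [K.IsEquivalence] :
    -- `C ⋊₀ S` and `C ⋊ S` are strict tensor categories
    IsStrictMonoidal (CrossedZero S K) ∧ IsLinearTensor F (CrossedZero S K) ∧
    IsStrictMonoidal (CrossedProduct S K) ∧ IsLinearTensor F (CrossedProduct S K) ∧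
    -- `ι` is a faithful strict monoidal functor, injective on objects
    IsStrictMonoidalFunctor (inclZero S K) ∧ IsStrictMonoidalFunctor (inclProduct S K) ∧
    (inclProduct S K).Faithful ∧ Function.Injective (inclProduct S K).obj ∧
    -- `*`-structures
    (∀ (φ : F ≃+* ℂ) (T : StarOperation φ C),
      T.star (MonObj.mul (X := regularObj S K)) = ComonObj.comul →
      T.star (MonObj.one (X := regularObj S K)) = ComonObj.counit →
      (∃ T₀ : StarOperation φ (CrossedZero S K), ∀ (X Y : C) (s : X ⟶ Y),
        T₀.star ((inclZero S K).map s) = (inclZero S K).map (T.star s)) ∧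
      ∃ T₁ : StarOperation φ (CrossedProduct S K), ∀ (X Y : C) (s : X ⟶ Y),
        T₁.star ((inclProduct S K).map s) = (inclProduct S K).map (T.star s)) ∧
    -- `Aut(Γ, m, η)` is a group, isomorphic to `G`
    (∀ g : regularObj S K ⟶ regularObj S K, IsMonHom g → IsIso g) ∧
    Nonempty (G ≃* GaloisGroup S K) ∧
    -- it acts on `C ⋊₀ S` and `C ⋊ S`, with fixed point category `C`
    (∃ (A₀ : StrictAction (GaloisGroup S K) (CrossedZero S K))
      (A₁ : StrictAction (GaloisGroup S K) (CrossedProduct S K)),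
      (∀ g X, (A₀.functor g).obj X = X) ∧
      (∀ g (X Y : CrossedZero S K) (s : X ⟶ Y), HEq ((A₀.functor g).map s) (gammaHom g s)) ∧
      (∀ g, A₁.functor g = (functorExtension₂ _ _).obj (A₀.functor g)) ∧
      (∃ J₀ : C ⥤ A₀.Fixed, J₀ ⋙ A₀.forget = inclZero S K ∧ IsStrictMonoidalFunctor J₀ ∧
        Function.Bijective J₀.obj ∧ J₀.Full ∧ J₀.Faithful) ∧
      ∃ J₁ : C ⥤ A₁.Fixed, J₁ ⋙ A₁.forget = inclProduct S K ∧ IsStrictMonoidalFunctor J₁ ∧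
        J₁.IsEquivalence) ∧
    -- spherical structures extending that of `C`, semisimplicity and dimension
    (∃ P₀ : PivotalStructure (CrossedZero S K), P.Extends (inclZero S K) P₀ ∧ P₀.IsSpherical) ∧
    (∃ P₁ : PivotalStructure (CrossedProduct S K), P.Extends (inclProduct S K) P₁ ∧ IsTC F P₁ ∧
      (Finite (SimpleClass C) →
        Finite (SimpleClass (CrossedProduct S K)) ∧
        globalDim (P₁.dim F) = globalDim (P.dim F) / (Nat.card (GaloisGroup S K) : F) ∧
        globalDim (P₁.dim F) =
          globalDim (P.dim F) / globalDim fun X : S.FullSubcategory => P.dim F X.obj)) ∧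
    globalDim (fun X : S.FullSubcategory => P.dim F X.obj) = (Nat.card (GaloisGroup S K) : F) := by
  have hΓ : IsGaloisAlgebra (F := F) (regularObj S K) (Fintype.card G : F) := regularObj_isGaloisAlgebra S K
  have hr := regularObj_isTranslations S K
  have hreg : ∀ {X Y : C} (f : X ⟶ Y), IsRegularHom f := hC.semisimple.isRegularHom
  have hreg₀ : ∀ {X Y : CrossedZero S K} (f : X ⟶ Y), IsRegularHom f := hΓ.isRegularHom hreg
  have := hC.semisimple.finiteProducts
  have := HasFiniteBiproducts.of_hasFiniteProducts (C := C)
  have := hC.semisimple.isIdempotentComplete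
  have hθ := twist_regularObj K hC hS hadm
  have hev := regularObj_braiding_ev K hC hS hadm
  have hL₀ : IsLinearTensor F (CrossedZero S K) :=
    Crossed.isLinearTensor F hC.hom_finite (hΓ.bijective_counit hC.end_unit)
  have hL₁ : IsLinearTensor F (CrossedProduct S K) := karoubi_isLinearTensor F hL₀
  have hss : IsSemisimple (CrossedProduct S K) := isSemisimple_of_isRegularHom F
    (fun f => karoubi_isRegularHom hreg₀ f) fun X => hL₁.hom_finite X X
  let e : G ≃* GaloisGroup S K := MulEquiv.ofBijective hr.toAut hr.toAut_bijective
  have hcard : (Nat.card (GaloisGroup S K) : F) = (Fintype.card G : F) := by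
    rw [← Nat.card_congr e.toEquiv, Nat.card_eq_fintype_card]
  have hsph := hΓ.isSpherical hC.ribbon.isSpherical hev
  have hdimS := globalDim_fullSubcategory K hC hS hadm
  have hE := (Crossed.pivotalStructure P hev).karoubi_extends
  refine ⟨inferInstance, hL₀, inferInstance, hL₁, Crossed.isStrictMonoidalFunctor_incl _,
    isStrictMonoidalFunctor_inclKaroubi, ⟨fun h => hΓ.incl_injective
      (congrArg Karoubi.Hom.f h)⟩, fun X Y h => congrArg (fun Z => Z.X.obj) h, ?_, ?_, ⟨e⟩,
    ⟨gammaAction hr.isComonHom, (gammaAction hr.isComonHom).karoubi, fun _ _ => rfl,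
      fun _ _ _ _ => HEq.rfl, fun _ => rfl,
      ⟨inclFixed hr.isComonHom, rfl, isStrictMonoidalFunctor_inclFixed _, inclFixed_bijective _,
        hr.inclFixed_full hΓ.ne_zero, hr.inclFixed_faithful hΓ⟩,
      ⟨inclKaroubiFixed hr.isComonHom, rfl, isStrictMonoidalFunctor_inclKaroubiFixed _,
        hr.inclKaroubiFixed_isEquivalence hΓ⟩⟩,
    ⟨Crossed.pivotalStructure P hev, Crossed.extends_pivotalStructure P hev, hsph⟩,
    ⟨(Crossed.pivotalStructure P hev).karoubi,
      -- The structure on `C ⋊₀ S` restricts to that of `C` definitionally, so extension along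
      -- `toKaroubi` already is extension along `ι`.
      ⟨fun X => hE.dual_obj (.of X), fun X => hE.ev_eq (.of X), fun X => hE.coev_eq (.of X),
        fun X => hE.evTilde_eq (.of X), fun X => hE.coevTilde_eq (.of X)⟩,
      ⟨hL₁, hss, PivotalStructure.karoubi_isSpherical _ hsph⟩, fun _ => ?_⟩, ?_⟩
  · intro φ T hmul hone
    let T₀ := T.crossed hΓ hmul (hr.star_braiding T hΓ hmul hone hreg)
    have hT₀ : ∀ (X Y : C) (s : X ⟶ Y),
        T₀.star ((inclZero S K).map s) = (inclZero S K).map (T.star s) := fun X Y s =>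
      T.crossed_incl hΓ hmul (hr.star_braiding T hΓ hmul hone hreg) s
    exact ⟨⟨T₀, hT₀⟩, T₀.karoubi hreg₀, fun X Y s => (T₀.karoubi_toKaroubi hreg₀ _).trans
      (congrArg (toKaroubi _).map (hT₀ X Y s))⟩
  · intro g hg
    obtain ⟨k, rfl⟩ := hr.exists_eq g hg
    exact hr.isIso k
  · have hfin₁ := finite_simpleClass_crossed (Γ := regularObj S K) F hC.semisimple hss
    have h := hΓ.globalDim_eq_mul hev hθ hC.toIsLinearTensor hC.semisimple hL₁ hss
    have hdiv : globalDim ((Crossed.pivotalStructure P hev).karoubi.dim F) =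
        globalDim (P.dim F) / (Fintype.card G : F) := by
      rw [h, mul_div_cancel_left₀ _ hΓ.ne_zero]
    exact ⟨hfin₁, by rw [hcard, hdiv], by rw [hdimS, hdiv]⟩
  · rw [hcard, hdimS]
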